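/- Let $2\le q<r$ be integers. Let $\mathbb T_q$ be the homogeneous tree of degree $q+1$ with a fixed reference end $\omega$ and Busemann (horocycle) function $\mathfrak h:\mathbb T_q\to\mathbb Z$; every vertex $x$ has one predecessor $x^-$ (its neighbour towards $\omega$), with $\mathfrak h(x^-)=\mathfrak h(x)-1$, and $q$ successors; write $a\preceq x$ if $a$ lies on the geodesic from $x$ to $\omega$. The Diestel–Leader graph $DL(q,r)$ has the vertices $x_1x_2\in\mathbb T_q\times\mathbb T_r$ with $\mathfrak h(x_1)+\mathfrak h(x_2)=0$, and $x_1x_2\sim y_1y_2$ iff $x_1\sim y_1$ and $x_2\sim y_2$. For $a_1\in\mathbb T_q$, $a_2\in\mathbb T_r$ with $-\mathfrak h(a_2)=\mathfrak h(a_1)+n$, $n\ge 0$, the tetrahedron $S(a_1,a_2)$ of height $n$ is the subgraph induced on $\{x_1x_2\in DL(q,r): a_1\preceq x_1,\ a_2\preceq x_2\}$. The cumulative spectral measure of a finite graph $X$ is $\frac1{|X|}\sum_{\lambda}\mathrm{mult}(\lambda)\,\delta_\lambda$, the sum being over the eigenvalues of the transition operator $Pf(x)=\frac1{\deg x}\sum_{y\sim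 x}f(y)$ of simple random walk on $X$ itself (with degrees taken in $X$). The Plancherel measure of $DL(q,r)$ is the spectral measure $\mu_{x,x}$ of simple random walk at a vertex $x$ (by transitivity it does not depend on $x$), i.e. the probability measure on $[-1,1]$ whose $N$-th moment is the return probability $p^{(N)}(x,x)$ for all $N\ge0$. Put $\rho=\dfrac{2\sqrt{qr}}{q+r}$, $K=\dfrac{r+q}{r-q}$ and, for $N\ge 2$ and $1\le m\le N-1$, $\lambda_{m,N}=\rho\cos\left(\frac mN\pi\right)$. For $N\ge 1$ consider the equation $$\cot(N\alpha)=\frac{r-q}{r+q}\cot\alpha,\qquad \alpha\in(0,\pi).\tag{1}$$ **(a)** If $N<K$, equation (1) has exactly $N$ solutions $\alpha_{0,N},\dots,\alpha_{N-1,N}$. If $N\ge K$, it has exactly $N-2$ solutions $\alpha_{1,N},\dots,\alpha_{N-2,N}$. If $N=K$, put moreover $\alpha_{0,N}=0$ and $\alpha_{N-1,N}=\pi$. If $N>K$, there is exactly one $\alpha_{0,N}>0$ with $$e^{2N\alpha_{0,N}}=\frac{q-r\,e^{2\alpha_{0,N}}}{q\,e^{2\alpha_{0,N}}-r}.$$ Put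 $\lambda'_{m,N}=\rho\cos\alpha_{m,N}$ (for $0\le m\le N-1$ if $N\le K$, for $1\le m\le N-2$ if $N>K$), and $\lambda'_{0,N}=\rho\cosh\alpha_{0,N}$ if $N>K$. **(b)** Let $(S_n)$ be a sequence of tetrahedra in $DL(q,r)$ whose heights tend to infinity (for instance an increasing sequence of tetrahedra with union $DL(q,r)$). Then the cumulative spectral measures $\tilde\mu_n$ of $S_n$ converge weakly to the probability measure $\tilde\mu+\tilde\nu$, where $$\begin{aligned}\tilde\mu={}&(q-1)(r-1)\sum_{N=2}^\infty r^{-N}\sum_{m=1}^{N-1}\delta_{\lambda_{m,N}}+(r-q)(r-1)\sum_{1\le N\le K}r^{-N-1}\sum_{m=0}^{N-1}\delta_{\lambda'_{m,N}}\\&+(r-q)(r-1)\sum_{N>K}r^{-N-1}\sum_{m=1}^{N-2}\delta_{\lambda'_{m,N}},\\ \tilde\nu={}&(r-q)(r-1)\sum_{N>K}r^{-N-1}\bigl(\delta_{\lambda'_{0,N}}+\delta_{-\lambda'_{0,N}}\bigr).\end{aligned}$$ **(c)** The support of $\tilde\mu$ is the interval $[-\rho,\rho]$. **(d)** The measure $\tilde\nu$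 is carried by its set of atoms, which is $\{\pm\lambda'_{0,N}:N>K\}$. This set is contained in $(-1,-\rho)\cup(\rho,1)$, and the closed support of $\tilde\nu$ is contained in $[-1,-\rho]\cup[\rho,1]$. The sequence $(\lambda'_{0,N})_{N>K}$ is strictly increasing with limit $1$. **(e)** In particular, $\tilde\mu+\tilde\nu$ is not the Plancherel measure of $DL(q,r)$. -/

import Mathlib

open MeasureTheory Filter Topology Set
open scoped ENNReal BoundedContinuousFunction

noncomputable section

namespace DiestelLeader

/-! ## Simple random walk on a graph and its spectral measures -/

section SRW

variable {V : Type*} (G : SimpleGraph V) [G.LocallyFinite]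

/-- The transition operator `P f (x) = ∑_{y ∼ x} f y / deg x` of simple random walk on a locally
finite graph, acting on all real functions on the vertex set. -/
def srwOp : (V → ℝ) →ₗ[ℝ] (V → ℝ) where
  toFun f x := (G.degree x : ℝ)⁻¹ * ∑ y ∈ G.neighborFinset x, f y
  map_add' f g := by
    funext x
    simp [Finset.sum_add_distrib, mul_add]
  map_smul' c f := by
    funext x
    simp [Finset.mul_sum, mul_left_comm]

open Classical in
/-- The `N`-step transition probability `p^(N)(x, y)`, the matrix element `(P^N δ_y)(x)`. -/
def stepProb (N : ℕ) (x y : V) : ℝ := ((srwOp G) ^ N) (Pi.single y 1) x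

/-- `κ` is the spectral measure `μ_{x,x}` of simple random walk at the vertex `x`: the probability
measure on `[-1, 1]` whose moments are the return probabilities `p^(N)(x, x)`. (As it lives on a
compact interval, it is uniquely determined by its moments.) If the graph is vertex-transitive, it
does not depend on `x` and is called the Plancherel measure of the graph. -/
def IsSpectralMeasureAt (x : V) (κ : Measure ℝ) : Prop :=
  IsProbabilityMeasure κ ∧ κ (Icc (-1) 1)ᶜ = 0 ∧
    ∀ N : ℕ, ∫ t, t ^ N ∂κ = stepProb G N x x

/-- The cumulative spectral measure of a finite graph,
`(1 / |V|) ∑_{λ ∈ spec P} mult(λ) δ_λ`. (The operator `P` is self-adjoint with respect to the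
inner product weighted by the degrees, so its eigenvalues are real and the multiplicity of an
eigenvalue is the dimension of its eigenspace.) -/
def cumulativeSpectralMeasure [Finite V] : Measure ℝ :=
  (Nat.card V : ℝ≥0∞)⁻¹ •
    Measure.sum fun l : Module.End.Eigenvalues (srwOp G) =>
      (Module.finrank ℝ (Module.End.eigenspace (srwOp G) (l : ℝ)) : ℝ≥0∞) • Measure.dirac (l : ℝ)

end SRW

/-! ## The homogeneous tree with a reference end -/

/-- A vertex of the homogeneous tree of degree `q + 1` with a reference end `ω`. Every edge from a
vertex to one of its `q` successors carries a label in `{0, …, q - 1}`. A vertex on the horocycle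
`H_hor` is given by the labels along its geodesic to `ω`: `lab m` is the label of the edge of that
geodesic that leads from `H_{m-1}` to `H_m`, for `m ≤ hor`. All but finitely many of them are `0`.
(For `m > hor`, `lab m` has no meaning and is set to `0`.) -/
@[ext] structure Tree (q : ℕ) where
  /-- the horocycle number (Busemann function) -/
  hor : ℤ
  /-- the labels on the geodesic to the reference end -/
  lab : ℤ →₀ ℕ
  lab_lt : ∀ m, lab m < q
  lab_eq_zero : ∀ m, hor < m → lab m = 0

/-- `a.IsAncestor x` is the order relation `a ≼ x`: the vertex `a` lies on the geodesic from `x` to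
the reference end (`a = x` is allowed). -/
def Tree.IsAncestor {q : ℕ} (a x : Tree q) : Prop :=
  a.hor ≤ x.hor ∧ ∀ m ≤ a.hor, x.lab m = a.lab m

/-- `y` is one of the `q` successors of `x`, i.e. `x` is the predecessor `y⁻` of `y`. -/
def Tree.IsSucc {q : ℕ} (x y : Tree q) : Prop :=
  x.IsAncestor y ∧ y.hor = x.hor + 1

/-- The homogeneous tree of degree `q + 1` as a graph: every vertex is joined to its predecessor
and to its `q` successors. -/
def treeGraph (q : ℕ) : SimpleGraph (Tree q) where
  Adj x y := x.IsSucc y ∨ y.IsSucc x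
  symm := ⟨fun _ _ h => h.symm⟩
  loopless := ⟨fun x h => by
    rcases h with h | h <;> · have := h.2; omega⟩

/-! ## The Diestel–Leader graph and its tetrahedra -/

/-- The vertex set of the Diestel–Leader graph `DL(q, r)`. -/
def DL (q r : ℕ) : Type := {x : Tree q × Tree r // x.1.hor + x.2.hor = 0}

/-- The Diestel–Leader graph `DL(q, r)`: `x₁x₂ ∼ y₁y₂` iff `x₁ ∼ y₁` and `x₂ ∼ y₂`. -/
def dlGraph (q r : ℕ) : SimpleGraph (DL q r) where
  Adj x y := (treeGraph q).Adj x.1.1 y.1.1 ∧ (treeGraph r).Adj x.1.2 y.1.2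
  symm := ⟨fun _ _ h => ⟨h.1.symm, h.2.symm⟩⟩
  loopless := ⟨fun _ h => (treeGraph q).irrefl h.1⟩

/-- The tetrahedron `S(a₁, a₂) = {x₁x₂ : a₁ ≼ x₁, a₂ ≼ x₂}`. Its height is the number `n ≥ 0` with
`-hor a₂ = hor a₁ + n`. -/
def tetrahedron {q r : ℕ} (a₁ : Tree q) (a₂ : Tree r) : Set (DL q r) :=
  {x | a₁.IsAncestor x.1.1 ∧ a₂.IsAncestor x.1.2}

/-- The subgraph of `DL(q, r)` induced by the tetrahedron `S(a₁, a₂)`. -/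
abbrev tetraGraph {q r : ℕ} (a₁ : Tree q) (a₂ : Tree r) : SimpleGraph (tetrahedron a₁ a₂) :=
  (dlGraph q r).induce (tetrahedron a₁ a₂)

/-- Only finitely many vertices below `a` have horocycle number at most `k`. -/
lemma Tree.finite_descendants {q : ℕ} (a : Tree q) (k : ℤ) :
    {x : Tree q | a.IsAncestor x ∧ x.hor ≤ k}.Finite := by
  classical
  let F : Tree q → ℤ × (Finset.Ioc a.hor k → ℕ) := fun x => (x.hor, fun m => x.lab m)
  have hfin : ((Icc a.hor k) ×ˢ
      (Set.pi Set.univ fun _ : Finset.Ioc a.hor k => Set.Iio q)).Finite :=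
    (Set.finite_Icc _ _).prod (Set.Finite.pi fun _ => Set.finite_Iio q)
  refine Set.Finite.of_finite_image (f := F) (hfin.subset ?_) ?_
  · rintro _ ⟨x, hx, rfl⟩
    exact ⟨⟨hx.1.1, hx.2⟩, fun m _ => x.lab_lt m⟩
  · intro x hx y hy hxy
    have h1 : x.hor = y.hor := congrArg Prod.fst hxy
    have h2 := congrArg Prod.snd hxy
    refine Tree.ext h1 (Finsupp.ext fun m => ?_)
    by_cases hm : m ≤ a.hor
    · rw [hx.1.2 m hm, hy.1.2 m hm]
    · by_cases hk : m ≤ k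
      · exact congrFun h2 ⟨m, Finset.mem_Ioc.2 ⟨by omega, hk⟩⟩
      · have hx' : x.hor ≤ k := hx.2
        have hy' : y.hor ≤ k := hy.2
        rw [x.lab_eq_zero m (by omega), y.lab_eq_zero m (by omega)]

instance {q r : ℕ} (a₁ : Tree q) (a₂ : Tree r) : Finite (tetrahedron a₁ a₂) := by
  refine Set.Finite.to_subtype ?_
  refine Set.Finite.of_finite_image (f := Subtype.val)
    (((a₁.finite_descendants (-a₂.hor)).prod (a₂.finite_descendants (-a₁.hor))).subset ?_)
    Subtype.val_injective.injOn
  rintro _ ⟨x, hx, rfl⟩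
  have h := x.2
  have h1 := hx.1.1
  have h2 := hx.2.1
  exact ⟨⟨hx.1, by omega⟩, ⟨hx.2, by omega⟩⟩

lemma finite_neighborSet_tree {q : ℕ} (x : Tree q) : ((treeGraph q).neighborSet x).Finite := by
  have hs : {y : Tree q | y.IsSucc x}.Subsingleton := by
    intro y hy z hz
    have h1 := hy.2
    have h2 := hz.2
    have h : y.hor = z.hor := by omega
    refine Tree.ext h (Finsupp.ext fun m => ?_)
    by_cases hm : m ≤ y.hor
    · rw [← hy.1.2 m hm, ← hz.1.2 m (by omega)]
    · rw [y.lab_eq_zero m (by omega), z.lab_eq_zero m (by omega)]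
  refine ((x.finite_descendants (x.hor + 1)).union hs.finite).subset ?_
  rintro y (hy | hy)
  · exact Or.inl ⟨hy.1, hy.2.le⟩
  · exact Or.inr hy

lemma finite_neighborSet_dl {q r : ℕ} (x : DL q r) : ((dlGraph q r).neighborSet x).Finite := by
  refine Set.Finite.of_finite_image (f := Subtype.val)
    (((finite_neighborSet_tree x.1.1).prod (finite_neighborSet_tree x.1.2)).subset ?_)
    Subtype.val_injective.injOn
  rintro _ ⟨y, hy, rfl⟩
  exact ⟨hy.1, hy.2⟩

instance (q r : ℕ) : (dlGraph q r).LocallyFinite :=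
  fun x => (finite_neighborSet_dl x).fintype

instance {q r : ℕ} (a₁ : Tree q) (a₂ : Tree r) : (tetraGraph a₁ a₂).LocallyFinite :=
  fun _ => Fintype.ofFinite _

/-! ## The limit measure -/

/-- The spectral radius `ρ = 2 √(qr) / (q + r)`. -/
def rho (q r : ℕ) : ℝ := 2 * √((q : ℝ) * r) / ((q : ℝ) + r)

/-- The threshold `(r + q) / (r - q)`. -/
def threshold (q r : ℕ) : ℝ := ((r : ℝ) + q) / ((r : ℝ) - q)

/-- The solutions `α ∈ (0, π)` of `cot (N α) = (r - q) / (r + q) * cot α`. (The condition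
`sin (N α) ≠ 0` says that `cot (N α)` is defined.) -/
def cotRoots (q r N : ℕ) : Set ℝ :=
  {α | α ∈ Ioo 0 Real.pi ∧ Real.sin (N * α) ≠ 0 ∧
    Real.cot (N * α) = ((r : ℝ) - q) / ((r : ℝ) + q) * Real.cot α}

/-- The solutions `α > 0` of `e^{2Nα} = (q - r e^{2α}) / (q e^{2α} - r)`. -/
def expRoots (q r N : ℕ) : Set ℝ :=
  {α | 0 < α ∧ (q : ℝ) * Real.exp (2 * α) - r ≠ 0 ∧
    Real.exp (2 * N * α) = (q - r * Real.exp (2 * α)) / (q * Real.exp (2 * α) - r)}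

/-- `α m N` (`N ≥ 1`) is an enumeration of the angles `α_{m,N}`:
* if `N < (r + q) / (r - q)`, then `α_{0,N}, …, α_{N-1,N}` are the distinct solutions of
  `cot (N α) = (r - q) / (r + q) * cot α` in `(0, π)`;
* if `N ≥ (r + q) / (r - q)`, then `α_{1,N}, …, α_{N-2,N}` are the distinct solutions;
* if `N = (r + q) / (r - q)`, then moreover `α_{0,N} = 0` and `α_{N-1,N} = π`;
* if `N > (r + q) / (r - q)`, then `α_{0,N}` is the only solution `α > 0` of
  `e^{2Nα} = (q - r e^{2α}) / (q e^{2α} - r)`. -/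
structure IsAngleFamily (q r : ℕ) (α : ℕ → ℕ → ℝ) : Prop where
  below : ∀ N : ℕ, 1 ≤ N → (N : ℝ) < threshold q r →
    BijOn (fun m => α m N) (Ico 0 N) (cotRoots q r N)
  above : ∀ N : ℕ, threshold q r ≤ (N : ℝ) →
    BijOn (fun m => α m N) (Icc 1 (N - 2)) (cotRoots q r N)
  zero_of_eq : ∀ N : ℕ, (N : ℝ) = threshold q r → α 0 N = 0
  last_of_eq : ∀ N : ℕ, (N : ℝ) = threshold q r → α (N - 1) N = Real.pi
  exp_root : ∀ N : ℕ, threshold q r < (N : ℝ) → expRoots q r N = {α 0 N}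

/-- The eigenvalues `λ_{m,N} = ρ cos (m π / N)`. -/
def eig (q r m N : ℕ) : ℝ := rho q r * Real.cos (m / N * Real.pi)

/-- The measure
`μ̃ = (q - 1) (r - 1) ∑_{N ≥ 2} r^{-N} ∑_{m=1}^{N-1} δ(λ_{m,N})`
` + (r - q) (r - 1) ∑_{1 ≤ N ≤ (r+q)/(r-q)} r^{-N-1} ∑_{m=0}^{N-1} δ(ρ cos α_{m,N})`
` + (r - q) (r - 1) ∑_{N > (r+q)/(r-q)} r^{-N-1} ∑_{m=1}^{N-2} δ(ρ cos α_{m,N})`. -/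
def muTilde (q r : ℕ) (α : ℕ → ℕ → ℝ) : Measure ℝ :=
  (Measure.sum fun N : {N : ℕ // 2 ≤ N} =>
    ENNReal.ofReal (((q : ℝ) - 1) * ((r : ℝ) - 1) / (r : ℝ) ^ (N : ℕ)) •
      ∑ m ∈ Finset.Icc 1 ((N : ℕ) - 1), Measure.dirac (eig q r m N)) +
  (Measure.sum fun N : {N : ℕ // 1 ≤ N ∧ (N : ℝ) ≤ threshold q r} =>
    ENNReal.ofReal (((r : ℝ) - q) * ((r : ℝ) - 1) / (r : ℝ) ^ ((N : ℕ) + 1)) •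
      ∑ m ∈ Finset.Ico 0 (N : ℕ), Measure.dirac (rho q r * Real.cos (α m N))) +
  (Measure.sum fun N : {N : ℕ // threshold q r < (N : ℝ)} =>
    ENNReal.ofReal (((r : ℝ) - q) * ((r : ℝ) - 1) / (r : ℝ) ^ ((N : ℕ) + 1)) •
      ∑ m ∈ Finset.Icc 1 ((N : ℕ) - 2), Measure.dirac (rho q r * Real.cos (α m N)))

/-- The eigenvalues `λ'_{0,N} = ρ cosh α_{0,N}`, for `N > (r + q) / (r - q)`. -/
def bigEig (q r : ℕ) (α : ℕ → ℕ → ℝ) (N : ℕ) : ℝ := rho q r * Real.cosh (α 0 N)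

/-- The measure
`ν̃ = (r - q) (r - 1) ∑_{N > (r+q)/(r-q)} r^{-N-1} (δ(λ'_{0,N}) + δ(-λ'_{0,N}))`. -/
def nuTilde (q r : ℕ) (α : ℕ → ℕ → ℝ) : Measure ℝ :=
  Measure.sum fun N : {N : ℕ // threshold q r < (N : ℝ)} =>
    ENNReal.ofReal (((r : ℝ) - q) * ((r : ℝ) - 1) / (r : ℝ) ^ ((N : ℕ) + 1)) •
      (Measure.dirac (bigEig q r α N) + Measure.dirac (-bigEig q r α N))

/-- The set `{± λ'_{0,N} : N > (r + q) / (r - q)}`. -/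
def bigEigSet (q r : ℕ) (α : ℕ → ℕ → ℝ) : Set ℝ :=
  {t | ∃ N : ℕ, threshold q r < (N : ℝ) ∧ (t = bigEig q r α N ∨ t = -bigEig q r α N)}

end DiestelLeader

end

/-! The walk on a tetrahedron `S` of height `n` reduces to walks on paths. Take cores `w` below `a₁`
and `v` below `a₂` (last label nonzero unless `w = a₁`, `v = a₂`), multiply the Helmert functions
with indices the labels of `w` and `v`, and multiply by a profile `p` of the height. A nonconstant
Helmert row sums to zero, so such a function may be cut off outside the generations between `w` and
`v`, and there the eigenvalue equation reads `q p(t+1) + r p(t-1) = (q + r) λ p(t)` on a path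
(`srwOp_profileFun`). For `v ≠ a₂` the far end is absorbing. The near end is absorbing if `w ≠ a₁`
and reflecting if `w = a₁`, where the degree in `S` is only `q`.

With `p(t) = s^t u(t)`, `s = √(r/q)` and `λ = ρ x` this is the Chebyshev recurrence for `u`. A path
with `L` vertices has as spectrum the zeros of `U_L`, which give `ρ cos(mπ/(L+1))`, or, at a
reflecting end, the zeros of `T_L - c X U_{L-1}` with `c = (r-q)/(r+q) = 1/K`. A zero `cos α` of the
latter is a solution of the cotangent equation, a zero `cosh α` is a solution of the exponential
one, and the value `1 - cL` at `1` decides which zeros leave `(-1, 1)` (`exists_boundaryRoots_eq`).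

There are `(r-1) r^(n-L)` paths of length `L` with `w = a₁` and `(q-1)(r-1)(r^(n-L) -
q^(n-L))/(r-q)` others. Division by `|S| = (r^(n+1) - q^(n+1))/(r-q)` gives the weights of the limit
as `n → ∞`. Neither the pairs with `v = a₂` nor completeness of the eigenfunctions matter:
orthogonality bounds multiplicities from below, their sum is at most `|S|`, and the limit weights
already have total mass one, so whatever is left out has vanishing share
(`abs_integral_cumulativeSpectralMeasure_sub_le`, `hasSum_levelMass`).

The support of the first part comes from density of the rationals `m/N`. For the eigenvalues outside
`[-ρ, ρ]` the quantity `e^{2α}` stays below `r/q` and tends to it, where `ρ cosh α = 1`. Finally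
`s^hor` is a positive eigenfunction of the walk on `DL(q,r)` with eigenvalue `ρ`, so return
probabilities are at most `ρ^N`, which excludes atoms beyond `ρ` in the Plancherel measure. -/

noncomputable section

namespace DiestelLeader

/-! ## Neighbours in the tree and in the Diestel–Leader graph -/

/-- The predecessor of a vertex of the tree. -/
def Tree.pred {q : ℕ} (x : Tree q) : Tree q where
  hor := x.hor - 1
  lab := x.lab.erase x.hor
  lab_lt m := by
    rw [Finsupp.erase_apply]
    split_ifs
    · exact (Nat.zero_le _).trans_lt (x.lab_lt m)
    · exact x.lab_lt m
  lab_eq_zero m hm := by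
    rw [Finsupp.erase_apply]
    split_ifs with h
    · rfl
    · exact x.lab_eq_zero m (by omega)

/-- The successor of a vertex along the edge labelled `a`. -/
def Tree.succ {q : ℕ} (x : Tree q) (a : Fin q) : Tree q where
  hor := x.hor + 1
  lab := x.lab.update (x.hor + 1) a
  lab_lt m := by
    rw [Finsupp.coe_update, Function.update_apply]
    split_ifs
    · exact a.2
    · exact x.lab_lt m
  lab_eq_zero m hm := by
    rw [Finsupp.coe_update, Function.update_apply, if_neg (by omega)]
    exact x.lab_eq_zero m (by omega)

section Tree

variable {q : ℕ}

@[simp] lemma Tree.hor_pred (x : Tree q) : x.pred.hor = x.hor - 1 := rfl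

@[simp] lemma Tree.hor_succ (x : Tree q) (a : Fin q) : (x.succ a).hor = x.hor + 1 := rfl

lemma Tree.lab_pred_of_ne (x : Tree q) {m : ℤ} (hm : m ≠ x.hor) : x.pred.lab m = x.lab m :=
  Finsupp.erase_ne hm

lemma Tree.lab_succ_of_ne (x : Tree q) (a : Fin q) {m : ℤ} (hm : m ≠ x.hor + 1) :
    (x.succ a).lab m = x.lab m := by
  simp [Tree.succ, hm]

@[simp] lemma Tree.lab_succ_self (x : Tree q) (a : Fin q) : (x.succ a).lab (x.hor + 1) = a := by
  simp [Tree.succ]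

lemma Tree.ext_of_le {x y : Tree q} (h : x.hor = y.hor) (hl : ∀ m ≤ x.hor, x.lab m = y.lab m) :
    x = y := by
  refine Tree.ext h (Finsupp.ext fun m => ?_)
  by_cases hm : m ≤ x.hor
  · exact hl m hm
  · rw [x.lab_eq_zero m (by omega), y.lab_eq_zero m (by omega)]

lemma Tree.isSucc_iff_exists (x y : Tree q) : x.IsSucc y ↔ ∃ a, x.succ a = y := by
  constructor
  · rintro ⟨⟨-, h⟩, h'⟩
    refine ⟨⟨y.lab (x.hor + 1), y.lab_lt _⟩, Tree.ext_of_le h'.symm fun m hm => ?_⟩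
    by_cases hm' : m = x.hor + 1
    · subst hm'
      simp
    · rw [Tree.lab_succ_of_ne _ _ hm', h m (by simp at hm; omega)]
  · rintro ⟨a, rfl⟩
    exact ⟨⟨by simp, fun m hm => Tree.lab_succ_of_ne _ _ (by omega)⟩, rfl⟩

lemma Tree.isSucc_iff_eq_pred (x y : Tree q) : y.IsSucc x ↔ y = x.pred := by
  constructor
  · rintro ⟨⟨-, h⟩, h'⟩
    refine Tree.ext_of_le (by simp; omega) fun m hm => ?_
    rw [Tree.lab_pred_of_ne _ (by omega), h m hm]
  · rintro rfl
    refine ⟨⟨by simp, fun m hm => ?_⟩, by simp⟩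
    rw [Tree.lab_pred_of_ne]
    simp at hm
    omega

lemma Tree.succ_injective (x : Tree q) : Function.Injective x.succ := by
  intro a b h
  have := congrArg (fun y : Tree q => y.lab (x.hor + 1)) h
  exact Fin.ext (by simpa using this)

@[simp] lemma Tree.pred_succ (x : Tree q) (a : Fin q) : (x.succ a).pred = x := by
  symm
  rw [← Tree.isSucc_iff_eq_pred, Tree.isSucc_iff_exists]
  exact ⟨a, rfl⟩

lemma Tree.isAncestor_refl (a : Tree q) : a.IsAncestor a := ⟨le_rfl, fun _ _ => rfl⟩

lemma Tree.IsAncestor.succ {a x : Tree q} (h : a.IsAncestor x) (b : Fin q) :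
    a.IsAncestor (x.succ b) :=
  ⟨by simp; exact h.1.trans (by omega), fun m hm => by
    rw [Tree.lab_succ_of_ne _ _ (by have := h.1; omega), h.2 m hm]⟩

lemma Tree.IsAncestor.pred_iff {a x : Tree q} (h : a.IsAncestor x) :
    a.IsAncestor x.pred ↔ a.hor < x.hor := by
  constructor
  · intro h'
    have := h'.1
    simp at this
    omega
  · intro h'
    exact ⟨by simp; omega, fun m hm => by rw [Tree.lab_pred_of_ne _ (by omega), h.2 m hm]⟩

end Tree

section DL

variable {q r : ℕ}

/-- The neighbour of `x₁x₂` obtained by going to a successor of `x₁` and the predecessor of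
`x₂`. -/
def DL.up (x : DL q r) (a : Fin q) : DL q r :=
  ⟨(x.1.1.succ a, x.1.2.pred), by have := x.2; simp; omega⟩

/-- The neighbour of `x₁x₂` obtained by going to the predecessor of `x₁` and a successor of
`x₂`. -/
def DL.down (x : DL q r) (b : Fin r) : DL q r :=
  ⟨(x.1.1.pred, x.1.2.succ b), by have := x.2; simp; omega⟩

/-- The two heights add up to zero at both ends of an edge, so one coordinate moves up exactly when
the other moves down. -/
lemma dlGraph_adj_iff (x y : DL q r) :
    (dlGraph q r).Adj x y ↔ (∃ a, x.up a = y) ∨ ∃ b, x.down b = y := by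
  have hx := x.2
  have hy := y.2
  have key : (dlGraph q r).Adj x y ↔
      (x.1.1.IsSucc y.1.1 ∧ y.1.2.IsSucc x.1.2) ∨ (y.1.1.IsSucc x.1.1 ∧ x.1.2.IsSucc y.1.2) := by
    change ((_ ∨ _) ∧ (_ ∨ _)) ↔ _
    constructor
    · rintro ⟨h1 | h1, h2 | h2⟩
      · have := h1.2
        have := h2.2
        omega
      · exact Or.inl ⟨h1, h2⟩
      · exact Or.inr ⟨h1, h2⟩
      · have := h1.2
        have := h2.2
        omega
    · rintro (⟨h1, h2⟩ | ⟨h1, h2⟩)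
      · exact ⟨Or.inl h1, Or.inr h2⟩
      · exact ⟨Or.inr h1, Or.inl h2⟩
  rw [key]
  simp only [Tree.isSucc_iff_eq_pred x.1.2 y.1.2, Tree.isSucc_iff_eq_pred x.1.1 y.1.1,
    Tree.isSucc_iff_exists]
  refine or_congr ⟨?_, ?_⟩ ⟨?_, ?_⟩
  · rintro ⟨⟨a, h1⟩, h2⟩
    exact ⟨a, Subtype.ext (Prod.ext h1 h2.symm)⟩
  · rintro ⟨a, rfl⟩
    exact ⟨⟨a, rfl⟩, rfl⟩
  · rintro ⟨h1, ⟨a, h2⟩⟩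
    exact ⟨a, Subtype.ext (Prod.ext h1.symm h2)⟩
  · rintro ⟨a, rfl⟩
    exact ⟨rfl, ⟨a, rfl⟩⟩

lemma DL.elim_up_down_injective (x : DL q r) : Function.Injective (Sum.elim x.up x.down) := by
  have h1 : Function.Injective x.up := fun a b h =>
    x.1.1.succ_injective (congrArg (fun y : DL q r => y.1.1) h)
  have h2 : Function.Injective x.down := fun a b h =>
    x.1.2.succ_injective (congrArg (fun y : DL q r => y.1.2) h)
  refine h1.sumElim h2 fun a b h => ?_
  have : x.1.1.hor + 1 = x.1.1.hor - 1 := congrArg (fun y : DL q r => y.1.1.hor) h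
  omega

lemma sum_neighborFinset_dlGraph (x : DL q r) (g : DL q r → ℝ) :
    ∑ y ∈ (dlGraph q r).neighborFinset x, g y = ∑ a, g (x.up a) + ∑ b, g (x.down b) := by
  classical
  have : (dlGraph q r).neighborFinset x = Finset.univ.map ⟨_, x.elim_up_down_injective⟩ := by
    ext y
    simp [dlGraph_adj_iff]
  rw [this, Finset.sum_map, Fintype.sum_sum_type]
  rfl

lemma degree_dlGraph (x : DL q r) : ((dlGraph q r).degree x : ℝ) = q + r := by
  have := sum_neighborFinset_dlGraph x fun _ => 1
  simpa using this

variable {a₁ : Tree q} {a₂ : Tree r}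

/-- Passing to a successor never leaves the tetrahedron; passing to a predecessor does so exactly at
`a₁` or `a₂`. Hence all neighbours of one kind are kept or lost together. -/
lemma sum_neighborFinset_tetraGraph (x : tetrahedron a₁ a₂) (g : DL q r → ℝ) :
    ∑ y ∈ (tetraGraph a₁ a₂).neighborFinset x, g y =
      (if a₂.hor < x.1.1.2.hor then ∑ a, g (x.1.up a) else 0) +
        if a₁.hor < x.1.1.1.hor then ∑ b, g (x.1.down b) else 0 := by
  classical
  have h1 : ∑ y ∈ (tetraGraph a₁ a₂).neighborFinset x, g y =
      ∑ y ∈ (dlGraph q r).neighborFinset x.1, if y ∈ tetrahedron a₁ a₂ then g y else 0 := by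
    rw [← Finset.sum_filter]
    refine Finset.sum_bij (fun y _ => y.1) ?_ ?_ ?_ ?_
    · intro y hy
      have : (tetraGraph a₁ a₂).Adj x y := by simpa using hy
      simpa using this
    · intro y _ z _ h
      exact Subtype.ext h
    · intro y hy
      simp only [Finset.mem_filter, SimpleGraph.mem_neighborFinset] at hy
      exact ⟨⟨y, hy.2⟩, by simpa using hy.1, rfl⟩
    · intro y _
      rfl
  have h2 : ∀ a, x.1.up a ∈ tetrahedron a₁ a₂ ↔ a₂.hor < x.1.1.2.hor := fun a =>
    ⟨fun h => (x.2.2.pred_iff).1 h.2, fun h => ⟨x.2.1.succ a, (x.2.2.pred_iff).2 h⟩⟩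
  have h3 : ∀ b, x.1.down b ∈ tetrahedron a₁ a₂ ↔ a₁.hor < x.1.1.1.hor := fun b =>
    ⟨fun h => (x.2.1.pred_iff).1 h.1, fun h => ⟨(x.2.1.pred_iff).2 h, x.2.2.succ b⟩⟩
  rw [h1, sum_neighborFinset_dlGraph]
  simp only [h2, h3]
  congr 1 <;> split_ifs <;> simp

lemma degree_tetraGraph (x : tetrahedron a₁ a₂) :
    ((tetraGraph a₁ a₂).degree x : ℝ) =
      (if a₂.hor < x.1.1.2.hor then (q : ℝ) else 0) + if a₁.hor < x.1.1.1.hor then (r : ℝ) else 0 := by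
  have := sum_neighborFinset_tetraGraph x fun _ => 1
  simpa using this

end DL

/-! ## Eigenfunctions of tetrahedra -/

/-- The rows of the Helmert matrix: an orthogonal basis of the functions on `{0, …, q - 1}` whose
first element is the constant `1`. -/
def helmert (a b : ℕ) : ℝ :=
  if a = 0 then 1 else if b < a then 1 else if b = a then -a else 0

@[simp] lemma helmert_zero (b : ℕ) : helmert 0 b = 1 := by simp [helmert]

lemma helmert_self_ne_zero (a : ℕ) : helmert a a ≠ 0 := by
  by_cases h : a = 0 <;> simp [helmert, h]

lemma sum_helmert {a q : ℕ} (ha : a ≠ 0) (haq : a < q) :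
    ∑ b ∈ Finset.range q, helmert a b = 0 := by
  have h1 : ∑ b ∈ Finset.range (a + 1), helmert a b = ∑ b ∈ Finset.range q, helmert a b := by
    refine Finset.sum_subset (Finset.range_mono haq) fun b _ hb => ?_
    simp only [Finset.mem_range] at hb
    simp [helmert, ha, show ¬ b < a by omega, show b ≠ a by omega]
  rw [← h1, Finset.sum_range_succ]
  have h2 : ∑ b ∈ Finset.range a, helmert a b = ∑ b ∈ Finset.range a, 1 := by
    refine Finset.sum_congr rfl fun b hb => ?_
    simp [helmert, Finset.mem_range.1 hb]
  rw [h2]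
  simp [helmert, ha]

/-- Row `a` lives on `b ≤ a`, where row `a'` is constantly `1`; the inner product is therefore the
row sum of row `a`. -/
lemma sum_helmert_mul_of_lt {a a' q : ℕ} (h : a < a') (ha : a' < q) :
    ∑ b ∈ Finset.range q, helmert a b * helmert a' b = 0 := by
  by_cases h0 : a = 0
  · subst h0
    simpa using sum_helmert (by omega) ha
  · rw [← sum_helmert h0 (h.trans ha)]
    refine Finset.sum_congr rfl fun b _ => ?_
    by_cases hb : b < a'
    · simp [helmert, hb, show a' ≠ 0 by omega]
    · simp [helmert, h0, show ¬ b < a by omega, show b ≠ a by omega]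

lemma sum_helmert_mul {a a' q : ℕ} (h : a ≠ a') (ha : a < q) (ha' : a' < q) :
    ∑ b ∈ Finset.range q, helmert a b * helmert a' b = 0 := by
  rcases lt_or_gt_of_ne h with h | h
  · exact sum_helmert_mul_of_lt h ha'
  · simpa only [mul_comm] using sum_helmert_mul_of_lt h ha

/-- The product of Helmert functions, over the generations below `a`, with indices the labels of
`w`. -/
def Tree.char {q : ℕ} (a w x : Tree q) : ℝ :=
  ∏ m ∈ Finset.Ioc a.hor w.hor, helmert (w.lab m) (x.lab m)

/-- `w` is a descendant of `a` whose last label, if `w ≠ a`, is not `0`. -/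
def Tree.IsCore {q : ℕ} (a w : Tree q) : Prop :=
  a.IsAncestor w ∧ (a.hor < w.hor → w.lab w.hor ≠ 0)

section Char

variable {q : ℕ} {a w : Tree q}

lemma Tree.char_congr {x y : Tree q} (h : ∀ m ≤ w.hor, x.lab m = y.lab m) :
    Tree.char a w x = Tree.char a w y :=
  Finset.prod_congr rfl fun m hm => by rw [h m (Finset.mem_Ioc.1 hm).2]

lemma Tree.char_succ {x : Tree q} (h : w.hor ≤ x.hor) (b : Fin q) :
    Tree.char a w (x.succ b) = Tree.char a w x :=
  Tree.char_congr fun m hm => Tree.lab_succ_of_ne _ _ (by omega)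

lemma Tree.char_pred {x : Tree q} (h : w.hor < x.hor) :
    Tree.char a w x.pred = Tree.char a w x :=
  Tree.char_congr fun m hm => Tree.lab_pred_of_ne _ (by omega)

lemma Tree.char_self_ne_zero {x : Tree q} (h : ∀ m ≤ w.hor, x.lab m = w.lab m) :
    Tree.char a w x ≠ 0 := by
  rw [Tree.char_congr h]
  exact Finset.prod_ne_zero_iff.2 fun m _ => helmert_self_ne_zero _

/-- Only the factor at height `w.hor` depends on the successor. Its index, the last label of `w`, is
nonzero, so that Helmert row sums to zero. This cancellation allows the eigenfunctions to be
extended by zero. -/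
lemma Tree.IsCore.sum_char_succ (hw : Tree.IsCore a w) {x : Tree q} (ha : a.hor ≤ x.hor)
    (h : x.hor + 1 = w.hor) : ∑ b, Tree.char a w (x.succ b) = 0 := by
  have h0 := hw.2 (by omega)
  have key : ∀ b : Fin q, Tree.char a w (x.succ b) =
      (∏ m ∈ Finset.Ioo a.hor w.hor, helmert (w.lab m) (x.lab m)) * helmert (w.lab w.hor) b := by
    intro b
    have hI : Finset.Ioc a.hor w.hor = insert w.hor (Finset.Ioo a.hor w.hor) :=
      (Finset.Ioo_insert_right (by omega)).symm
    rw [Tree.char, hI, Finset.prod_insert (by simp), mul_comm]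
    congr 1
    · refine Finset.prod_congr rfl fun m hm => ?_
      rw [Tree.lab_succ_of_ne]
      simp only [Finset.mem_Ioo] at hm
      omega
    · rw [← h, Tree.lab_succ_self]
  simp_rw [key]
  rw [← Finset.mul_sum, Fin.sum_univ_eq_sum_range (fun b => helmert (w.lab w.hor) b) q,
    sum_helmert h0 (w.lab_lt _), mul_zero]

end Char

/-- The function on the Diestel–Leader graph with profile `p` along the generations between those
of `w` and `v`, built from the products of Helmert functions belonging to `w` and `v`. -/
def profileFun {q r : ℕ} (a₁ w : Tree q) (a₂ v : Tree r) (p : ℤ → ℝ) (x : DL q r) : ℝ :=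
  if w.hor ≤ x.1.1.hor ∧ v.hor ≤ x.1.2.hor then
    p (x.1.1.hor - w.hor) * (Tree.char a₁ w x.1.1 * Tree.char a₂ v x.1.2)
  else 0

section ProfileFun

variable {q r : ℕ} {a₁ w : Tree q} {a₂ v : Tree r} {p : ℤ → ℝ}

/-- The condition on the right is the one for `x` itself to lie between `w` and `v`, not for its
successor: one generation before `w` the successors carry nonzero values, but these cancel. -/
lemma sum_profileFun_up (hw : Tree.IsCore a₁ w) (x : DL q r) (hx : a₁.hor ≤ x.1.1.hor) :
    ∑ a, profileFun a₁ w a₂ v p (x.up a) =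
      if w.hor ≤ x.1.1.hor ∧ v.hor < x.1.2.hor then
        q * p (x.1.1.hor - w.hor + 1) * (Tree.char a₁ w x.1.1 * Tree.char a₂ v x.1.2)
      else 0 := by
  have h1 : ∀ a, (x.up a).1.1 = x.1.1.succ a := fun _ => rfl
  have h2 : ∀ a, (x.up a).1.2 = x.1.2.pred := fun _ => rfl
  simp only [profileFun, h1, h2, Tree.hor_succ, Tree.hor_pred]
  by_cases hv : v.hor < x.1.2.hor
  · rw [Tree.char_pred hv]
    rcases lt_trichotomy (x.1.1.hor + 1) w.hor with h | h | h
    · simp [show ¬ w.hor ≤ x.1.1.hor by omega, show ¬ w.hor ≤ x.1.1.hor + 1 by omega]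
    · rw [if_neg (by omega)]
      have hc : w.hor ≤ x.1.1.hor + 1 ∧ v.hor ≤ x.1.2.hor - 1 := by omega
      simp only [if_pos hc]
      rw [← Finset.mul_sum, ← Finset.sum_mul, hw.sum_char_succ hx h]
      simp
    · have hle : w.hor ≤ x.1.1.hor := by omega
      simp only [show w.hor ≤ x.1.1.hor + 1 ∧ v.hor ≤ x.1.2.hor - 1 by omega, if_true, hle, hv,
        and_self, Tree.char_succ hle]
      rw [Finset.sum_const, Finset.card_univ, Fintype.card_fin, nsmul_eq_mul, mul_assoc]
      ring_nf
  · simp [hv, show ¬ v.hor ≤ x.1.2.hor - 1 by omega]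

lemma sum_profileFun_down (hv : Tree.IsCore a₂ v) (x : DL q r) (hx : a₂.hor ≤ x.1.2.hor) :
    ∑ b, profileFun a₁ w a₂ v p (x.down b) =
      if w.hor < x.1.1.hor ∧ v.hor ≤ x.1.2.hor then
        r * p (x.1.1.hor - w.hor - 1) * (Tree.char a₁ w x.1.1 * Tree.char a₂ v x.1.2)
      else 0 := by
  have h1 : ∀ b, (x.down b).1.1 = x.1.1.pred := fun _ => rfl
  have h2 : ∀ b, (x.down b).1.2 = x.1.2.succ b := fun _ => rfl
  simp only [profileFun, h1, h2, Tree.hor_succ, Tree.hor_pred]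
  by_cases hw : w.hor < x.1.1.hor
  · rw [Tree.char_pred hw]
    rcases lt_trichotomy (x.1.2.hor + 1) v.hor with h | h | h
    · simp [show ¬ v.hor ≤ x.1.2.hor by omega, show ¬ v.hor ≤ x.1.2.hor + 1 by omega]
    · rw [if_neg (by omega)]
      have hc : w.hor ≤ x.1.1.hor - 1 ∧ v.hor ≤ x.1.2.hor + 1 := by omega
      simp only [if_pos hc]
      rw [← Finset.mul_sum, ← Finset.mul_sum, hv.sum_char_succ hx h]
      simp
    · have hle : v.hor ≤ x.1.2.hor := by omega
      simp only [show w.hor ≤ x.1.1.hor - 1 ∧ v.hor ≤ x.1.2.hor + 1 by omega, if_true, hle, hw,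
        and_self, Tree.char_succ hle]
      rw [Finset.sum_const, Finset.card_univ, Fintype.card_fin, nsmul_eq_mul, mul_assoc]
      ring_nf
  · simp [hw, show ¬ w.hor ≤ x.1.1.hor - 1 by omega]

/-- A profile satisfying the three-term recurrence with boundary conditions gives an
eigenfunction. -/
lemma srwOp_profileFun (hq : 0 < q) (hw : Tree.IsCore a₁ w) (hv : Tree.IsCore a₂ v)
    (hv' : a₂.hor < v.hor) {l : ℝ}
    (hrec : ∀ t : ℤ, 0 ≤ t → t ≠ 0 ∨ a₁.hor < w.hor →
      q * p (t + 1) + r * p (t - 1) = (q + r) * (l * p t))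
    (hend : p (-w.hor - v.hor + 1) = 0) (hstart : a₁.hor < w.hor → p (-1) = 0)
    (hstart' : a₁.hor = w.hor → p 1 = l * p 0) :
    srwOp (tetraGraph a₁ a₂) (fun x => profileFun a₁ w a₂ v p x) =
      l • fun x : tetrahedron a₁ a₂ => profileFun a₁ w a₂ v p x := by
  funext x
  have hx := x.1.2
  have hx1 := x.2.1.1
  have hx2 := x.2.2.1
  have hq' : (0 : ℝ) < q := by exact_mod_cast hq
  change ((tetraGraph a₁ a₂).degree x : ℝ)⁻¹ *
    (∑ y ∈ (tetraGraph a₁ a₂).neighborFinset x, profileFun a₁ w a₂ v p y) =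
      l * profileFun a₁ w a₂ v p x.1
  rw [degree_tetraGraph, sum_neighborFinset_tetraGraph, sum_profileFun_up hw _ hx1,
    sum_profileFun_down hv _ hx2, profileFun]
  set c := Tree.char a₁ w x.1.1.1 * Tree.char a₂ v x.1.1.2
  have haw := hw.1.1
  by_cases hin : w.hor ≤ x.1.1.1.hor ∧ v.hor ≤ x.1.1.2.hor
  · rw [if_pos (show a₂.hor < x.1.1.2.hor by omega), if_pos (show a₂.hor < x.1.1.2.hor by omega),
      if_pos hin]
    obtain ⟨h1, h2⟩ := hin
    -- At the far end the missing neighbours may be included in the formula because the profile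
    -- vanishes one step further; `hdown` below does the same at an absorbing near end, with `p (-1)
    -- = 0`.
    have hup : (if w.hor ≤ x.1.1.1.hor ∧ v.hor < x.1.1.2.hor then
        q * p (x.1.1.1.hor - w.hor + 1) * c else 0) = q * p (x.1.1.1.hor - w.hor + 1) * c := by
      by_cases h : v.hor < x.1.1.2.hor
      · rw [if_pos ⟨h1, h⟩]
      · rw [if_neg (by tauto), show x.1.1.1.hor - w.hor + 1 = -w.hor - v.hor + 1 by omega, hend]
        simp
    rw [hup]
    by_cases ha : a₁.hor < x.1.1.1.hor
    · rw [if_pos ha, if_pos ha]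
      have hdown : (if w.hor < x.1.1.1.hor ∧ v.hor ≤ x.1.1.2.hor then
          r * p (x.1.1.1.hor - w.hor - 1) * c else 0) =
            r * p (x.1.1.1.hor - w.hor - 1) * c := by
        by_cases h : w.hor < x.1.1.1.hor
        · rw [if_pos ⟨h, h2⟩]
        · rw [if_neg (by tauto), show x.1.1.1.hor - w.hor - 1 = -1 by omega, hstart (by omega)]
          simp
      have := hrec (x.1.1.1.hor - w.hor) (by omega) (by omega)
      have hpos : (0 : ℝ) < q + r := by positivity
      rw [hdown, inv_mul_eq_iff_eq_mul₀ hpos.ne']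
      linear_combination c * this
    -- Reflecting end: `x₁` is at the height of `a₁`, there are no neighbours downwards and the
    -- degree is `q`.
    · have h0 : x.1.1.1.hor - w.hor = 0 := by omega
      rw [if_neg ha, if_neg ha, h0, zero_add, hstart' (by omega)]
      field_simp
      ring
  -- Outside the strip the function is zero at `x`, and both neighbour sums vanish, by absence or by
  -- cancellation.
  · rw [if_neg (show ¬ (w.hor ≤ x.1.1.1.hor ∧ v.hor < x.1.1.2.hor) by omega),
      if_neg (show ¬ (w.hor < x.1.1.1.hor ∧ v.hor ≤ x.1.1.2.hor) by omega), if_neg hin]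
    simp

end ProfileFun

/-! ## Orthogonality -/

/-- Add `s` modulo `q` to the label of `x` at height `m`. -/
def Tree.shift {q : ℕ} (m : ℤ) (s : ℕ) (x : Tree q) : Tree q where
  hor := x.hor
  lab := if m ≤ x.hor then x.lab.update m ((x.lab m + s) % q) else x.lab
  lab_lt k := by
    split_ifs
    · rw [Finsupp.coe_update, Function.update_apply]
      split_ifs
      · exact Nat.mod_lt _ ((Nat.zero_le _).trans_lt (x.lab_lt m))
      · exact x.lab_lt k
    · exact x.lab_lt k
  lab_eq_zero k hk := by
    split_ifs
    · rw [Finsupp.coe_update, Function.update_apply, if_neg (by omega)]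
      exact x.lab_eq_zero k hk
    · exact x.lab_eq_zero k hk

section Shift

variable {q : ℕ} {m : ℤ} {s : ℕ}

@[simp] lemma Tree.hor_shift (x : Tree q) : (x.shift m s).hor = x.hor := rfl

lemma Tree.lab_shift_of_ne (x : Tree q) {k : ℤ} (hk : k ≠ m) :
    (x.shift m s).lab k = x.lab k := by
  simp only [Tree.shift]
  split_ifs <;> simp [hk]

lemma Tree.lab_shift_self (x : Tree q) (hm : m ≤ x.hor) :
    (x.shift m s).lab m = (x.lab m + s) % q := by
  simp [Tree.shift, hm]

lemma Tree.shift_injective : Function.Injective (Tree.shift (q := q) m s) := by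
  intro x y h
  have h0 := congrArg Tree.hor h
  have hh : x.hor = y.hor := h0
  refine Tree.ext_of_le hh fun k hk => ?_
  have hl : (x.shift m s).lab k = (y.shift m s).lab k := by rw [h]
  by_cases hkm : k = m
  · subst hkm
    rw [Tree.lab_shift_self _ hk, Tree.lab_shift_self _ (hh ▸ hk)] at hl
    have h3 : x.lab k ≡ y.lab k [MOD q] := Nat.ModEq.add_right_cancel' s hl
    exact Nat.ModEq.eq_of_lt_of_lt h3 (x.lab_lt k) (y.lab_lt k)
  · rwa [Tree.lab_shift_of_ne _ hkm, Tree.lab_shift_of_ne _ hkm] at hl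

lemma Tree.IsAncestor.shift {a x : Tree q} (h : a.IsAncestor x) (hm : a.hor < m) :
    a.IsAncestor (x.shift m s) :=
  ⟨h.1, fun k hk => by rw [Tree.lab_shift_of_ne _ (by omega), h.2 k hk]⟩

/-- Isolates the only factor changed by the shift. The formula also covers `m > w.hor`: the label of
`w` is then `0` and the corresponding Helmert row is constantly `1`. -/
lemma Tree.char_shift {a w x : Tree q} (ha : a.hor < m) (hx : m ≤ x.hor) :
    Tree.char a w (x.shift m s) =
      (∏ k ∈ (Finset.Ioc a.hor w.hor).erase m, helmert (w.lab k) (x.lab k)) *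
        helmert (w.lab m) ((x.lab m + s) % q) := by
  have hprod : ∏ k ∈ (Finset.Ioc a.hor w.hor).erase m, helmert (w.lab k) ((x.shift m s).lab k) =
      ∏ k ∈ (Finset.Ioc a.hor w.hor).erase m, helmert (w.lab k) (x.lab k) :=
    Finset.prod_congr rfl fun k hk => by rw [Tree.lab_shift_of_ne _ (Finset.ne_of_mem_erase hk)]
  rw [← hprod, Tree.char]
  by_cases hm : m ≤ w.hor
  · rw [← Finset.prod_erase_mul _ _ (Finset.mem_Ioc.2 ⟨ha, hm⟩), Tree.lab_shift_self _ hx]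
  · rw [w.lab_eq_zero m (by omega), helmert_zero, mul_one, Finset.erase_eq_of_notMem]
    exact fun h => hm (Finset.mem_Ioc.1 h).2

lemma sum_range_add_mod (g : ℕ → ℝ) (b : ℕ) (hq : 0 < q) :
    ∑ s ∈ Finset.range q, g ((b + s) % q) = ∑ s ∈ Finset.range q, g s := by
  have hinj : Set.InjOn (fun s => (b + s) % q) (Finset.range q) := by
    intro s hs t ht h
    have h3 : s ≡ t [MOD q] := Nat.ModEq.add_left_cancel' b h
    exact Nat.ModEq.eq_of_lt_of_lt h3 (Finset.mem_range.1 hs) (Finset.mem_range.1 ht)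
  have himg : (Finset.range q).image (fun s => (b + s) % q) = Finset.range q := by
    refine Finset.eq_of_subset_of_card_le ?_ ?_
    · intro s hs
      obtain ⟨t, -, rfl⟩ := Finset.mem_image.1 hs
      exact Finset.mem_range.2 (Nat.mod_lt _ hq)
    · rw [Finset.card_image_of_injOn hinj]
  rw [← Finset.sum_image (f := g) hinj, himg]

/-- As `s` runs through the residues, the label at height `m` runs through all values while the
other factors stay fixed, leaving the inner product of two distinct Helmert rows. -/
lemma Tree.sum_char_shift_mul {a w w' x : Tree q} (ha : a.hor < m) (hx : m ≤ x.hor)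
    (hne : w.lab m ≠ w'.lab m) :
    ∑ s ∈ Finset.range q, Tree.char a w (x.shift m s) * Tree.char a w' (x.shift m s) = 0 := by
  have key : ∀ s, Tree.char a w (x.shift m s) * Tree.char a w' (x.shift m s) =
      ((∏ k ∈ (Finset.Ioc a.hor w.hor).erase m, helmert (w.lab k) (x.lab k)) *
        ∏ k ∈ (Finset.Ioc a.hor w'.hor).erase m, helmert (w'.lab k) (x.lab k)) *
      (helmert (w.lab m) ((x.lab m + s) % q) * helmert (w'.lab m) ((x.lab m + s) % q)) := by
    intro s
    rw [Tree.char_shift ha hx, Tree.char_shift ha hx, mul_mul_mul_comm]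
  simp only [key]
  rw [← Finset.mul_sum, sum_range_add_mod (fun b => helmert (w.lab m) b * helmert (w'.lab m) b) _
    ((Nat.zero_le _).trans_lt (x.lab_lt m)), sum_helmert_mul hne (w.lab_lt m) (w'.lab_lt m),
    mul_zero]

/-- Labels determine a core: its height is that of its last nonzero label below `a`, or that of `a`
if there is none. -/
lemma Tree.IsCore.exists_lab_ne {a w w' : Tree q} (hw : Tree.IsCore a w)
    (hw' : Tree.IsCore a w') (hne : w ≠ w') : ∃ k, a.hor < k ∧ w.lab k ≠ w'.lab k := by
  by_contra! h
  have hl : w.lab = w'.lab := by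
    ext k
    by_cases hk : a.hor < k
    · exact h k hk
    · rw [hw.1.2 k (by omega), hw'.1.2 k (by omega)]
  refine hne (Tree.ext ?_ hl)
  have h1 := hw.1.1
  have h2 := hw'.1.1
  rcases lt_trichotomy w.hor w'.hor with h3 | h3 | h3
  · exact absurd (hl ▸ w.lab_eq_zero _ h3) (hw'.2 (by omega))
  · exact h3
  · exact absurd (hl ▸ w'.lab_eq_zero _ h3) (hw.2 (by omega))

end Shift

/-- Each `φ s` permutes the finite set, so summing the averages counts the full sum `q` times. -/
lemma sum_eq_zero_of_averages {X : Type*} [Fintype X] {q : ℕ} (hq : 0 < q) (φ : ℕ → X → X)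
    (hφ : ∀ s, Function.Injective (φ s)) (F : X → ℝ)
    (h : ∀ x, ∑ s ∈ Finset.range q, F (φ s x) = 0) : ∑ x, F x = 0 := by
  have h1 : ∀ s, ∑ x, F (φ s x) = ∑ x, F x := fun s =>
    (Finite.injective_iff_bijective.1 (hφ s)).sum_comp F
  have h2 : (q : ℝ) * ∑ x, F x = 0 := by
    rw [← Finset.sum_eq_zero (fun x _ => h x), Finset.sum_comm]
    rw [Finset.sum_congr rfl fun s _ => h1 s]
    simp
  exact (mul_eq_zero.1 h2).resolve_left (by positivity)

section Orthogonality

variable {q r : ℕ} {a₁ w w' : Tree q} {a₂ v v' : Tree r}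

lemma sum_profileFun_mul_of_left_ne [Fintype (tetrahedron a₁ a₂)] (hw : Tree.IsCore a₁ w)
    (hw' : Tree.IsCore a₁ w') (hne : w ≠ w') (p p' : ℤ → ℝ) :
    ∑ x : tetrahedron a₁ a₂, profileFun a₁ w a₂ v p x * profileFun a₁ w' a₂ v' p' x = 0 := by
  obtain ⟨m, ham, hm⟩ := hw.exists_lab_ne hw' hne
  have hq : 0 < q := (Nat.zero_le _).trans_lt (w.lab_lt m)
  let φ : ℕ → tetrahedron a₁ a₂ → tetrahedron a₁ a₂ := fun s x =>
    ⟨⟨(x.1.1.1.shift m s, x.1.1.2), x.1.2⟩, x.2.1.shift ham, x.2.2⟩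
  refine sum_eq_zero_of_averages hq φ (fun s x y h => ?_) _ fun x => ?_
  · have h0 := congrArg (fun z : tetrahedron a₁ a₂ => z.1.1) h
    have h1 : x.1.1.1.shift m s = y.1.1.1.shift m s := congrArg Prod.fst h0
    have h2 : x.1.1.2 = y.1.1.2 := (Prod.ext_iff.1 h0).2
    exact Subtype.ext (Subtype.ext (Prod.ext (Tree.shift_injective h1) h2))
  · simp only [profileFun, φ, Tree.hor_shift]
    by_cases h : w.hor ≤ x.1.1.1.hor ∧ v.hor ≤ x.1.1.2.hor
    · by_cases h' : w'.hor ≤ x.1.1.1.hor ∧ v'.hor ≤ x.1.1.2.hor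
      -- Above the heights of both cores the labels are `0`, so a height at which they differ is at
      -- most one of these heights, hence at most that of `x₁`.
      · have hmx : m ≤ x.1.1.1.hor := by
          by_contra hlt
          rw [w.lab_eq_zero m (by omega), w'.lab_eq_zero m (by omega)] at hm
          exact hm rfl
        simp only [h, h', if_true, and_self]
        have := Tree.sum_char_shift_mul ham hmx hm
        calc _ = p (x.1.1.1.hor - w.hor) * p' (x.1.1.1.hor - w'.hor) *
              (Tree.char a₂ v x.1.1.2 * Tree.char a₂ v' x.1.1.2) *
              ∑ s ∈ Finset.range q, Tree.char a₁ w (x.1.1.1.shift m s) *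
                Tree.char a₁ w' (x.1.1.1.shift m s) := by
                rw [Finset.mul_sum]
                exact Finset.sum_congr rfl fun s _ => by ring
          _ = 0 := by rw [this, mul_zero]
      · simp [h']
    · simp [h]

lemma sum_profileFun_mul_of_right_ne [Fintype (tetrahedron a₁ a₂)] (hv : Tree.IsCore a₂ v)
    (hv' : Tree.IsCore a₂ v') (hne : v ≠ v') (p p' : ℤ → ℝ) :
    ∑ x : tetrahedron a₁ a₂, profileFun a₁ w a₂ v p x * profileFun a₁ w' a₂ v' p' x = 0 := by
  obtain ⟨m, ham, hm⟩ := hv.exists_lab_ne hv' hne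
  have hr : 0 < r := (Nat.zero_le _).trans_lt (v.lab_lt m)
  let φ : ℕ → tetrahedron a₁ a₂ → tetrahedron a₁ a₂ := fun s x =>
    ⟨⟨(x.1.1.1, x.1.1.2.shift m s), x.1.2⟩, x.2.1, x.2.2.shift ham⟩
  refine sum_eq_zero_of_averages hr φ (fun s x y h => ?_) _ fun x => ?_
  · have h0 := congrArg (fun z : tetrahedron a₁ a₂ => z.1.1) h
    have h1 : x.1.1.2.shift m s = y.1.1.2.shift m s := congrArg Prod.snd h0
    have h2 : x.1.1.1 = y.1.1.1 := (Prod.ext_iff.1 h0).1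
    exact Subtype.ext (Subtype.ext (Prod.ext h2 (Tree.shift_injective h1)))
  · simp only [profileFun, φ, Tree.hor_shift]
    by_cases h : w.hor ≤ x.1.1.1.hor ∧ v.hor ≤ x.1.1.2.hor
    · by_cases h' : w'.hor ≤ x.1.1.1.hor ∧ v'.hor ≤ x.1.1.2.hor
      · have hmx : m ≤ x.1.1.2.hor := by
          by_contra hlt
          rw [v.lab_eq_zero m (by omega), v'.lab_eq_zero m (by omega)] at hm
          exact hm rfl
        simp only [h, h', if_true, and_self]
        have := Tree.sum_char_shift_mul ham hmx hm
        calc _ = p (x.1.1.1.hor - w.hor) * p' (x.1.1.1.hor - w'.hor) *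
              (Tree.char a₁ w x.1.1.1 * Tree.char a₁ w' x.1.1.1) *
              ∑ s ∈ Finset.range r, Tree.char a₂ v (x.1.1.2.shift m s) *
                Tree.char a₂ v' (x.1.1.2.shift m s) := by
                rw [Finset.mul_sum]
                exact Finset.sum_congr rfl fun s _ => by ring
          _ = 0 := by rw [this, mul_zero]
      · simp [h']
    · simp [h]

lemma profileFun_ne_zero (hw : Tree.IsCore a₁ w) (hv : Tree.IsCore a₂ v)
    (hwv : w.hor + v.hor ≤ 0) {p : ℤ → ℝ} (hp : p 0 ≠ 0) :
    (fun x : tetrahedron a₁ a₂ => profileFun a₁ w a₂ v p x) ≠ 0 := by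
  -- Continuing `v` with labels `0` down to height `-w.hor` makes `(w, y)` a vertex at position `0`
  -- of the path, where no Helmert factor vanishes.
  let y : Tree r := ⟨-w.hor, v.lab, v.lab_lt, fun m hm => v.lab_eq_zero m (by omega)⟩
  have hy : y.hor = -w.hor := rfl
  have hvy : a₂.IsAncestor y := ⟨by have := hv.1.1; omega, hv.1.2⟩
  intro h
  have h0 := congrFun h ⟨⟨(w, y), by simp [hy]⟩, hw.1, hvy⟩
  simp only [profileFun, Pi.zero_apply] at h0
  rw [if_pos ⟨le_rfl, by omega⟩, sub_self] at h0
  refine mul_ne_zero hp (mul_ne_zero ?_ ?_) h0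
  · exact Tree.char_self_ne_zero fun _ _ => rfl
  · exact Tree.char_self_ne_zero fun _ _ => rfl

end Orthogonality

/-- Nonzero pairwise orthogonal vectors are linearly independent, and these all lie in one
eigenspace. -/
lemma card_le_finrank_eigenspace {V ι : Type*} [Fintype V] (T : Module.End ℝ (V → ℝ)) (l : ℝ)
    (K : Finset ι) (b : ι → V → ℝ) (heig : ∀ i ∈ K, T (b i) = l • b i) (hne : ∀ i ∈ K, b i ≠ 0)
    (horth : ∀ i ∈ K, ∀ j ∈ K, i ≠ j → ∑ x, b i x * b j x = 0) :
    K.card ≤ Module.finrank ℝ (T.eigenspace l) := by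
  let B : K → T.eigenspace l := fun i => ⟨b i, Module.End.mem_eigenspace_iff.2 (heig i i.2)⟩
  have hB : LinearIndependent ℝ B := by
    refine LinearIndependent.of_comp (T.eigenspace l).subtype ?_
    rw [Fintype.linearIndependent_iff]
    intro g hg i
    have h1 : ∑ x, (∑ j : K, g j • b j) x * b i x = 0 := by
      have : ∑ j : K, g j • b j = 0 := hg
      rw [this]
      simp
    have h2 : ∑ x, (∑ j : K, g j • b j) x * b i x = g i * ∑ x, b i x * b i x := by
      simp only [Finset.sum_apply, Pi.smul_apply, smul_eq_mul, Finset.sum_mul]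
      rw [Finset.sum_comm, Finset.sum_eq_single i]
      · rw [Finset.mul_sum]
        exact Finset.sum_congr rfl fun x _ => by ring
      · intro j _ hj
        simp_rw [mul_assoc]
        rw [← Finset.mul_sum, horth j j.2 i i.2 (fun h => hj (Subtype.ext h)), mul_zero]
      · simp
    rw [h2] at h1
    refine (mul_eq_zero.1 h1).resolve_right fun h3 => hne i i.2 ?_
    funext x
    have := (Finset.sum_eq_zero_iff_of_nonneg fun x _ => mul_self_nonneg (b i x)).1 h3 x
      (Finset.mem_univ x)
    simpa using this
  simpa using hB.fintype_card_le_finrank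

/-! ## Cumulative spectral measures and lower bounds for multiplicities -/

/-- Eigenspaces to distinct eigenvalues are independent. Only this inequality is needed, so
diagonalizability never enters. -/
lemma sum_finrank_eigenspace_le {V : Type*} [Fintype V] (T : Module.End ℝ (V → ℝ)) :
    ∑ l : T.Eigenvalues, Module.finrank ℝ (T.eigenspace l) ≤ Fintype.card V := by
  classical
  have h : iSupIndep fun l : T.Eigenvalues => T.eigenspace (l : ℝ) :=
    T.eigenspaces_iSupIndep.comp Subtype.val_injective
  let φ : (DirectSum T.Eigenvalues fun l => T.eigenspace (l : ℝ)) →ₗ[ℝ] (V → ℝ) :=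
    DFinsupp.lsum ℕ fun l : T.Eigenvalues => (T.eigenspace (l : ℝ)).subtype
  have h1 := LinearMap.finrank_le_finrank_of_injective (f := φ) h.dfinsupp_lsum_injective
  rwa [Module.finrank_directSum, Module.finrank_fintype_fun_eq_card] at h1

lemma integral_cumulativeSpectralMeasure {V : Type*} [Finite V] (G : SimpleGraph V)
    [G.LocallyFinite] (f : ℝ →ᵇ ℝ) :
    ∫ t, f t ∂(cumulativeSpectralMeasure G) = (Nat.card V : ℝ)⁻¹ *
      ∑ l : Module.End.Eigenvalues (srwOp G),
        (Module.finrank ℝ (Module.End.eigenspace (srwOp G) (l : ℝ)) : ℝ) * f l := by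
  rw [cumulativeSpectralMeasure, integral_smul_measure, Measure.sum_fintype,
    integral_finsetSum_measure]
  · simp
  · intro l _
    exact Integrable.smul_measure (integrable_dirac (by simp)) (by simp)

/-- If the multiplicities of the eigenvalues of `G` are bounded below by those in a family `σ` of
finite sets of reals, then the cumulative spectral measure is close to the normalized counting
measure of the family, with an error controlled by the defect of the total number. -/
lemma abs_integral_cumulativeSpectralMeasure_sub_le {V ι : Type*} [Fintype V] [Nonempty V]
    (G : SimpleGraph V) [G.LocallyFinite] (K : Finset ι) (σ : ι → Finset ℝ)
    (hσ : ∀ l : ℝ, (K.filter fun i => l ∈ σ i).card ≤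
      Module.finrank ℝ (Module.End.eigenspace (srwOp G) l)) (f : ℝ →ᵇ ℝ) :
    |∫ t, f t ∂(cumulativeSpectralMeasure G) -
        (Nat.card V : ℝ)⁻¹ * ∑ i ∈ K, ∑ l ∈ σ i, f l| ≤
      ‖f‖ * (1 - (Nat.card V : ℝ)⁻¹ * ∑ i ∈ K, ((σ i).card : ℝ)) := by
  classical
  have hint := integral_cumulativeSpectralMeasure G f
  set T : Module.End ℝ (V → ℝ) := srwOp G
  have hcard : (0 : ℝ) < Nat.card V := by exact_mod_cast Nat.card_pos
  have key : ∀ g : ℝ → ℝ, ∑ i ∈ K, ∑ l ∈ σ i, g l =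
      ∑ l : Module.End.Eigenvalues T, ((K.filter fun i => (l : ℝ) ∈ σ i).card : ℝ) * g l := by
    intro g
    have h1 : ∀ i ∈ K, ∑ l ∈ σ i, g l =
        ∑ l : Module.End.Eigenvalues T, if (l : ℝ) ∈ σ i then g l else 0 := by
      intro i hi
      -- A listed number has an eigenspace of dimension at least one, so the sum over the lists can
      -- be rearranged as a sum over the eigenvalues.
      have hsub : ∀ l ∈ σ i, T.HasEigenvalue l := by
        intro l hl
        rw [Module.End.hasEigenvalue_iff]
        intro hbot
        have h2 := hσ l
        rw [hbot, finrank_bot, Nat.le_zero, Finset.card_eq_zero] at h2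
        have h3 : i ∈ K.filter fun i => l ∈ σ i := Finset.mem_filter.2 ⟨hi, hl⟩
        rw [h2] at h3
        simp at h3
      rw [← Finset.sum_filter]
      refine (Finset.sum_bij (fun (l : Module.End.Eigenvalues T) _ => (l : ℝ)) ?_ ?_ ?_ ?_).symm
      · intro l hl
        exact (Finset.mem_filter.1 hl).2
      · intro l _ l' _ h
        exact Subtype.ext h
      · intro l hl
        exact ⟨⟨l, hsub l hl⟩, Finset.mem_filter.2 ⟨Finset.mem_univ _, hl⟩, rfl⟩
      · intro l _
        rfl
    rw [Finset.sum_congr rfl h1, Finset.sum_comm]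
    refine Finset.sum_congr rfl fun l _ => ?_
    rw [← Finset.sum_filter, Finset.sum_const, nsmul_eq_mul]
  have hone : ∑ i ∈ K, ((σ i).card : ℝ) = ∑ l : Module.End.Eigenvalues T,
      ((K.filter fun i => (l : ℝ) ∈ σ i).card : ℝ) := by
    simpa using key fun _ => 1
  have htot : (∑ l : Module.End.Eigenvalues T, (Module.finrank ℝ (T.eigenspace (l : ℝ)) : ℝ)) ≤
      Nat.card V := by
    rw [Nat.card_eq_fintype_card]
    exact_mod_cast sum_finrank_eigenspace_le T
  rw [hint, key, hone, ← mul_sub, ← Finset.sum_sub_distrib, abs_mul, abs_of_pos (inv_pos.2 hcard)]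
  -- Each unaccounted multiplicity is nonnegative, so the error is at most `‖f‖` times their total,
  -- and the true multiplicities sum to at most `|V|`.
  have h4 : |∑ l : Module.End.Eigenvalues T, ((Module.finrank ℝ (T.eigenspace (l : ℝ)) : ℝ) * f l -
      ((K.filter fun i => (l : ℝ) ∈ σ i).card : ℝ) * f l)| ≤
      ∑ l : Module.End.Eigenvalues T, ((Module.finrank ℝ (T.eigenspace (l : ℝ)) : ℝ) -
        ((K.filter fun i => (l : ℝ) ∈ σ i).card : ℝ)) * ‖f‖ := by
    refine (Finset.abs_sum_le_sum_abs _ _).trans (Finset.sum_le_sum fun l _ => ?_)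
    have h5 : (0 : ℝ) ≤ (Module.finrank ℝ (T.eigenspace (l : ℝ)) : ℝ) -
        ((K.filter fun i => (l : ℝ) ∈ σ i).card : ℝ)  := by
      rw [sub_nonneg]
      exact_mod_cast hσ l
    rw [← sub_mul, abs_mul, abs_of_nonneg h5]
    exact mul_le_mul_of_nonneg_left (f.norm_coe_le_norm l) h5
  rw [← Finset.sum_mul, Finset.sum_sub_distrib (fun l : Module.End.Eigenvalues T =>
    (Module.finrank ℝ (T.eigenspace (l : ℝ)) : ℝ))] at h4
  refine (mul_le_mul_of_nonneg_left h4 (inv_pos.2 hcard).le).trans ?_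
  calc _ ≤ (Nat.card V : ℝ)⁻¹ * ((Nat.card V - ∑ l : Module.End.Eigenvalues T,
        ((K.filter fun i => (l : ℝ) ∈ σ i).card : ℝ)) * ‖f‖) := by gcongr
    _ = ‖f‖ * (1 - (Nat.card V : ℝ)⁻¹ * ∑ l : Module.End.Eigenvalues T,
        ((K.filter fun i => (l : ℝ) ∈ σ i).card : ℝ)) := by
      rw [mul_comm _ ‖f‖, mul_left_comm, mul_sub, inv_mul_cancel₀ hcard.ne']

/-! ## Counting vertices -/

open Classical in
/-- The descendants of `a` in generation `k`. -/
def Tree.descendants {q : ℕ} (a : Tree q) : ℕ → Finset (Tree q)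
  | 0 => {a}
  | k + 1 => (Tree.descendants a k ×ˢ Finset.univ).image fun y => y.1.succ y.2

open Classical in
/-- The cores `w` below `a` in generation `k`. -/
def Tree.cores {q : ℕ} (a : Tree q) : ℕ → Finset (Tree q)
  | 0 => {a}
  | k + 1 => (a.descendants k ×ˢ Finset.univ.filter fun b : Fin q => (b : ℕ) ≠ 0).image
      fun y => y.1.succ y.2

section Counting

variable {q : ℕ} (a : Tree q)

lemma Tree.succ_inj {x y : Tree q} {b c : Fin q} (h : x.succ b = y.succ c) : x = y ∧ b = c := by
  have h1 : x = y := by rw [← x.pred_succ b, h, Tree.pred_succ]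
  subst h1
  exact ⟨rfl, x.succ_injective h⟩

lemma Tree.mem_descendants (k : ℕ) (x : Tree q) :
    x ∈ a.descendants k ↔ a.IsAncestor x ∧ x.hor = a.hor + k := by
  induction k generalizing x with
  | zero =>
    simp only [Tree.descendants, Finset.mem_singleton, Nat.cast_zero, add_zero]
    constructor
    · rintro rfl
      exact ⟨x.isAncestor_refl, rfl⟩
    · rintro ⟨h1, h2⟩
      exact Tree.ext_of_le h2 fun m hm => h1.2 m (by omega)
  | succ k ih =>
    simp only [Tree.descendants, Finset.mem_image, Finset.mem_product, ih, Finset.mem_univ,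
      and_true, Prod.exists]
    constructor
    · rintro ⟨y, b, ⟨h1, h2⟩, rfl⟩
      exact ⟨h1.succ b, by simp [h2]; omega⟩
    · rintro ⟨h1, h2⟩
      obtain ⟨b, hb⟩ := (Tree.isSucc_iff_exists x.pred x).1 ((Tree.isSucc_iff_eq_pred _ _).2 rfl)
      refine ⟨x.pred, b, ⟨(h1.pred_iff).2 (by omega), by simp; omega⟩, hb⟩

lemma Tree.card_descendants (k : ℕ) : (a.descendants k).card = q ^ k := by
  classical
  induction k with
  | zero => simp [Tree.descendants]
  | succ k ih =>
    rw [Tree.descendants, Finset.card_image_of_injective, Finset.card_product, ih, pow_succ]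
    · simp
    · rintro ⟨x, b⟩ ⟨y, c⟩ h
      exact Prod.ext (Tree.succ_inj h).1 (Tree.succ_inj h).2

lemma Tree.mem_cores {k : ℕ} {x : Tree q} (h : x ∈ a.cores k) :
    a.IsCore x ∧ x.hor = a.hor + k := by
  cases k with
  | zero =>
    simp only [Tree.cores, Finset.mem_singleton] at h
    subst h
    exact ⟨⟨x.isAncestor_refl, by simp⟩, by simp⟩
  | succ k =>
    simp only [Tree.cores, Finset.mem_image, Finset.mem_product, Finset.mem_filter,
      Finset.mem_univ, true_and, Prod.exists, Tree.mem_descendants] at h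
    obtain ⟨y, b, ⟨⟨h1, h2⟩, h3⟩, rfl⟩ := h
    refine ⟨⟨h1.succ b, fun _ => ?_⟩, by simp [h2]; omega⟩
    simpa using h3

lemma Tree.card_cores_succ (k : ℕ) : (a.cores (k + 1)).card = (q - 1) * q ^ k := by
  classical
  have h0 : (Finset.univ.filter fun b : Fin q => (b : ℕ) ≠ 0).card = q - 1 := by
    cases q with
    | zero => simp
    | succ n =>
      have : (Finset.univ.filter fun b : Fin (n + 1) => (b : ℕ) ≠ 0) = Finset.univ.erase 0 := by
        ext b
        rw [Finset.mem_filter, Finset.mem_erase, ne_eq, ne_eq, Fin.ext_iff, Fin.val_zero]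
        tauto
      rw [this]
      simp
  rw [Tree.cores, Finset.card_image_of_injective, Finset.card_product, Tree.card_descendants, h0,
    mul_comm]
  rintro ⟨x, b⟩ ⟨y, c⟩ h
  exact Prod.ext (Tree.succ_inj h).1 (Tree.succ_inj h).2

end Counting

/-- The vertices are sorted by the generation `k` of `x₁` below `a₁`; then `x₂` is in generation `n
- k` below `a₂`. -/
lemma card_tetrahedron {q r : ℕ} (a₁ : Tree q) (a₂ : Tree r) {n : ℕ}
    (hn : -a₂.hor = a₁.hor + n) :
    Nat.card (tetrahedron a₁ a₂) = ∑ k ∈ Finset.range (n + 1), q ^ k * r ^ (n - k) := by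
  let D : Finset (Σ _ : ℕ, Tree q × Tree r) :=
    (Finset.range (n + 1)).sigma fun k => a₁.descendants k ×ˢ a₂.descendants (n - k)
  have hD : D.card = ∑ k ∈ Finset.range (n + 1), q ^ k * r ^ (n - k) := by
    simp [D, Finset.card_sigma, Finset.card_product, Tree.card_descendants]
  have hmem : ∀ d ∈ D, d.1 ≤ n ∧ (a₁.IsAncestor d.2.1 ∧ d.2.1.hor = a₁.hor + d.1) ∧
      a₂.IsAncestor d.2.2 ∧ d.2.2.hor = a₂.hor + ((n - d.1 : ℕ) : ℤ) := by
    rintro ⟨k, x, y⟩ hd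
    simp only [D, Finset.mem_sigma, Finset.mem_range, Finset.mem_product,
      Tree.mem_descendants] at hd
    exact ⟨by simp; omega, hd.2⟩
  let φ : D → tetrahedron a₁ a₂ := fun d =>
    ⟨⟨d.1.2, by have := hmem d.1 d.2; omega⟩, (hmem d.1 d.2).2.1.1, (hmem d.1 d.2).2.2.1⟩
  have hφ : Function.Bijective φ := by
    constructor
    · rintro ⟨⟨k, x⟩, hk⟩ ⟨⟨l, y⟩, hl⟩ h
      have hxy : x = y := congrArg Subtype.val (congrArg Subtype.val h)
      subst hxy
      have h1 := (hmem _ hk).2.1.2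
      have h2 := (hmem _ hl).2.1.2
      have hkl : k = l := by
        simp only at h1 h2
        omega
      subst hkl
      rfl
    · rintro ⟨⟨⟨x, y⟩, hxy⟩, h1, h2⟩
      have hxy' : x.hor + y.hor = 0 := hxy
      have h1' : a₁.IsAncestor x := h1
      have h2' : a₂.IsAncestor y := h2
      have h3 := h1'.1
      have h4 := h2'.1
      refine ⟨⟨⟨(x.hor - a₁.hor).toNat, x, y⟩, ?_⟩, rfl⟩
      simp only [D, Finset.mem_sigma, Finset.mem_range, Finset.mem_product,
        Tree.mem_descendants]
      exact ⟨by omega, ⟨h1', by omega⟩, h2', by omega⟩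
  rw [← Nat.card_eq_of_bijective φ hφ, ← hD]
  simp

lemma card_tetrahedron_mul {q r : ℕ} (a₁ : Tree q) (a₂ : Tree r) {n : ℕ}
    (hn : -a₂.hor = a₁.hor + n) :
    (Nat.card (tetrahedron a₁ a₂) : ℝ) * (r - q) = (r : ℝ) ^ (n + 1) - (q : ℝ) ^ (n + 1) := by
  have := geom_sum₂_mul (q : ℝ) (r : ℝ) (n + 1)
  rw [card_tetrahedron a₁ a₂ hn]
  push_cast
  simp only [Nat.add_sub_cancel] at this
  linear_combination -this

/-! ## The polynomials `T_N - c X U_{N-1}` -/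

open Polynomial in
/-- The polynomial `T_N - c X U_{N-1}`. -/
def boundaryPoly (c : ℝ) (N : ℤ) : ℝ[X] :=
  Chebyshev.T ℝ N - C c * (X * Chebyshev.U ℝ (N - 1))

section BoundaryPoly

variable {c : ℝ}

/-- Both `T_N` and `U_{N-1}` obey the Chebyshev recurrence, hence so does the combination with
coefficients independent of `N`. -/
lemma eval_boundaryPoly_add_one (N : ℤ) (x : ℝ) :
    (boundaryPoly c (N + 1)).eval x + (boundaryPoly c (N - 1)).eval x =
      2 * x * (boundaryPoly c N).eval x := by
  have h1 := congrArg (Polynomial.eval x) (Polynomial.Chebyshev.T_add_one ℝ N)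
  have h2 := congrArg (Polynomial.eval x) (Polynomial.Chebyshev.U_add_one ℝ (N - 1))
  simp only [Polynomial.eval_sub, Polynomial.eval_mul, Polynomial.eval_X,
    Polynomial.eval_ofNat, sub_add_cancel] at h1 h2
  simp only [boundaryPoly, Polynomial.eval_sub, Polynomial.eval_mul, Polynomial.eval_X,
    Polynomial.eval_C, add_sub_cancel_right, h1, h2]
  ring

lemma eval_boundaryPoly_cos (N : ℤ) (a : ℝ) :
    (boundaryPoly c N).eval (Real.cos a) * Real.sin a =
      Real.sin a * Real.cos (N * a) - c * Real.cos a * Real.sin (N * a) := by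
  have h2 := Polynomial.Chebyshev.U_real_cos a (N - 1)
  push_cast at h2
  rw [sub_add_cancel] at h2
  simp only [boundaryPoly, Polynomial.eval_sub, Polynomial.eval_mul, Polynomial.eval_X,
    Polynomial.eval_C, Polynomial.Chebyshev.T_real_cos]
  linear_combination -(c * Real.cos a) * h2

lemma eval_boundaryPoly_cosh (N : ℤ) (a : ℝ) :
    (boundaryPoly c N).eval (Real.cosh a) * Real.sinh a =
      Real.sinh a * Real.cosh (N * a) - c * Real.cosh a * Real.sinh (N * a) := by
  have h2 := Polynomial.Chebyshev.U_real_cosh a (N - 1)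
  push_cast at h2
  rw [sub_add_cancel] at h2
  simp only [boundaryPoly, Polynomial.eval_sub, Polynomial.eval_mul, Polynomial.eval_X,
    Polynomial.eval_C, Polynomial.Chebyshev.T_real_cosh]
  linear_combination -(c * Real.cosh a) * h2

lemma eval_boundaryPoly_one (N : ℤ) : (boundaryPoly c N).eval 1 = 1 - c * N := by
  simp [boundaryPoly, Polynomial.Chebyshev.T_eval_one, Polynomial.Chebyshev.U_eval_one]

lemma eval_boundaryPoly_neg_eq_zero {N : ℕ} (hN : 1 ≤ N) {x : ℝ}
    (hx : (boundaryPoly c N).eval x = 0) : (boundaryPoly c N).eval (-x) = 0 := by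
  obtain ⟨n, rfl⟩ : ∃ n, N = n + 1 := ⟨N - 1, by omega⟩
  have h2 := Polynomial.Chebyshev.U_eval_neg (R := ℝ) n x
  have h1 := Polynomial.Chebyshev.T_eval_neg (R := ℝ) ((n : ℤ) + 1) x
  rw [Int.negOnePow_succ] at h1
  simp only [boundaryPoly, Polynomial.eval_sub, Polynomial.eval_mul, Polynomial.eval_X,
    Polynomial.eval_C, Nat.cast_add, Nat.cast_one, add_sub_cancel_right, h1, h2] at hx ⊢
  push_cast
  linear_combination -(((n : ℤ).negOnePow : ℤ) : ℝ) * hx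

/-- At these points `U_{N-1}` vanishes and `T_N` is `±1`: the sign alternates independently of `c`,
which locates the roots. -/
lemma eval_boundaryPoly_cos_mul_pi_div {N k : ℕ} (hk : 1 ≤ k) (hkN : k < N) :
    (boundaryPoly c N).eval (Real.cos (k * Real.pi / N)) = (-1) ^ k := by
  have hN : (0 : ℝ) < N := by exact_mod_cast (by omega : 0 < N)
  have hk' : (0 : ℝ) < k := by exact_mod_cast hk
  have hkN' : (k : ℝ) < N := by exact_mod_cast hkN
  have hsin : 0 < Real.sin (k * Real.pi / N) := by
    refine Real.sin_pos_of_pos_of_lt_pi (by positivity) ?_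
    rw [div_lt_iff₀ hN, mul_comm]
    exact mul_lt_mul_of_pos_left hkN' Real.pi_pos
  have h := eval_boundaryPoly_cos (c := c) N (k * Real.pi / N)
  have h1 : (((N : ℕ) : ℤ) : ℝ) * (k * Real.pi / N) = k * Real.pi := by
    push_cast
    field_simp
  rw [h1, Real.sin_nat_mul_pi, Real.cos_nat_mul_pi, mul_zero, sub_zero, mul_comm] at h
  exact mul_left_cancel₀ hsin.ne' h

/-- For `N ≥ 2` a value `-1` is attained. The hypothesis serves the case `N = 1`, where the
polynomial is `(1 - c) X`. -/
lemma boundaryPoly_ne_zero (hc : c < 1) (N : ℕ) : boundaryPoly c N ≠ 0 := by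
  rcases lt_trichotomy N 1 with h | h | h
  · obtain rfl : N = 0 := by omega
    simp [boundaryPoly]
  · subst h
    intro h0
    have := eval_boundaryPoly_one (c := c) ((1 : ℕ) : ℤ)
    rw [h0] at this
    simp at this
    linarith
  · intro h0
    have := eval_boundaryPoly_cos_mul_pi_div (c := c) le_rfl h
    rw [h0] at this
    simp at this

lemma natDegree_boundaryPoly_le (N : ℕ) : (boundaryPoly c N).natDegree ≤ N := by
  refine (Polynomial.natDegree_sub_le _ _).trans (max_le ?_ ?_)
  · simp [Polynomial.Chebyshev.natDegree_T]
  · rcases N with _ | n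
    · simp
    · refine (Polynomial.natDegree_C_mul_le _ _).trans (Polynomial.natDegree_mul_le.trans ?_)
      simp
      omega

/-- The set of real roots of `T_N - c X U_{N-1}`. -/
def boundaryRoots (c : ℝ) (N : ℕ) : Finset ℝ := (boundaryPoly c N).roots.toFinset

lemma mem_boundaryRoots (hc : c < 1) {N : ℕ} {x : ℝ} :
    x ∈ boundaryRoots c N ↔ (boundaryPoly c N).eval x = 0 := by
  simp [boundaryRoots, boundaryPoly_ne_zero hc N]

lemma card_boundaryRoots_le (N : ℕ) : (boundaryRoots c N).card ≤ N :=
  (Multiset.toFinset_card_le _).trans ((Polynomial.card_roots' _).trans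
    (natDegree_boundaryPoly_le N))

lemma exists_eval_eq_zero_of_mul_neg (p : Polynomial ℝ) {a b : ℝ} (hab : a < b)
    (h : p.eval a * p.eval b < 0) : ∃ x ∈ Ioo a b, p.eval x = 0 := by
  have hcont : ContinuousOn (fun x => p.eval x) (Icc a b) := p.continuous.continuousOn
  rcases mul_neg_iff.1 h with ⟨h1, h2⟩ | ⟨h1, h2⟩
  · exact intermediate_value_Ioo' hab.le hcont ⟨h2, h1⟩
  · exact intermediate_value_Ioo hab.le hcont ⟨h1, h2⟩

lemma cos_mul_pi_div_lt {N i j : ℕ} (hij : i < j) (hj : j ≤ N) :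
    Real.cos (j * Real.pi / N) < Real.cos (i * Real.pi / N) := by
  have hN : (0 : ℝ) < N := by exact_mod_cast (by omega : 0 < N)
  have hij' : (i : ℝ) < j := by exact_mod_cast hij
  have hj' : (j : ℝ) ≤ N := by exact_mod_cast hj
  refine Real.cos_lt_cos_of_nonneg_of_le_pi (by positivity) ?_ ?_
  · rw [div_le_iff₀ hN, mul_comm]
    exact mul_le_mul_of_nonneg_left hj' Real.pi_pos.le
  · gcongr

/-- The number `e^{2a} = (1 + c) / (1 - c)` determines an upper bound for the roots. -/
lemma exists_eval_boundaryPoly_pos (hc0 : 0 < c) (hc1 : c < 1) (N : ℕ) :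
    ∃ x, 1 < x ∧ 0 < (boundaryPoly c N).eval x := by
  set a := Real.log ((1 + c) / (1 - c)) / 2
  have hpos : 0 < 1 - c := by linarith
  have ha : 0 < a := by
    refine half_pos (Real.log_pos ?_)
    rw [lt_div_iff₀ hpos]
    linarith
  have he : Real.exp a * Real.exp a * (1 - c) = 1 + c := by
    rw [← Real.exp_add, add_halves, Real.exp_log (by positivity)]
    field_simp
  have hee : Real.exp a * Real.exp (-a) = 1 := by rw [← Real.exp_add]; simp
  -- The choice of `a` means `tanh a = c`, which reduces the value at `cosh a` to `cosh (N a) - sinh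
  -- (N a) > 0`.
  have hs : Real.sinh a = c * Real.cosh a := by
    have h0 : Real.exp a * (Real.sinh a - c * Real.cosh a) = 0 := by
      rw [Real.sinh_eq, Real.cosh_eq]
      linear_combination (1 / 2) * he - (1 + c) / 2 * hee
    have := (mul_eq_zero.1 h0).resolve_left (Real.exp_pos a).ne'
    linarith
  refine ⟨Real.cosh a, Real.one_lt_cosh.2 ha.ne', ?_⟩
  have h := eval_boundaryPoly_cosh (c := c) N a
  rw [← hs, ← mul_sub, mul_comm] at h
  rw [mul_left_cancel₀ (Real.sinh_pos_iff.2 ha).ne' h]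
  exact sub_pos.2 (Real.sinh_lt_cosh _)

/-- All roots of `T_N - c X U_{N-1}` are real and simple: `N - 2` of them are between
`-cos (π / N)` and `cos (π / N)`, and there are two others `±x₀`. -/
lemma exists_boundaryRoots_eq (hc0 : 0 < c) (hc1 : c < 1) {N : ℕ} (hN : 2 ≤ N) :
    ∃ (M : Finset ℝ) (x₀ : ℝ), M.card = N - 2 ∧
      (∀ x ∈ M, -Real.cos (Real.pi / N) < x ∧ x < Real.cos (Real.pi / N)) ∧
      Real.cos (Real.pi / N) < x₀ ∧ (c * N < 1 → x₀ < 1) ∧ (c * N = 1 → x₀ = 1) ∧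
      (1 < c * N → 1 < x₀) ∧ boundaryRoots c N = M ∪ {x₀, -x₀} := by
  have hN0 : (0 : ℝ) < N := by exact_mod_cast (by omega : 0 < N)
  -- The signs at the `N - 1` points `cos(kπ/N)`, `1 ≤ k ≤ N - 1`, alternate and enclose `N - 2`
  -- roots.
  have hξ : ∀ j ∈ Finset.range (N - 2), ∃ x ∈ Ioo (Real.cos (((j + 2 : ℕ) : ℝ) * Real.pi / N))
      (Real.cos (((j + 1 : ℕ) : ℝ) * Real.pi / N)), (boundaryPoly c N).eval x = 0 := by
    intro j hj
    have hj' := Finset.mem_range.1 hj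
    refine exists_eval_eq_zero_of_mul_neg _ (cos_mul_pi_div_lt (by omega) (by omega)) ?_
    rw [eval_boundaryPoly_cos_mul_pi_div (by omega) (by omega),
      eval_boundaryPoly_cos_mul_pi_div (by omega) (by omega), ← pow_add]
    exact (Odd.neg_one_pow ⟨j + 1, by ring⟩).trans_lt (by norm_num)
  choose! ξ hξ1 hξ2 using hξ
  have hanti : ∀ i j, i < j → j < N - 2 → ξ j < ξ i := by
    intro i j hij hj
    have h1 := (hξ1 j (Finset.mem_range.2 hj)).2
    have h2 := (hξ1 i (Finset.mem_range.2 (by omega))).1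
    refine h1.trans_le (le_trans ?_ h2.le)
    rcases (show i + 2 ≤ j + 1 by omega).eq_or_lt with h | h
    · rw [h]
    · exact (cos_mul_pi_div_lt h (by omega)).le
  have hinj : Set.InjOn ξ (Finset.range (N - 2)) := by
    intro i hi j hj h
    have hi' := Finset.mem_range.1 hi
    have hj' := Finset.mem_range.1 hj
    rcases lt_trichotomy i j with h3 | h3 | h3
    · exact absurd h (hanti i j h3 hj').ne'
    · exact h3
    · exact absurd h (hanti j i h3 hi').ne
  have hcos1 : Real.cos (((1 : ℕ) : ℝ) * Real.pi / N) = Real.cos (Real.pi / N) := by simp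
  have hcosN : Real.cos (((N - 1 : ℕ) : ℝ) * Real.pi / N) = -Real.cos (Real.pi / N) := by
    rw [← Real.cos_pi_sub, Nat.cast_sub (by omega)]
    congr 1
    push_cast
    field_simp
  have hMb : ∀ x ∈ (Finset.range (N - 2)).image ξ,
      -Real.cos (Real.pi / N) < x ∧ x < Real.cos (Real.pi / N) := by
    intro x hx
    obtain ⟨j, hj, rfl⟩ := Finset.mem_image.1 hx
    have hj' := Finset.mem_range.1 hj
    rw [← hcosN, ← hcos1]
    constructor
    · refine lt_of_le_of_lt ?_ (hξ1 j hj).1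
      rcases (show j + 2 ≤ N - 1 by omega).eq_or_lt with h | h
      · rw [h]
      · exact (cos_mul_pi_div_lt h (by omega)).le
    · refine lt_of_lt_of_le (hξ1 j hj).2 ?_
      rcases (show 1 ≤ j + 1 by omega).eq_or_lt with h | h
      · rw [← h]
      · exact (cos_mul_pi_div_lt h (by omega)).le
  have hlt1 : Real.cos (Real.pi / N) < 1 := by
    have := cos_mul_pi_div_lt (N := N) (i := 0) (j := 1) (by omega) (by omega)
    simpa using this
  have hval1 := eval_boundaryPoly_one (c := c) ((N : ℕ) : ℤ)
  push_cast at hval1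
  have hvalcos : (boundaryPoly c N).eval (Real.cos (Real.pi / N)) = -1 := by
    have := eval_boundaryPoly_cos_mul_pi_div (c := c) (N := N) (k := 1) le_rfl (by omega)
    rwa [hcos1, pow_one] at this
  -- The largest root: the value at `cos(π/N)` is `-1` and the value at `1` is `1 - cN`. Its sign
  -- tells whether the next sign change occurs before, at or after `1`.
  obtain ⟨x₀, hx1, hx2, hx3, hx4, hx5⟩ : ∃ x₀, Real.cos (Real.pi / N) < x₀ ∧
      (c * N < 1 → x₀ < 1) ∧ (c * N = 1 → x₀ = 1) ∧ (1 < c * N → 1 < x₀) ∧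
      (boundaryPoly c N).eval x₀ = 0 := by
    rcases lt_trichotomy (c * N) 1 with h | h | h
    · obtain ⟨x, hx, hx'⟩ := exists_eval_eq_zero_of_mul_neg (boundaryPoly c N) hlt1
        (by rw [hvalcos, hval1]; linarith)
      exact ⟨x, hx.1, fun _ => hx.2, fun h' => absurd h' h.ne, fun h' => absurd h' h.not_gt, hx'⟩
    · exact ⟨1, hlt1, fun h' => absurd h h'.ne, fun _ => rfl, fun h' => absurd h h'.ne', by
        rw [hval1, h, sub_self]⟩
    · obtain ⟨y, hy1, hy2⟩ := exists_eval_boundaryPoly_pos hc0 hc1 N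
      obtain ⟨x, hx, hx'⟩ := exists_eval_eq_zero_of_mul_neg (boundaryPoly c N) hy1
        (mul_neg_of_neg_of_pos (by rw [hval1]; linarith) hy2)
      exact ⟨x, hlt1.trans hx.1, fun h' => absurd h' h.not_gt, fun h' => absurd h' h.ne',
        fun _ => hx.1, hx'⟩
  have hcos0 : 0 ≤ Real.cos (Real.pi / N) := by
    refine Real.cos_nonneg_of_mem_Icc ⟨?_, ?_⟩
    · have : 0 ≤ Real.pi / N := by positivity
      linarith [Real.pi_pos]
    · gcongr
      exact_mod_cast hN
  have hcard : ((Finset.range (N - 2)).image ξ).card = N - 2 := by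
    rw [Finset.card_image_of_injOn hinj, Finset.card_range]
  refine ⟨(Finset.range (N - 2)).image ξ, x₀, hcard, hMb, hx1, hx2, hx3, hx4, ?_⟩
  symm
  -- With `±x₀` there are `N` distinct roots, as many as the degree permits.
  refine Finset.eq_of_subset_of_card_le ?_ ?_
  · intro x hx
    rw [mem_boundaryRoots hc1]
    simp only [Finset.mem_union, Finset.mem_insert, Finset.mem_singleton] at hx
    rcases hx with hx | rfl | rfl
    · obtain ⟨j, hj, rfl⟩ := Finset.mem_image.1 hx
      exact hξ2 j hj
    · exact hx5
    · exact eval_boundaryPoly_neg_eq_zero (by omega) hx5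
  · refine (card_boundaryRoots_le N).trans ?_
    rw [Finset.card_union_of_disjoint, hcard, Finset.card_pair (by linarith)]
    · omega
    · rw [Finset.disjoint_left]
      intro x hx hx'
      have := hMb x hx
      simp only [Finset.mem_insert, Finset.mem_singleton] at hx'
      rcases hx' with rfl | rfl <;> linarith

lemma boundaryRoots_zero : boundaryRoots c 0 = ∅ := by
  simp [boundaryRoots, boundaryPoly]

lemma boundaryRoots_one (hc1 : c < 1) : boundaryRoots c 1 = {0} := by
  ext x
  rw [mem_boundaryRoots hc1, Finset.mem_singleton]
  have : (boundaryPoly c ((1 : ℕ) : ℤ)).eval x = (1 - c) * x := by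
    simp [boundaryPoly]
    ring
  rw [this, mul_eq_zero]
  constructor
  · rintro (h | h)
    · linarith
    · exact h
  · exact Or.inr

lemma card_boundaryRoots (hc0 : 0 < c) (hc1 : c < 1) (N : ℕ) : (boundaryRoots c N).card = N := by
  rcases Nat.lt_or_ge N 2 with h | h
  · interval_cases N
    · simp [boundaryRoots_zero]
    · simp [boundaryRoots_one hc1]
  · obtain ⟨M, x₀, h1, h2, h3, -, -, -, h4⟩ := exists_boundaryRoots_eq hc0 hc1 h
    have hcos0 : 0 ≤ Real.cos (Real.pi / N) := by
      have hN0 : (0 : ℝ) < N := by exact_mod_cast (by omega : 0 < N)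
      refine Real.cos_nonneg_of_mem_Icc ⟨?_, ?_⟩
      · have : 0 ≤ Real.pi / N := by positivity
        linarith [Real.pi_pos]
      · gcongr
        exact_mod_cast h
    rw [h4, Finset.card_union_of_disjoint, h1, Finset.card_pair (by linarith)]
    · omega
    · rw [Finset.disjoint_left]
      intro x hx hx'
      have := h2 x hx
      simp only [Finset.mem_insert, Finset.mem_singleton] at hx'
      rcases hx' with rfl | rfl <;> linarith

end BoundaryPoly

/-! ## Angle families -/

/-- The number `(r - q) / (r + q)`, the inverse of the threshold. -/
def ratio (q r : ℕ) : ℝ := ((r : ℝ) - q) / ((r : ℝ) + q)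

section Angles

variable {q r : ℕ}

lemma ratio_pos (hqr : q < r) : 0 < ratio q r := by
  have h : (q : ℝ) < r := by exact_mod_cast hqr
  have h0 : (0 : ℝ) ≤ q := Nat.cast_nonneg q
  exact div_pos (by linarith) (by linarith)

lemma ratio_lt_one (hq : 0 < q) (hqr : q < r) : ratio q r < 1 := by
  have h : (q : ℝ) < r := by exact_mod_cast hqr
  have h0 : (0 : ℝ) < q := by exact_mod_cast hq
  rw [ratio, div_lt_one (by linarith)]
  linarith

lemma ratio_mul_threshold (hqr : q < r) : ratio q r * threshold q r = 1 := by
  have h : (q : ℝ) < r := by exact_mod_cast hqr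
  have h0 : (0 : ℝ) ≤ q := Nat.cast_nonneg q
  have h1 : (r : ℝ) - q ≠ 0 := by linarith
  have h2 : (r : ℝ) + q ≠ 0 := by linarith
  rw [ratio, threshold]
  field_simp

lemma ratio_mul_lt_one_iff (hqr : q < r) (x : ℝ) : ratio q r * x < 1 ↔ x < threshold q r := by
  rw [← ratio_mul_threshold hqr, mul_lt_mul_iff_right₀ (ratio_pos hqr)]

lemma one_lt_ratio_mul_iff (hqr : q < r) (x : ℝ) : 1 < ratio q r * x ↔ threshold q r < x := by
  rw [← ratio_mul_threshold hqr, mul_lt_mul_iff_right₀ (ratio_pos hqr)]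

lemma ratio_mul_eq_one_iff (hqr : q < r) (x : ℝ) : ratio q r * x = 1 ↔ x = threshold q r := by
  rw [← ratio_mul_threshold hqr, mul_right_inj' (ratio_pos hqr).ne']

lemma one_lt_threshold (hq : 0 < q) (hqr : q < r) : 1 < threshold q r := by
  rw [← ratio_mul_lt_one_iff hqr, mul_one]
  exact ratio_lt_one hq hqr

lemma two_le_of_threshold_le (hq : 0 < q) (hqr : q < r) {N : ℕ} (h : threshold q r ≤ N) :
    2 ≤ N := by
  have : (1 : ℝ) < N := (one_lt_threshold hq hqr).trans_le h
  exact_mod_cast this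

/-- Clearing denominators turns the equation into the trigonometric form of the polynomial. No root
is lost to `sin (N a) = 0`, since this would force `cos (N a) = 0` as well. -/
lemma mem_cotRoots_iff {N : ℕ} {a : ℝ} : a ∈ cotRoots q r N ↔
    a ∈ Ioo 0 Real.pi ∧ (boundaryPoly (ratio q r) N).eval (Real.cos a) = 0 := by
  refine and_congr_right fun ha => ?_
  have hs : Real.sin a ≠ 0 := (Real.sin_pos_of_pos_of_lt_pi ha.1 ha.2).ne'
  have h := eval_boundaryPoly_cos (c := ratio q r) N a
  push_cast at h
  rw [Real.cot_eq_cos_div_sin, Real.cot_eq_cos_div_sin, ← ratio]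
  constructor
  · rintro ⟨h1, h2⟩
    field_simp at h2
    rw [← mul_right_inj' hs, mul_zero, mul_comm, h]
    linear_combination h2
  · intro h0
    rw [h0, zero_mul] at h
    have h1 : Real.sin (N * a) ≠ 0 := by
      intro h1
      rw [h1, mul_zero, sub_zero] at h
      have := Real.sin_sq_add_cos_sq (N * a)
      rw [h1, (mul_eq_zero.1 h.symm).resolve_left hs] at this
      norm_num at this
    refine ⟨h1, ?_⟩
    field_simp
    linear_combination -h

lemma mem_expRoots_iff (hqr : q < r) {N : ℕ} {a : ℝ} : a ∈ expRoots q r N ↔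
    0 < a ∧ (boundaryPoly (ratio q r) N).eval (Real.cosh a) = 0 := by
  refine and_congr_right fun ha => ?_
  have hq0 : (0 : ℝ) ≤ q := Nat.cast_nonneg q
  have hqr' : (q : ℝ) < r := by exact_mod_cast hqr
  have hs : Real.sinh a ≠ 0 := (Real.sinh_pos_iff.2 ha).ne'
  have h := eval_boundaryPoly_cosh (c := ratio q r) N a
  push_cast at h
  have hu : Real.exp a * Real.exp (-a) = 1 := by rw [← Real.exp_add]; simp
  have hv : Real.exp (N * a) * Real.exp (-(N * a)) = 1 := by rw [← Real.exp_add]; simp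
  have hu2 : Real.exp (2 * a) = Real.exp a * Real.exp a := by rw [← Real.exp_add]; ring_nf
  have hv2 : Real.exp (2 * N * a) = Real.exp (N * a) * Real.exp (N * a) := by
    rw [← Real.exp_add]; ring_nf
  have hc : ratio q r * (r + q) = r - q := by
    rw [ratio]
    exact div_mul_cancel₀ _ (by linarith)
  -- Clearing the negative exponentials and the denominator of `ratio q r` exhibits the exponential
  -- equation as a nonzero multiple of the polynomial at `cosh a`.
  have key : 2 * (r + q) * Real.exp a * Real.exp (N * a) *
      ((boundaryPoly (ratio q r) N).eval (Real.cosh a) * Real.sinh a) =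
      Real.exp (2 * N * a) * (q * Real.exp (2 * a) - r) - (q - r * Real.exp (2 * a)) := by
    rw [h, hu2, hv2, Real.sinh_eq, Real.cosh_eq, Real.sinh_eq, Real.cosh_eq]
    set u := Real.exp a
    set u' := Real.exp (-a)
    set v := Real.exp (N * a)
    set v' := Real.exp (-(N * a))
    have e1 : 2 * (r + q) * u * v * ((u - u') / 2 * ((v + v') / 2) -
        ratio q r * ((u + u') / 2) * ((v - v') / 2)) =
        (r + q) / 2 * ((u * u - u * u') * (v * v + v * v')) -
        (ratio q r * (r + q)) / 2 * ((u * u + u * u') * (v * v - v * v')) := by ring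
    rw [e1, hc, hu, hv]
    ring
  have hpos : 2 * ((r : ℝ) + q) * Real.exp a * Real.exp (N * a) ≠ 0 := by
    have : (0 : ℝ) < r + q := by linarith
    positivity
  constructor
  · rintro ⟨h1, h2⟩
    rw [eq_div_iff h1] at h2
    rw [h2, sub_self] at key
    exact (mul_eq_zero.1 ((mul_eq_zero.1 key).resolve_left hpos)).resolve_right hs
  · intro h0
    rw [h0, zero_mul, mul_zero] at key
    have h1 : (q : ℝ) * Real.exp (2 * a) - r ≠ 0 := by
      intro h1
      have h3 := h1
      rw [h1, mul_zero] at key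
      nlinarith
    refine ⟨h1, ?_⟩
    rw [eq_div_iff h1]
    linarith

lemma bijOn_cos_cotRoots (hq : 0 < q) (hqr : q < r) (N : ℕ) :
    BijOn Real.cos (cotRoots q r N)
      ((boundaryRoots (ratio q r) N).filter fun x => -1 < x ∧ x < 1) := by
  have hmem : ∀ x, x ∈ boundaryRoots (ratio q r) N ↔
      (boundaryPoly (ratio q r) N).eval x = 0 := fun x => mem_boundaryRoots (ratio_lt_one hq hqr)
  refine ⟨?_, ?_, ?_⟩
  · intro a ha
    rw [mem_cotRoots_iff] at ha
    rw [Finset.mem_coe, Finset.mem_filter, hmem]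
    refine ⟨ha.2, ?_, ?_⟩
    · rw [← Real.cos_pi]
      exact Real.cos_lt_cos_of_nonneg_of_le_pi ha.1.1.le le_rfl ha.1.2
    · rw [← Real.cos_zero]
      exact Real.cos_lt_cos_of_nonneg_of_le_pi le_rfl ha.1.2.le ha.1.1
  · intro a ha b hb h
    rw [mem_cotRoots_iff] at ha hb
    exact Real.injOn_cos ⟨ha.1.1.le, ha.1.2.le⟩ ⟨hb.1.1.le, hb.1.2.le⟩ h
  · intro x hx
    rw [Finset.mem_coe, Finset.mem_filter, hmem] at hx
    have hcos : Real.cos (Real.arccos x) = x := Real.cos_arccos hx.2.1.le hx.2.2.le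
    refine ⟨Real.arccos x, ?_, hcos⟩
    rw [mem_cotRoots_iff, hcos]
    refine ⟨⟨Real.arccos_pos.2 hx.2.2, ?_⟩, hx.1⟩
    refine lt_of_le_of_ne (Real.arccos_le_pi x) fun h => ?_
    rw [h, Real.cos_pi] at hcos
    linarith [hx.2.1]

lemma cos_pi_div_nonneg {N : ℕ} (hN : 2 ≤ N) : 0 ≤ Real.cos (Real.pi / N) := by
  have hN0 : (0 : ℝ) < N := by exact_mod_cast (by omega : 0 < N)
  refine Real.cos_nonneg_of_mem_Icc ⟨?_, ?_⟩
  · have : 0 ≤ Real.pi / N := by positivity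
    linarith [Real.pi_pos]
  · gcongr
    exact_mod_cast hN

lemma filter_boundaryRoots_of_lt (hq : 0 < q) (hqr : q < r) {N : ℕ}
    (h : (N : ℝ) < threshold q r) :
    ((boundaryRoots (ratio q r) N).filter fun x => -1 < x ∧ x < 1) =
      boundaryRoots (ratio q r) N := by
  refine Finset.filter_true_of_mem fun x hx => ?_
  rcases Nat.lt_or_ge N 2 with h2 | h2
  · interval_cases N
    · simp [boundaryRoots_zero] at hx
    · rw [boundaryRoots_one (ratio_lt_one hq hqr), Finset.mem_singleton] at hx
      subst hx
      norm_num
  · obtain ⟨M, x₀, -, h2', h3, h4, -, -, h5⟩ :=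
      exists_boundaryRoots_eq (ratio_pos hqr) (ratio_lt_one hq hqr) h2
    have h0 := cos_pi_div_nonneg h2
    have h6 := h4 ((ratio_mul_lt_one_iff hqr _).2 h)
    rw [h5] at hx
    simp only [Finset.mem_union, Finset.mem_insert, Finset.mem_singleton] at hx
    rcases hx with hx | rfl | rfl
    · have := h2' x hx
      constructor <;> linarith
    · constructor <;> linarith
    · constructor <;> linarith

/-- Above the threshold, the roots are those in `(-1, 1)` and two others `±x₀`. -/
lemma exists_boundaryRoots_eq_of_threshold_le (hq : 0 < q) (hqr : q < r) {N : ℕ}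
    (h : threshold q r ≤ N) :
    ∃ (M : Finset ℝ) (x₀ : ℝ), M.card = N - 2 ∧
      ((boundaryRoots (ratio q r) N).filter fun x => -1 < x ∧ x < 1) = M ∧
      boundaryRoots (ratio q r) N = M ∪ {x₀, -x₀} ∧ Disjoint M {x₀, -x₀} ∧
      ((N : ℝ) = threshold q r → x₀ = 1) ∧ (threshold q r < N → 1 < x₀) ∧ 1 ≤ x₀ := by
  have h2 := two_le_of_threshold_le hq hqr h
  obtain ⟨M, x₀, h1, h2', h3, -, h4, h4', h5⟩ :=
    exists_boundaryRoots_eq (ratio_pos hqr) (ratio_lt_one hq hqr) h2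
  rw [ratio_mul_eq_one_iff hqr] at h4
  rw [one_lt_ratio_mul_iff hqr] at h4'
  have hx₀ : 1 ≤ x₀ := by
    rcases h.lt_or_eq with h | h
    · exact (h4' h).le
    · exact (h4 h.symm).ge
  have hcos1 := Real.cos_le_one (Real.pi / N)
  have hM : ∀ x ∈ M, -1 < x ∧ x < 1 := fun x hx => by
    have := h2' x hx
    constructor <;> linarith
  refine ⟨M, x₀, h1, ?_, h5, ?_, h4, h4', hx₀⟩
  · ext x
    rw [Finset.mem_filter, h5]
    simp only [Finset.mem_union, Finset.mem_insert, Finset.mem_singleton]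
    constructor
    · rintro ⟨hx | rfl | rfl, h6, h7⟩
      · exact hx
      · linarith
      · linarith
    · exact fun hx => ⟨Or.inl hx, hM x hx⟩
  · rw [Finset.disjoint_left]
    intro x hx hx'
    have := hM x hx
    simp only [Finset.mem_insert, Finset.mem_singleton] at hx'
    rcases hx' with rfl | rfl <;> linarith

lemma exists_bijOn_cotRoots (hq : 0 < q) (hqr : q < r) (N : ℕ) (s : Finset ℕ)
    (hs : s.card = ((boundaryRoots (ratio q r) N).filter fun x => -1 < x ∧ x < 1).card) :
    ∃ f : ℕ → ℝ, BijOn f s (cotRoots q r N) := by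
  have hb := bijOn_cos_cotRoots hq hqr N
  refine s.finite_toSet.exists_bijOn_of_encard_eq ?_
  rw [← hb.injOn.encard_image, hb.image_eq, encard_coe_eq_coe_finsetCard,
    encard_coe_eq_coe_finsetCard, hs]

/-- `cosh` maps the positive solutions bijectively onto the roots larger than `1`, and `x₀` is the
only such root. -/
lemma exists_expRoots_eq_singleton (hq : 0 < q) (hqr : q < r) {N : ℕ}
    (h : threshold q r < N) : ∃ a, expRoots q r N = {a} := by
  obtain ⟨M, x₀, -, h1, h2, -, -, h3, -⟩ := exists_boundaryRoots_eq_of_threshold_le hq hqr h.le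
  have hx₀ := h3 h
  have hcosh : Real.cosh (Real.arcosh x₀) = x₀ := Real.cosh_arcosh hx₀.le
  refine ⟨Real.arcosh x₀, ?_⟩
  ext a
  rw [mem_expRoots_iff hqr, ← mem_boundaryRoots (ratio_lt_one hq hqr), mem_singleton_iff]
  have hroot : ∀ y, 1 < y → (y ∈ boundaryRoots (ratio q r) N ↔ y = x₀) := by
    intro y hy
    constructor
    · intro hy'
      rw [h2] at hy'
      simp only [Finset.mem_union, Finset.mem_insert, Finset.mem_singleton] at hy'
      rcases hy' with hy' | hy' | hy'
      · rw [← h1, Finset.mem_filter] at hy'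
        linarith [hy'.2.2]
      · exact hy'
      · linarith
    · rintro rfl
      rw [h2]
      simp
  constructor
  · rintro ⟨ha, ha'⟩
    rw [hroot _ (Real.one_lt_cosh.2 ha.ne')] at ha'
    rw [← ha', Real.arcosh_cosh ha.le]
  · rintro rfl
    rw [hcosh]
    exact ⟨Real.arcosh_pos hx₀, (hroot _ hx₀).2 rfl⟩

lemma exists_isAngleFamily (hq : 0 < q) (hqr : q < r) : ∃ α, IsAngleFamily q r α := by
  have key : ∀ N : ℕ, ∃ a : ℕ → ℝ,
      (1 ≤ N → (N : ℝ) < threshold q r → BijOn a (Ico 0 N) (cotRoots q r N)) ∧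
      (threshold q r ≤ (N : ℝ) → BijOn a (Icc 1 (N - 2)) (cotRoots q r N)) ∧
      ((N : ℝ) = threshold q r → a 0 = 0) ∧
      ((N : ℝ) = threshold q r → a (N - 1) = Real.pi) ∧
      (threshold q r < (N : ℝ) → expRoots q r N = {a 0}) := by
    intro N
    rcases lt_or_ge (N : ℝ) (threshold q r) with h | h
    · obtain ⟨f, hf⟩ := exists_bijOn_cotRoots hq hqr N (Finset.Ico 0 N) (by
        rw [filter_boundaryRoots_of_lt hq hqr h,
          card_boundaryRoots (ratio_pos hqr) (ratio_lt_one hq hqr)]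
        simp)
      rw [Finset.coe_Ico] at hf
      exact ⟨f, fun _ _ => hf, fun h' => absurd h' h.not_ge, fun h' => absurd h' h.ne,
        fun h' => absurd h' h.ne, fun h' => absurd h' h.not_gt⟩
    · have h2 := two_le_of_threshold_le hq hqr h
      obtain ⟨M, x₀, h1, h1', -⟩ := exists_boundaryRoots_eq_of_threshold_le hq hqr h
      obtain ⟨f, hf⟩ := exists_bijOn_cotRoots hq hqr N (Finset.Icc 1 (N - 2)) (by
        rw [h1', h1]
        simp)
      rw [Finset.coe_Icc] at hf
      rcases h.lt_or_eq with h | h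
      · obtain ⟨a, ha⟩ := exists_expRoots_eq_singleton hq hqr h
        refine ⟨Function.update f 0 a, fun _ h' => absurd h' h.not_gt, fun _ => ?_,
          fun h' => absurd h' h.ne', fun h' => absurd h' h.ne', fun _ => by simpa using ha⟩
        refine hf.congr fun m hm => ?_
        rw [Function.update_of_ne]
        have := hm.1
        omega
      -- At the threshold the two prescribed angles go to the indices `0` and `N - 1`, which differ
      -- as `N ≥ 2` and lie outside `1, …, N - 2`.
      · refine ⟨Function.update (Function.update f 0 0) (N - 1) Real.pi,
          fun _ h' => absurd h' h.le.not_gt, fun _ => ?_, fun _ => ?_, fun _ => by simp,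
          fun h' => absurd h' h.ge.not_gt⟩
        · refine hf.congr fun m hm => ?_
          have h3 := hm.1
          have h4 := hm.2
          rw [Function.update_of_ne (by omega), Function.update_of_ne (by omega)]
        · rw [Function.update_of_ne (by omega), Function.update_self]
  choose a h1 h2 h3 h4 h5 using key
  exact ⟨fun m N => a N m, h1, h2, h3, h4, h5⟩

variable {α : ℕ → ℕ → ℝ}

lemma IsAngleFamily.pos_and_eval_eq_zero (hα : IsAngleFamily q r α) (hqr : q < r) {N : ℕ}
    (h : threshold q r < N) :
    0 < α 0 N ∧ (boundaryPoly (ratio q r) N).eval (Real.cosh (α 0 N)) = 0 := by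
  rw [← mem_expRoots_iff hqr, hα.exp_root N h]
  rfl

/-- Sums over the angles `α_{0,N}, …, α_{N-1,N}` for `N` up to the threshold. -/
lemma IsAngleFamily.sum_of_le (hα : IsAngleFamily q r α) (hq : 0 < q) (hqr : q < r) {N : ℕ}
    (hN : 1 ≤ N) (h : (N : ℝ) ≤ threshold q r) {A : Type*} [AddCommMonoid A] (g : ℝ → A) :
    ∑ m ∈ Finset.Ico 0 N, g (Real.cos (α m N)) = ∑ x ∈ boundaryRoots (ratio q r) N, g x := by
  have hb := bijOn_cos_cotRoots hq hqr N
  rcases h.lt_or_eq with h | h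
  · rw [filter_boundaryRoots_of_lt hq hqr h] at hb
    have hb' := hb.comp (hα.below N hN h)
    rw [← Finset.coe_Ico] at hb'
    exact Finset.sum_nbij (fun m => Real.cos (α m N)) (fun m hm => hb'.mapsTo hm) hb'.injOn
      hb'.surjOn fun _ _ => rfl
  · have h2 := two_le_of_threshold_le hq hqr h.ge
    obtain ⟨M, x₀, -, h1', h3, h4, h5, -, -⟩ :=
      exists_boundaryRoots_eq_of_threshold_le hq hqr h.ge
    rw [h1'] at hb
    have hb' := hb.comp (hα.above N h.ge)
    rw [← Finset.coe_Icc] at hb'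
    have hsum : ∑ m ∈ Finset.Icc 1 (N - 2), g (Real.cos (α m N)) = ∑ x ∈ M, g x :=
      Finset.sum_nbij (fun m => Real.cos (α m N)) (fun m hm => hb'.mapsTo hm) hb'.injOn
        hb'.surjOn fun _ _ => rfl
    -- At the threshold `x₀ = 1`; the angles `0` and `π` at the two extra indices account for the
    -- roots `±1`.
    have hI : Finset.Ico 0 N = Finset.Icc 1 (N - 2) ∪ {0, N - 1} := by
      ext m
      simp only [Finset.mem_Ico, Finset.mem_union, Finset.mem_Icc, Finset.mem_insert,
        Finset.mem_singleton]
      omega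
    have hd : Disjoint (Finset.Icc 1 (N - 2)) {0, N - 1} := by
      rw [Finset.disjoint_left]
      intro m hm hm'
      simp only [Finset.mem_Icc, Finset.mem_insert, Finset.mem_singleton] at hm hm'
      omega
    rw [hI, h3, Finset.sum_union hd, Finset.sum_union h4, hsum, Finset.sum_pair (by omega), h5 h,
      Finset.sum_pair (by norm_num), hα.zero_of_eq N h, hα.last_of_eq N h, Real.cos_zero,
      Real.cos_pi]

/-- Sums over the angles `α_{0,N}, …, α_{N-2,N}` for `N` above the threshold. -/
lemma IsAngleFamily.sum_of_lt (hα : IsAngleFamily q r α) (hq : 0 < q) (hqr : q < r) {N : ℕ}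
    (h : threshold q r < (N : ℝ)) {A : Type*} [AddCommMonoid A] (g : ℝ → A) :
    ∑ m ∈ Finset.Icc 1 (N - 2), g (Real.cos (α m N)) +
        (g (Real.cosh (α 0 N)) + g (-Real.cosh (α 0 N))) =
      ∑ x ∈ boundaryRoots (ratio q r) N, g x := by
  have hb := bijOn_cos_cotRoots hq hqr N
  obtain ⟨M, x₀, -, h1', h3, h4, -, -, h5⟩ :=
    exists_boundaryRoots_eq_of_threshold_le hq hqr h.le
  rw [h1'] at hb
  have hb' := hb.comp (hα.above N h.le)
  rw [← Finset.coe_Icc] at hb'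
  have hsum : ∑ m ∈ Finset.Icc 1 (N - 2), g (Real.cos (α m N)) = ∑ x ∈ M, g x :=
    Finset.sum_nbij (fun m => Real.cos (α m N)) (fun m hm => hb'.mapsTo hm) hb'.injOn
      hb'.surjOn fun _ _ => rfl
  obtain ⟨ha, ha'⟩ := hα.pos_and_eval_eq_zero hqr h
  have hcosh : Real.cosh (α 0 N) = x₀ := by
    rw [← mem_boundaryRoots (ratio_lt_one hq hqr), h3] at ha'
    have h1 := Real.one_lt_cosh.2 ha.ne'
    simp only [Finset.mem_union, Finset.mem_insert, Finset.mem_singleton] at ha'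
    rcases ha' with h6 | h6 | h6
    · rw [← h1', Finset.mem_filter] at h6
      linarith [h6.2.2]
    · exact h6
    · linarith
  rw [h3, Finset.sum_union h4, hsum, Finset.sum_pair (by linarith), hcosh]

/-- Roots larger than `1` are `cosh α_{0,N}`. -/
lemma IsAngleFamily.eq_cosh (hα : IsAngleFamily q r α) (hqr : q < r) {N : ℕ}
    (h : threshold q r < (N : ℝ)) {x : ℝ} (hx : 1 < x)
    (hx' : (boundaryPoly (ratio q r) N).eval x = 0) : x = Real.cosh (α 0 N) := by
  have hcosh : Real.cosh (Real.arcosh x) = x := Real.cosh_arcosh hx.le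
  have : Real.arcosh x ∈ expRoots q r N := by
    rw [mem_expRoots_iff hqr, hcosh]
    exact ⟨Real.arcosh_pos hx, hx'⟩
  rw [hα.exp_root N h, mem_singleton_iff] at this
  rw [← this, hcosh]

/-- At the large root for `N` the polynomial for `N + 1` is negative, so its own unique root beyond
`1` lies further to the right. -/
lemma IsAngleFamily.cosh_lt_cosh_succ (hα : IsAngleFamily q r α) (hq : 0 < q) (hqr : q < r)
    {N : ℕ} (h : threshold q r < (N : ℝ)) :
    Real.cosh (α 0 N) < Real.cosh (α 0 (N + 1)) := by
  obtain ⟨ha, ha'⟩ := hα.pos_and_eval_eq_zero hqr h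
  have hN : 0 < N := (two_le_of_threshold_le hq hqr h.le).trans' (by norm_num)
  have hN' : (0 : ℝ) < N := by exact_mod_cast hN
  have hsucc : threshold q r < ((N + 1 : ℕ) : ℝ) := h.trans (by push_cast; linarith)
  set a := α 0 N
  have h1 := eval_boundaryPoly_cosh (c := ratio q r) N a
  have h2 := eval_boundaryPoly_cosh (c := ratio q r) ((N + 1 : ℕ) : ℤ) a
  rw [ha', zero_mul] at h1
  push_cast at h1 h2
  have hs := Real.sinh_pos_iff.2 ha
  have hsN := Real.sinh_pos_iff.2 (mul_pos hN' ha)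
  -- Eliminating `c` between levels `N` and `N + 1` by means of the root equation, together with
  -- `cosh² - sinh² = 1`.
  have h3 : (boundaryPoly (ratio q r) ((N + 1 : ℕ) : ℤ)).eval (Real.cosh a) *
      Real.sinh (N * a) = -Real.sinh a := by
    refine mul_left_cancel₀ hs.ne' ?_
    have e1 : Real.cosh ((N + 1) * a) =
        Real.cosh (N * a) * Real.cosh a + Real.sinh (N * a) * Real.sinh a := by
      rw [add_mul, one_mul, Real.cosh_add]
    have e2 : Real.sinh ((N + 1) * a) =
        Real.sinh (N * a) * Real.cosh a + Real.cosh (N * a) * Real.sinh a := by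
      rw [add_mul, one_mul, Real.sinh_add]
    push_cast
    rw [e1, e2] at h2
    have e3 := Real.cosh_sq (N * a)
    linear_combination Real.sinh (N * a) * h2 - (Real.cosh a * Real.sinh (N * a) +
      Real.sinh a * Real.cosh (N * a)) * h1 - Real.sinh a ^ 2 * e3
  have h4 : (boundaryPoly (ratio q r) ((N + 1 : ℕ) : ℤ)).eval (Real.cosh a) < 0 := by
    by_contra h5
    nlinarith
  have hc : ratio q r * ((N + 1 : ℕ) : ℝ) > 1 := (one_lt_ratio_mul_iff hqr _).2 hsucc
  have h5 := eval_boundaryPoly_one (c := ratio q r) ((N + 1 : ℕ) : ℤ)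
  rw [Int.cast_natCast] at h5
  obtain ⟨y, hy1, hy2⟩ := exists_eval_boundaryPoly_pos (ratio_pos hqr) (ratio_lt_one hq hqr) (N + 1)
  obtain ⟨x, hx, hx'⟩ := exists_eval_eq_zero_of_mul_neg _ hy1
    (mul_neg_of_neg_of_pos (by rw [h5]; linarith) hy2)
  -- A point `y` of positive value to the left of `cosh a` would yield two roots beyond `1`, one on
  -- each side of `y`.
  rcases lt_trichotomy y (Real.cosh a) with h6 | h6 | h6
  · obtain ⟨z, hz, hz'⟩ := exists_eval_eq_zero_of_mul_neg _ h6 (mul_neg_of_pos_of_neg hy2 h4)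
    have e1 := hα.eq_cosh hqr hsucc hx.1 hx'
    have e2 := hα.eq_cosh hqr hsucc (hy1.trans hz.1) hz'
    linarith [hx.2, hz.1]
  · rw [← h6] at h4
    linarith
  · obtain ⟨z, hz, hz'⟩ := exists_eval_eq_zero_of_mul_neg _ h6 (mul_neg_of_neg_of_pos h4 hy2)
    rw [← hα.eq_cosh hqr hsucc ((Real.one_lt_cosh.2 ha.ne').trans hz.1) hz']
    exact hz.1

end Angles

/-! ## The eigenvalues outside `[-ρ, ρ]` -/

section BigEig

variable {q r : ℕ} {α : ℕ → ℕ → ℝ}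

lemma rho_pos (hq : 0 < q) (hqr : q < r) : 0 < rho q r := by
  have h0 : (0 : ℝ) < q := by exact_mod_cast hq
  have h1 : (0 : ℝ) < r := by exact_mod_cast hq.trans hqr
  rw [rho]
  positivity

lemma exists_rho_mul_eq (hq : 0 < q) (hqr : q < r) :
    ∃ s : ℝ, 0 < s ∧ q * s * s = r ∧ rho q r * (q + r) = 2 * (q * s) := by
  have h0 : (0 : ℝ) < q := by exact_mod_cast hq
  have h1 : (0 : ℝ) < r := by exact_mod_cast hq.trans hqr
  have h2 : √((q : ℝ) * r) * √((q : ℝ) * r) = q * r := Real.mul_self_sqrt (by positivity)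
  refine ⟨√((q : ℝ) * r) / q, by positivity, ?_, ?_⟩
  · field_simp
    linear_combination h2
  · rw [rho]
    field_simp

/-- As a function of `E = e^{2a}` the right side equals `1` at `E = r/q`; both the bound and the
limit of the large eigenvalues are read off from this form. -/
lemma rho_mul_cosh_sq (hq : 0 < q) (hqr : q < r) (a : ℝ) :
    (rho q r * Real.cosh a) ^ 2 =
      q * r * (Real.exp (2 * a) + 2 + (Real.exp (2 * a))⁻¹) / ((q : ℝ) + r) ^ 2 := by
  have h0 : (0 : ℝ) < q := by exact_mod_cast hq
  have h1 : (0 : ℝ) < r := by exact_mod_cast hq.trans hqr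
  have h2 : √((q : ℝ) * r) ^ 2 = q * r := Real.sq_sqrt (by positivity)
  have hu2 : Real.exp (2 * a) = Real.exp a * Real.exp a := by rw [← Real.exp_add]; ring_nf
  rw [rho, Real.cosh_eq, hu2, Real.exp_neg, mul_pow, div_pow, mul_pow, h2]
  have := Real.exp_pos a
  field_simp
  ring

/-- The defining equation solved for `r - q E` with `E = e^{2α}`. The right side is positive because
`E > 1`, so `E < r/q`, with a gap governed by the factor `e^{-2Nα}`. -/
lemma IsAngleFamily.exp_lt (hα : IsAngleFamily q r α) (hqr : q < r) {N : ℕ}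
    (h : threshold q r < N) :
    0 < r - q * Real.exp (2 * α 0 N) ∧ r - q * Real.exp (2 * α 0 N) =
      (r * Real.exp (2 * α 0 N) - q) * Real.exp (-(2 * N * α 0 N)) := by
  have hq0 : (0 : ℝ) ≤ q := Nat.cast_nonneg q
  have hqr' : (q : ℝ) < r := by exact_mod_cast hqr
  have hmem : α 0 N ∈ expRoots q r N := by rw [hα.exp_root N h]; rfl
  obtain ⟨h1, h2, h3⟩ := hmem
  rw [eq_div_iff h2] at h3
  have h4 : 1 < Real.exp (2 * α 0 N) := Real.one_lt_exp_iff.2 (by linarith)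
  have h5 : Real.exp (2 * N * α 0 N) * Real.exp (-(2 * N * α 0 N)) = 1 := by
    rw [← Real.exp_add]; simp
  have h6 : r - q * Real.exp (2 * α 0 N) =
      (r * Real.exp (2 * α 0 N) - q) * Real.exp (-(2 * N * α 0 N)) := by
    linear_combination (-Real.exp (-(2 * N * α 0 N))) * h3 -
      (r - q * Real.exp (2 * α 0 N)) * h5
  refine ⟨?_, h6⟩
  rw [h6]
  exact mul_pos (by nlinarith) (Real.exp_pos _)

lemma IsAngleFamily.rho_lt_bigEig (hα : IsAngleFamily q r α) (hq : 0 < q) (hqr : q < r) {N : ℕ}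
    (h : threshold q r < N) : rho q r < bigEig q r α N := by
  have := Real.one_lt_cosh.2 (hα.pos_and_eval_eq_zero hqr h).1.ne'
  rw [bigEig]
  nlinarith [rho_pos hq hqr]

lemma IsAngleFamily.bigEig_lt_one (hα : IsAngleFamily q r α) (hq : 0 < q) (hqr : q < r) {N : ℕ}
    (h : threshold q r < N) : bigEig q r α N < 1 := by
  have h0 : (0 : ℝ) < q := by exact_mod_cast hq
  have hqr' : (q : ℝ) < r := by exact_mod_cast hqr
  have ha := (hα.pos_and_eval_eq_zero hqr h).1
  have h1 := (hα.exp_lt hqr h).1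
  have h2 : 1 < Real.exp (2 * α 0 N) := Real.one_lt_exp_iff.2 (by linarith)
  have h3 := rho_mul_cosh_sq hq hqr (α 0 N)
  rw [← bigEig] at h3
  set E := Real.exp (2 * α 0 N)
  have hE : 0 < E := by linarith
  have h4 : q * r * (E + 2 + E⁻¹) / ((q : ℝ) + r) ^ 2 < 1 := by
    rw [div_lt_one (by positivity)]
    have h5 : E * E⁻¹ = 1 := mul_inv_cancel₀ hE.ne'
    -- This product is `(q + r)² (1 - λ²)` for the eigenvalue `λ` in question.
    have h6 : 0 < (r - q * E) * (r * E - q) * E⁻¹ :=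
      mul_pos (mul_pos h1 (by nlinarith)) (inv_pos.2 hE)
    have h7 : (r - q * E) * (r * E - q) * E⁻¹ = r ^ 2 + q ^ 2 - q * r * (E + E⁻¹) := by
      linear_combination ((r : ℝ) ^ 2 + q ^ 2 - q * r * E) * h5
    rw [h7] at h6
    linarith
  rw [← h3] at h4
  exact (sq_lt_one_iff₀ ((rho_pos hq hqr).le.trans (hα.rho_lt_bigEig hq hqr h).le)).1 h4

lemma IsAngleFamily.bigEigSet_subset (hα : IsAngleFamily q r α) (hq : 0 < q) (hqr : q < r) :
    bigEigSet q r α ⊆ Ioo (-1) (-rho q r) ∪ Ioo (rho q r) 1 := by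
  rintro t ⟨N, hN, rfl | rfl⟩
  · exact Or.inr ⟨hα.rho_lt_bigEig hq hqr hN, hα.bigEig_lt_one hq hqr hN⟩
  · exact Or.inl ⟨neg_lt_neg (hα.bigEig_lt_one hq hqr hN),
      neg_lt_neg (hα.rho_lt_bigEig hq hqr hN)⟩

lemma IsAngleFamily.strictMonoOn_bigEig (hα : IsAngleFamily q r α) (hq : 0 < q) (hqr : q < r) :
    StrictMonoOn (bigEig q r α) {N : ℕ | threshold q r < (N : ℝ)} := by
  have hstep : ∀ N : ℕ, threshold q r < N → bigEig q r α N < bigEig q r α (N + 1) := fun N hN =>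
    mul_lt_mul_of_pos_left (hα.cosh_lt_cosh_succ hq hqr hN) (rho_pos hq hqr)
  intro M hM N _ hMN
  induction N, (show M + 1 ≤ N from hMN) using Nat.le_induction with
  | base => exact hstep M hM
  | succ N hN ih =>
    have hN' : threshold q r < N := lt_of_lt_of_le hM (by exact_mod_cast (by omega : M ≤ N))
    exact (ih hN' (by omega)).trans (hstep N hN')

lemma IsAngleFamily.tendsto_bigEig (hα : IsAngleFamily q r α) (hq : 0 < q) (hqr : q < r) :
    Tendsto (bigEig q r α) atTop (𝓝 1) := by
  have h0 : (0 : ℝ) < q := by exact_mod_cast hq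
  have hr0 : (0 : ℝ) < r := by exact_mod_cast hq.trans hqr
  obtain ⟨M, hM⟩ := exists_nat_gt (threshold q r)
  have hge : ∀ N ≥ M, threshold q r < N := fun N hN =>
    lt_of_lt_of_le hM (by exact_mod_cast hN)
  have hpos : ∀ N ≥ M, 0 < α 0 N := fun N hN => (hα.pos_and_eval_eq_zero hqr (hge N hN)).1
  have hmono : ∀ N ≥ M, α 0 M ≤ α 0 N := by
    intro N hN
    have h1 := (hα.strictMonoOn_bigEig hq hqr).monotoneOn hM (hge N hN) hN
    have h2 : Real.cosh (α 0 M) ≤ Real.cosh (α 0 N) := le_of_mul_le_mul_left h1 (rho_pos hq hqr)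
    rwa [Real.cosh_le_cosh, abs_of_pos (hpos M le_rfl), abs_of_pos (hpos N hN)] at h2
  -- Majorant for the gap `r - q E`: the constant comes from `r E - q ≤ r (r/q)`, the ratio from
  -- monotonicity, `α_{0,N} ≥ α_{0,M} > 0`.
  have hexp : Tendsto (fun N : ℕ => (r : ℝ) * (r / q) * Real.exp (-(2 * α 0 M)) ^ N) atTop
      (𝓝 0) := by
    have := tendsto_pow_atTop_nhds_zero_of_lt_one (Real.exp_pos (-(2 * α 0 M))).le
      (Real.exp_lt_one_iff.2 (by linarith [hpos M le_rfl]))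
    simpa using this.const_mul ((r : ℝ) * (r / q))
  have hdiff : Tendsto (fun N : ℕ => (r : ℝ) - q * Real.exp (2 * α 0 N)) atTop (𝓝 0) := by
    refine squeeze_zero' ?_ ?_ hexp
    · filter_upwards [eventually_ge_atTop M] with N hN
      exact (hα.exp_lt hqr (hge N hN)).1.le
    · filter_upwards [eventually_ge_atTop M] with N hN
      obtain ⟨h1, h2⟩ := hα.exp_lt hqr (hge N hN)
      rw [h2, ← Real.exp_nat_mul]
      have h3 : Real.exp (2 * α 0 N) ≤ r / q := by
        rw [le_div_iff₀ h0]
        linarith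
      refine mul_le_mul ?_ ?_ (Real.exp_pos _).le (by positivity)
      · have := mul_le_mul_of_nonneg_left h3 hr0.le
        linarith
      · rw [Real.exp_le_exp]
        have := mul_le_mul_of_nonneg_left (hmono N hN) (Nat.cast_nonneg (α := ℝ) N)
        linarith
  have hE : Tendsto (fun N : ℕ => Real.exp (2 * α 0 N)) atTop (𝓝 (r / q)) := by
    have h1 := (tendsto_const_nhds (x := (r : ℝ))).sub hdiff |>.div_const (q : ℝ)
    rw [sub_zero] at h1
    refine h1.congr fun N => ?_
    field_simp
    ring
  have hsq : Tendsto (fun N => √(bigEig q r α N ^ 2)) atTop (𝓝 √1) := by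
    refine (Real.continuous_sqrt.tendsto _).comp ?_
    have h1 : Tendsto (fun N : ℕ => q * r * (Real.exp (2 * α 0 N) + 2 +
        (Real.exp (2 * α 0 N))⁻¹) / ((q : ℝ) + r) ^ 2) atTop
        (𝓝 (q * r * (r / q + 2 + (r / q : ℝ)⁻¹) / ((q : ℝ) + r) ^ 2)) :=
      (((hE.add_const 2).add (hE.inv₀ (by positivity))).const_mul _).div_const _
    have h2 : q * r * (r / q + 2 + (r / q : ℝ)⁻¹) / ((q : ℝ) + r) ^ 2 = 1 := by
      field_simp
      ring
    rw [h2] at h1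
    exact h1.congr fun N => (rho_mul_cosh_sq hq hqr _).symm
  rw [Real.sqrt_one] at hsq
  refine hsq.congr fun N => ?_
  rw [Real.sqrt_sq]
  exact mul_nonneg (rho_pos hq hqr).le (Real.cosh_pos _).le

end BigEig

/-! ## Return probabilities of the Diestel–Leader graph -/

section Return

variable {q r : ℕ}

lemma srwOp_dlGraph_apply (f : DL q r → ℝ) (x : DL q r) :
    srwOp (dlGraph q r) f x =
      ((q : ℝ) + r)⁻¹ * (∑ a, f (x.up a) + ∑ b, f (x.down b)) := by
  change ((dlGraph q r).degree x : ℝ)⁻¹ * ∑ y ∈ (dlGraph q r).neighborFinset x, f y = _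
  rw [degree_dlGraph, sum_neighborFinset_dlGraph]

/-- The function `s^hor` is positive and is multiplied by `ρ` under the walk, because `q s + r s⁻¹ =
ρ (q + r)`. Normalized to be `1` at `x`, it dominates the point mass at `x`, and positivity
preserves this under iteration. -/
lemma stepProb_dlGraph_le (hq : 0 < q) (hqr : q < r) (N : ℕ) (x : DL q r) :
    stepProb (dlGraph q r) N x x ≤ rho q r ^ N := by
  classical
  obtain ⟨s, hs, hs1, hs2⟩ := exists_rho_mul_eq hq hqr
  have h0 : (0 : ℝ) < q := by exact_mod_cast hq
  have hr0 : (0 : ℝ) < r := by exact_mod_cast hq.trans hqr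
  have key : ∀ y : DL q r, ((srwOp (dlGraph q r)) ^ N) (Pi.single x 1) y ≤
      rho q r ^ N * s ^ (y.1.1.hor - x.1.1.hor) := by
    induction N with
    | zero =>
      intro y
      by_cases h : y = x
      · subst h
        simp
      · have h1 : 0 < s ^ (y.1.1.hor - x.1.1.hor) := zpow_pos hs _
        simpa [h] using h1.le
    | succ N ih =>
      intro y
      rw [pow_succ', Module.End.mul_apply, srwOp_dlGraph_apply]
      have h1 : ∑ a, ((srwOp (dlGraph q r)) ^ N) (Pi.single x 1) (y.up a) ≤
          ∑ _a : Fin q, rho q r ^ N * s ^ (y.1.1.hor + 1 - x.1.1.hor) :=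
        Finset.sum_le_sum fun a _ => ih (y.up a)
      have h2 : ∑ b, ((srwOp (dlGraph q r)) ^ N) (Pi.single x 1) (y.down b) ≤
          ∑ _b : Fin r, rho q r ^ N * s ^ (y.1.1.hor - 1 - x.1.1.hor) :=
        Finset.sum_le_sum fun b _ => ih (y.down b)
      rw [Finset.sum_const, Finset.card_univ, Fintype.card_fin, nsmul_eq_mul] at h1 h2
      refine (mul_le_mul_of_nonneg_left (add_le_add h1 h2) (by positivity)).trans (le_of_eq ?_)
      rw [show y.1.1.hor + 1 - x.1.1.hor = y.1.1.hor - x.1.1.hor + 1 by ring,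
        show y.1.1.hor - 1 - x.1.1.hor = y.1.1.hor - x.1.1.hor - 1 by ring,
        zpow_add_one₀ hs.ne', zpow_sub_one₀ hs.ne', inv_mul_eq_iff_eq_mul₀ (by positivity),
        pow_succ]
      have h3 : (r : ℝ) * s⁻¹ = q * s := by
        rw [← hs1]
        field_simp
      linear_combination (rho q r ^ N * s ^ (y.1.1.hor - x.1.1.hor)) * h3 -
        (rho q r ^ N * s ^ (y.1.1.hor - x.1.1.hor)) * hs2
  have := key x
  rw [sub_self, zpow_zero, mul_one] at this
  rw [stepProb]
  convert this

/-- A measure with an atom beyond `ρ` is not a spectral measure of the Diestel–Leader graph. -/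
lemma not_isSpectralMeasureAt_dlGraph (hq : 0 < q) (hqr : q < r) {κ : Measure ℝ} {t₀ : ℝ}
    (ht₀ : rho q r < t₀) (hκ : κ {t₀} ≠ 0) (x : DL q r) :
    ¬ IsSpectralMeasureAt (dlGraph q r) x κ := by
  rintro ⟨hprob, hsupp, hmom⟩
  have hρ := rho_pos hq hqr
  have hint : ∀ n : ℕ, Integrable (fun t : ℝ => t ^ (2 * n)) κ := by
    intro n
    refine Integrable.of_bound (by fun_prop) 1 ?_
    have h1 : ∀ᵐ t ∂κ, t ∈ Icc (-1 : ℝ) 1 := hsupp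
    filter_upwards [h1] with t ht
    rw [norm_pow, Real.norm_eq_abs]
    exact pow_le_one₀ (abs_nonneg _) (abs_le.2 ht)
  -- Even moments are bounded below by the contribution of the atom and above by the return
  -- probability; as `t₀ > ρ` this fails for large `n`.
  have hle : ∀ n : ℕ, κ.real {t₀} * (t₀ ^ 2) ^ n ≤ (rho q r ^ 2) ^ n := by
    intro n
    rw [← pow_mul, ← pow_mul]
    calc κ.real {t₀} * t₀ ^ (2 * n) = ∫ t in {t₀}, t ^ (2 * n) ∂κ := by
          rw [integral_singleton]
          simp
      _ ≤ ∫ t, t ^ (2 * n) ∂κ := setIntegral_le_integral (hint n)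
          (Eventually.of_forall fun t => by
            change 0 ≤ t ^ (2 * n)
            rw [pow_mul]
            positivity)
      _ = stepProb (dlGraph q r) (2 * n) x x := hmom _
      _ ≤ _ := stepProb_dlGraph_le hq hqr _ x
  have hκ' : 0 < κ.real {t₀} := ENNReal.toReal_pos hκ (measure_ne_top _ _)
  have ht0 : 0 < t₀ := hρ.trans ht₀
  have hlt : rho q r ^ 2 / t₀ ^ 2 < 1 := by
    rw [div_lt_one (by positivity)]
    exact pow_lt_pow_left₀ ht₀ hρ.le (by norm_num)
  obtain ⟨n, hn⟩ := exists_pow_lt_of_lt_one hκ' hlt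
  rw [div_pow, div_lt_iff₀ (by positivity)] at hn
  exact absurd (hle n) (not_le.2 hn)

end Return

/-! ## The limit measure as a sum over levels -/

/-- The weight `(q - 1) (r - 1) r^{-N}`. -/
def innerWeight (q r N : ℕ) : ℝ := ((q : ℝ) - 1) * ((r : ℝ) - 1) / (r : ℝ) ^ N

/-- The weight `(r - q) (r - 1) r^{-N-1}`. -/
def boundaryWeight (q r N : ℕ) : ℝ := ((r : ℝ) - q) * ((r : ℝ) - 1) / (r : ℝ) ^ (N + 1)

/-- The part of the limit measure that comes from paths of a given length. -/
def levelMeasure (q r N : ℕ) : Measure ℝ :=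
  ENNReal.ofReal (innerWeight q r N) •
      ∑ m ∈ Finset.Icc 1 (N - 1), Measure.dirac (eig q r m N) +
    ENNReal.ofReal (boundaryWeight q r N) •
      ∑ x ∈ boundaryRoots (ratio q r) N, Measure.dirac (rho q r * x)

lemma sum_measure_subtype {ι X : Type*} [MeasurableSpace X] (p : ι → Prop) [DecidablePred p]
    (μ : ι → Measure X) :
    Measure.sum (fun i : {i // p i} => μ i) = Measure.sum fun i => if p i then μ i else 0 := by
  ext s hs
  rw [Measure.sum_apply _ hs, Measure.sum_apply _ hs]
  refine (tsum_subtype {i | p i} fun i => μ i s).trans (tsum_congr fun i => ?_)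
  by_cases h : p i
  · simp [h]
  · simp [h]

lemma sum_measure_add {ι X : Type*} [MeasurableSpace X] (μ ν : ι → Measure X) :
    Measure.sum μ + Measure.sum ν = Measure.sum fun i => μ i + ν i := by
  ext s hs
  simp [Measure.sum_apply _ hs, ENNReal.tsum_add]

section LimitMeasure

variable {q r : ℕ} {α : ℕ → ℕ → ℝ}

lemma innerWeight_pos (hq : 2 ≤ q) (hqr : q < r) (N : ℕ) : 0 < innerWeight q r N := by
  have h0 : (2 : ℝ) ≤ q := by exact_mod_cast hq
  have h1 : (q : ℝ) < r := by exact_mod_cast hqr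
  rw [innerWeight]
  have h2 : (0 : ℝ) < q - 1 := by linarith
  have h3 : (0 : ℝ) < r - 1 := by linarith
  have h4 : (0 : ℝ) < r := by linarith
  positivity

lemma boundaryWeight_pos (hq : 2 ≤ q) (hqr : q < r) (N : ℕ) : 0 < boundaryWeight q r N := by
  have h0 : (2 : ℝ) ≤ q := by exact_mod_cast hq
  have h1 : (q : ℝ) < r := by exact_mod_cast hqr
  rw [boundaryWeight]
  have h2 : (0 : ℝ) < r - q := by linarith
  have h3 : (0 : ℝ) < r - 1 := by linarith
  have h4 : (0 : ℝ) < r := by linarith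
  positivity

/-- For each `N` the angles enumerate all zeros of `T_N - c X U_{N-1}`; the division into the two
measures only separates zeros inside and outside `[-1, 1]`. Merged, the sum no longer depends on the
enumeration. -/
lemma IsAngleFamily.muTilde_add_nuTilde (hα : IsAngleFamily q r α) (hq : 0 < q) (hqr : q < r) :
    muTilde q r α + nuTilde q r α = Measure.sum (levelMeasure q r) := by
  classical
  rw [muTilde, nuTilde,
    sum_measure_subtype (fun N : ℕ => 2 ≤ N) fun N : ℕ =>
      ENNReal.ofReal (((q : ℝ) - 1) * ((r : ℝ) - 1) / (r : ℝ) ^ (N : ℕ)) •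
        ∑ m ∈ Finset.Icc 1 ((N : ℕ) - 1), Measure.dirac (eig q r m N),
    sum_measure_subtype (fun N : ℕ => 1 ≤ N ∧ (N : ℝ) ≤ threshold q r) fun N : ℕ =>
      ENNReal.ofReal (((r : ℝ) - q) * ((r : ℝ) - 1) / (r : ℝ) ^ ((N : ℕ) + 1)) •
        ∑ m ∈ Finset.Ico 0 (N : ℕ), Measure.dirac (rho q r * Real.cos (α m N)),
    sum_measure_subtype (fun N : ℕ => threshold q r < (N : ℝ)) fun N : ℕ =>
      ENNReal.ofReal (((r : ℝ) - q) * ((r : ℝ) - 1) / (r : ℝ) ^ ((N : ℕ) + 1)) •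
        ∑ m ∈ Finset.Icc 1 ((N : ℕ) - 2), Measure.dirac (rho q r * Real.cos (α m N)),
    sum_measure_subtype (fun N : ℕ => threshold q r < (N : ℝ)) fun N : ℕ =>
      ENNReal.ofReal (((r : ℝ) - q) * ((r : ℝ) - 1) / (r : ℝ) ^ ((N : ℕ) + 1)) •
        (Measure.dirac (bigEig q r α N) + Measure.dirac (-bigEig q r α N)),
    sum_measure_add, sum_measure_add, sum_measure_add]
  congr 1
  funext N
  rw [levelMeasure, innerWeight, boundaryWeight, add_assoc, add_assoc]
  congr 1
  · split_ifs with h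
    · rfl
    · rw [Finset.Icc_eq_empty (by omega)]
      simp
  · rcases lt_or_ge (threshold q r) (N : ℝ) with h | h
    · rw [if_neg (fun h' => h.not_ge h'.2), if_pos h, if_pos h, zero_add, ← smul_add,
        ← hα.sum_of_lt hq hqr h fun x => (Measure.dirac (rho q r * x) : Measure ℝ), bigEig,
        mul_neg]
    · rw [if_neg h.not_gt, if_neg h.not_gt, add_zero, add_zero]
      by_cases h1 : 1 ≤ N
      · rw [if_pos ⟨h1, h⟩,
          hα.sum_of_le hq hqr h1 h fun x => (Measure.dirac (rho q r * x) : Measure ℝ)]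
      · obtain rfl : N = 0 := by omega
        simp [boundaryRoots_zero]

lemma integral_levelMeasure (hq : 2 ≤ q) (hqr : q < r) (N : ℕ) (f : ℝ → ℝ) :
    ∫ t, f t ∂(levelMeasure q r N) =
      innerWeight q r N * ∑ m ∈ Finset.Icc 1 (N - 1), f (eig q r m N) +
        boundaryWeight q r N * ∑ x ∈ boundaryRoots (ratio q r) N, f (rho q r * x) := by
  have hi : ∀ {ι : Type} (s : Finset ι) (x : ι → ℝ),
      Integrable f (∑ i ∈ s, Measure.dirac (x i)) := fun s x =>
    integrable_finsetSum_measure.2 fun i _ => integrable_dirac (by simp)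
  rw [levelMeasure, integral_add_measure ((hi _ _).smul_measure (by simp))
    ((hi _ _).smul_measure (by simp)), integral_smul_measure, integral_smul_measure,
    integral_finsetSum_measure fun i _ => integrable_dirac (by simp),
    integral_finsetSum_measure fun i _ => integrable_dirac (by simp),
    ENNReal.toReal_ofReal (innerWeight_pos hq hqr N).le,
    ENNReal.toReal_ofReal (boundaryWeight_pos hq hqr N).le]
  simp

/-- Both series `∑ (N-1) r^{-N}` and `∑ N r^{-N-1}` equal `(r-1)^{-2}`, so the masses are
`(q-1)/(r-1)` and `(r-q)/(r-1)`. -/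
lemma hasSum_levelMass (hq : 2 ≤ q) (hqr : q < r) :
    HasSum (fun N : ℕ => innerWeight q r N * ((N - 1 : ℕ) : ℝ) + boundaryWeight q r N * N) 1 := by
  have h0 : (2 : ℝ) ≤ q := by exact_mod_cast hq
  have h1 : (q : ℝ) < r := by exact_mod_cast hqr
  have hr0 : (0 : ℝ) < r := by linarith
  have hr1 : (r : ℝ) - 1 ≠ 0 := by linarith
  have hlt : ‖(r : ℝ)⁻¹‖ < 1 := by
    rw [Real.norm_of_nonneg (by positivity)]
    exact inv_lt_one_of_one_lt₀ (by linarith)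
  have hg := hasSum_coe_mul_geometric_of_norm_lt_one hlt
  have e : (1 - (r : ℝ)⁻¹) = (r - 1) / r := by field_simp
  rw [e] at hg
  have hg1 : HasSum (fun N : ℕ => ((N - 1 : ℕ) : ℝ) * (r : ℝ)⁻¹ ^ N)
      ((r : ℝ)⁻¹ * ((r : ℝ)⁻¹ / (((r : ℝ) - 1) / r) ^ 2)) := by
    rw [← hasSum_nat_add_iff' 1]
    have := hg.mul_left (r : ℝ)⁻¹
    simp only [Finset.range_one, Finset.sum_singleton, zero_tsub, Nat.cast_zero, zero_mul,
      sub_zero, Nat.add_sub_cancel]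
    refine this.congr_fun fun n => ?_
    rw [pow_succ]
    ring
  have hg2 := (hg1.mul_left (((q : ℝ) - 1) * (r - 1))).add
    (hg.mul_left (((r : ℝ) - q) * (r - 1) * (r : ℝ)⁻¹))
  have hval : ((q : ℝ) - 1) * (r - 1) * ((r : ℝ)⁻¹ * ((r : ℝ)⁻¹ / (((r : ℝ) - 1) / r) ^ 2)) +
      ((r : ℝ) - q) * (r - 1) * (r : ℝ)⁻¹ * ((r : ℝ)⁻¹ / (((r : ℝ) - 1) / r) ^ 2) = 1 := by
    field_simp
    ring
  rw [hval] at hg2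
  refine hg2.congr_fun fun N => ?_
  rw [innerWeight, boundaryWeight, inv_pow, pow_succ]
  field_simp

lemma isProbabilityMeasure_sum_levelMeasure (hq : 2 ≤ q) (hqr : q < r) :
    IsProbabilityMeasure (Measure.sum (levelMeasure q r)) := by
  refine ⟨?_⟩
  have hq0 : 0 < q := by omega
  have hmass : ∀ N, levelMeasure q r N univ = ENNReal.ofReal
      (innerWeight q r N * ((N - 1 : ℕ) : ℝ) + boundaryWeight q r N * N) := by
    intro N
    have h1 := (innerWeight_pos hq hqr N).le
    have h2 := (boundaryWeight_pos hq hqr N).le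
    rw [ENNReal.ofReal_add (by positivity) (by positivity), ENNReal.ofReal_mul h1,
      ENNReal.ofReal_mul h2, ENNReal.ofReal_natCast, ENNReal.ofReal_natCast]
    simp [levelMeasure, card_boundaryRoots (ratio_pos hqr) (ratio_lt_one hq0 hqr)]
  have hs := hasSum_levelMass hq hqr
  rw [Measure.sum_apply _ MeasurableSet.univ, tsum_congr hmass,
    ← ENNReal.ofReal_tsum_of_nonneg ?_ hs.summable, hs.tsum_eq, ENNReal.ofReal_one]
  intro N
  have h1 := (innerWeight_pos hq hqr N).le
  have h2 := (boundaryWeight_pos hq hqr N).le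
  positivity

/-! ## Supports -/

lemma muTilde_apply_eq_zero (hq : 0 < q) (hqr : q < r) {s : Set ℝ} (hs : MeasurableSet s)
    (h : Disjoint s (Icc (-rho q r) (rho q r))) : muTilde q r α s = 0 := by
  have hcos : ∀ a, rho q r * Real.cos a ∉ s := by
    intro a ha
    refine Set.disjoint_left.1 h ha ⟨?_, ?_⟩
    · nlinarith [Real.neg_one_le_cos a, rho_pos hq hqr]
    · nlinarith [Real.cos_le_one a, rho_pos hq hqr]
  simp only [muTilde, Measure.add_apply, Measure.sum_apply _ hs, Measure.smul_apply,
    Measure.finsetSum_apply, Measure.dirac_apply' _ hs, eig, Set.indicator_of_notMem (hcos _)]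
  simp

/-- The atoms `λ_{m,N}` suffice: every rational in `(0,1)` is some `m/N` with `N ≥ 2`, these are
dense, and `b ↦ ρ cos(bπ)` maps `[0,1]` continuously onto `[-ρ, ρ]`. -/
lemma muTilde_support (hq : 2 ≤ q) (hqr : q < r) :
    (muTilde q r α).support = Icc (-rho q r) (rho q r) := by
  have hq0 : 0 < q := by omega
  have hρ := rho_pos hq0 hqr
  refine Subset.antisymm (Measure.support_subset_of_isClosed isClosed_Icc ?_) fun t ht => ?_
  · exact muTilde_apply_eq_zero hq0 hqr isClosed_Icc.measurableSet.compl disjoint_compl_left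
  · rw [Measure.mem_support_iff_forall]
    intro U hU
    obtain ⟨O, hOU, hO, htO⟩ := mem_nhds_iff.1 hU
    obtain ⟨b, hb, hb'⟩ : ∃ b ∈ Icc (0 : ℝ) 1, rho q r * Real.cos (b * Real.pi) = t := by
      refine ⟨Real.arccos (t / rho q r) / Real.pi, ⟨?_, ?_⟩, ?_⟩
      · exact div_nonneg (Real.arccos_nonneg _) Real.pi_pos.le
      · rw [div_le_one Real.pi_pos]
        exact Real.arccos_le_pi _
      · rw [div_mul_cancel₀ _ Real.pi_pos.ne', Real.cos_arccos, mul_div_cancel₀ _ hρ.ne']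
        · rw [le_div_iff₀ hρ]
          linarith [ht.1]
        · rw [div_le_one hρ]
          exact ht.2
    have hcont : Continuous fun b : ℝ => rho q r * Real.cos (b * Real.pi) := by fun_prop
    have hW : IsOpen ((fun b : ℝ => rho q r * Real.cos (b * Real.pi)) ⁻¹' O) := hO.preimage hcont
    -- The endpoints `b = 0, 1` are not of the form `m/N` with `1 ≤ m ≤ N - 1`; passing to the
    -- closure covers them.
    have hbW : b ∈ closure (Ioo (0 : ℝ) 1) := by rwa [closure_Ioo (by norm_num)]
    have hne := mem_closure_iff.1 hbW _ hW (by rw [mem_preimage, hb']; exact htO)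
    obtain ⟨x, hx, y, rfl⟩ := Rat.isDenseEmbedding_coe_real.dense.inter_open_nonempty _
      (hW.inter isOpen_Ioo) hne
    obtain ⟨hy1, hy2, hy3⟩ := hx
    have hy2' : 0 < y := by exact_mod_cast hy2
    have hy3' : y < 1 := by exact_mod_cast hy3
    have hnum : 0 < y.num := Rat.num_pos.2 hy2'
    have hnd : y.num < y.den := Rat.num_lt_denom_iff.2 hy3'
    have hN : 2 ≤ y.den := by omega
    have hcast : (((y.num.toNat : ℕ) : ℝ) / (y.den : ℝ)) = y := by
      rw [Rat.cast_def]
      congr 1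
      exact_mod_cast Int.toNat_of_nonneg hnum.le
    have heig : eig q r y.num.toNat y.den ∈ O := by
      rw [eig, hcast]
      exact hy1
    have hmem : y.num.toNat ∈ Finset.Icc 1 (y.den - 1) := by
      rw [Finset.mem_Icc]
      omega
    refine lt_of_lt_of_le ?_ (measure_mono hOU)
    rw [muTilde, Measure.add_apply, Measure.add_apply]
    refine lt_of_lt_of_le ?_ (le_self_add.trans le_self_add)
    refine lt_of_lt_of_le ?_ (Measure.le_sum _ (⟨y.den, hN⟩ : {N : ℕ // 2 ≤ N}) O)
    rw [Measure.smul_apply, smul_eq_mul]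
    refine ENNReal.mul_pos (ENNReal.ofReal_pos.2 (innerWeight_pos hq hqr _)).ne' ?_
    rw [Measure.finsetSum_apply]
    refine (lt_of_lt_of_le ?_ (Finset.single_le_sum (fun _ _ => zero_le) hmem)).ne'
    rw [Measure.dirac_apply' _ hO.measurableSet, Set.indicator_of_mem heig]
    simp

/-- All weights are strictly positive, so null sets are those that miss every atom. The carrier, the
atoms and the support all follow from this. -/
lemma nuTilde_apply_eq_zero_iff (hq : 2 ≤ q) (hqr : q < r) {s : Set ℝ} (hs : MeasurableSet s) :
    nuTilde q r α s = 0 ↔ ∀ t ∈ bigEigSet q r α, t ∉ s := by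
  rw [nuTilde, Measure.sum_apply _ hs, ENNReal.tsum_eq_zero]
  have key : ∀ N : {N : ℕ // threshold q r < (N : ℝ)},
      (ENNReal.ofReal (((r : ℝ) - q) * ((r : ℝ) - 1) / (r : ℝ) ^ ((N : ℕ) + 1)) •
        (Measure.dirac (bigEig q r α N) + Measure.dirac (-bigEig q r α N))) s = 0 ↔
      bigEig q r α N ∉ s ∧ -bigEig q r α N ∉ s := by
    intro N
    have h1 : ENNReal.ofReal (((r : ℝ) - q) * ((r : ℝ) - 1) / (r : ℝ) ^ ((N : ℕ) + 1)) ≠ 0 :=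
      (ENNReal.ofReal_pos.2 (boundaryWeight_pos hq hqr _)).ne'
    rw [Measure.smul_apply, smul_eq_mul, mul_eq_zero, or_iff_right h1, Measure.add_apply,
      add_eq_zero, Measure.dirac_apply' _ hs, Measure.dirac_apply' _ hs]
    simp [Set.indicator_apply_eq_zero]
  simp only [key]
  constructor
  · rintro h t ⟨N, hN, rfl | rfl⟩
    · exact (h ⟨N, hN⟩).1
    · exact (h ⟨N, hN⟩).2
  · exact fun h N => ⟨h _ ⟨N, N.2, Or.inl rfl⟩, h _ ⟨N, N.2, Or.inr rfl⟩⟩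

lemma measurableSet_bigEigSet : MeasurableSet (bigEigSet q r α) := by
  refine Set.Countable.measurableSet (((countable_range (bigEig q r α)).union
    (countable_range fun N => -bigEig q r α N)).mono ?_)
  rintro t ⟨N, -, rfl | rfl⟩
  · exact Or.inl ⟨N, rfl⟩
  · exact Or.inr ⟨N, rfl⟩

lemma nuTilde_compl_bigEigSet (hq : 2 ≤ q) (hqr : q < r) :
    nuTilde q r α (bigEigSet q r α)ᶜ = 0 :=
  (nuTilde_apply_eq_zero_iff hq hqr measurableSet_bigEigSet.compl).2 fun _ ht h => h ht

lemma nuTilde_singleton_ne_zero_iff (hq : 2 ≤ q) (hqr : q < r) (t : ℝ) :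
    nuTilde q r α {t} ≠ 0 ↔ t ∈ bigEigSet q r α := by
  rw [ne_eq, nuTilde_apply_eq_zero_iff hq hqr (measurableSet_singleton t)]
  simp

lemma IsAngleFamily.nuTilde_support_subset (hα : IsAngleFamily q r α) (hq : 2 ≤ q)
    (hqr : q < r) :
    (nuTilde q r α).support ⊆ Icc (-1) (-rho q r) ∪ Icc (rho q r) 1 := by
  have hcl : IsClosed (Icc (-1) (-rho q r) ∪ Icc (rho q r) 1) := isClosed_Icc.union isClosed_Icc
  refine Measure.support_subset_of_isClosed hcl ?_
  refine (nuTilde_apply_eq_zero_iff hq hqr hcl.measurableSet.compl).2 fun t ht h => h ?_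
  exact union_subset_union Ioo_subset_Icc_self Ioo_subset_Icc_self
    (hα.bigEigSet_subset (by omega) hqr ht)

end LimitMeasure

/-! ## The family of eigenvalues of a tetrahedron -/

/-- The eigenvalues of a path with `L` vertices: if `j = 0`, the path starts at the lower end of the
tetrahedron, with reflection; otherwise both ends are absorbing. -/
def pathSpectrum (q r j L : ℕ) : Finset ℝ :=
  if j = 0 then (boundaryRoots (ratio q r) L).image fun x => rho q r * x
  else (Finset.Icc 1 L).image fun m => eig q r m (L + 1)

/-- The pairs of cores `(w, v)` below `(a₁, a₂)` with `v ≠ a₂`, sorted by their generations. -/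
def corePairs {q r : ℕ} (a₁ : Tree q) (a₂ : Tree r) (n : ℕ) :
    Finset (Σ _ : (Σ _ : ℕ, ℕ × ℕ), Tree q × Tree r) :=
  ((Finset.range n).sigma fun k => Finset.HasAntidiagonal.antidiagonal k).sigma fun p =>
    a₁.cores p.2.1 ×ˢ a₂.cores (p.2.2 + 1)

section Spectrum

variable {q r : ℕ}

lemma sum_pathSpectrum_zero (hq : 0 < q) (hqr : q < r) (L : ℕ) (f : ℝ → ℝ) :
    ∑ l ∈ pathSpectrum q r 0 L, f l = ∑ x ∈ boundaryRoots (ratio q r) L, f (rho q r * x) := by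
  rw [pathSpectrum, if_pos rfl, Finset.sum_image]
  exact fun x _ y _ h => mul_left_cancel₀ (rho_pos hq hqr).ne' h

lemma sum_pathSpectrum_of_ne_zero (hq : 0 < q) (hqr : q < r) {j : ℕ} (hj : j ≠ 0) (L : ℕ)
    (f : ℝ → ℝ) :
    ∑ l ∈ pathSpectrum q r j L, f l = ∑ m ∈ Finset.Icc 1 L, f (eig q r m (L + 1)) := by
  rw [pathSpectrum, if_neg hj, Finset.sum_image]
  have hlt : ∀ m m' : ℕ, m < m' → m' ≤ L → eig q r m' (L + 1) < eig q r m (L + 1) := by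
    intro m m' h h'
    have := cos_mul_pi_div_lt (N := L + 1) h (by omega)
    have h3 := mul_lt_mul_of_pos_left this (rho_pos hq hqr)
    simpa only [eig, div_mul_eq_mul_div] using h3
  intro m hm m' hm' h
  simp only [Finset.coe_Icc, mem_Icc] at hm hm'
  rcases lt_trichotomy m m' with h3 | h3 | h3
  · exact absurd h (hlt m m' h3 hm'.2).ne'
  · exact h3
  · exact absurd h (hlt m' m h3 hm.2).ne

/-- The profile of the eigenfunctions with eigenvalue `ρ x`. -/
def profile (q r : ℕ) (s : ℝ) (j : ℕ) (x : ℝ) (t : ℤ) : ℝ :=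
  s ^ t * if j = 0 then (boundaryPoly (ratio q r) t).eval x
    else (Polynomial.Chebyshev.U ℝ t).eval x

/-- Once `s^t` is removed, what remains is the Chebyshev recurrence, obeyed by either choice of
polynomial. -/
lemma profile_rec {s : ℝ} (hs : 0 < s) (hs1 : q * s * s = r)
    (hs2 : rho q r * (q + r) = 2 * (q * s)) (j : ℕ) (x : ℝ) (t : ℤ) :
    q * profile q r s j x (t + 1) + r * profile q r s j x (t - 1) =
      (q + r) * (rho q r * x * profile q r s j x t) := by
  have h3 : (r : ℝ) * s⁻¹ = q * s := by
    rw [← hs1]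
    field_simp
  rw [profile, profile, profile, zpow_add_one₀ hs.ne', zpow_sub_one₀ hs.ne']
  split_ifs with hj
  · have h := eval_boundaryPoly_add_one (c := ratio q r) t x
    linear_combination s ^ t * (boundaryPoly (ratio q r) (t - 1)).eval x * h3 +
      s ^ t * (q * s) * h - s ^ t * x * (boundaryPoly (ratio q r) t).eval x * hs2
  · have h := congrArg (Polynomial.eval x) (Polynomial.Chebyshev.U_add_one ℝ t)
    simp only [Polynomial.eval_sub, Polynomial.eval_mul, Polynomial.eval_X,
      Polynomial.eval_ofNat] at h
    linear_combination s ^ t * (Polynomial.Chebyshev.U ℝ (t - 1)).eval x * h3 +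
      s ^ t * (q * s) * h - s ^ t * x * (Polynomial.Chebyshev.U ℝ t).eval x * hs2

lemma profile_zero (s : ℝ) (j : ℕ) (x : ℝ) : profile q r s j x 0 = 1 := by
  simp [profile, boundaryPoly]

lemma profile_eq_zero (hq : 0 < q) (hqr : q < r) (s : ℝ) {j L : ℕ} {l : ℝ}
    (hl : l ∈ pathSpectrum q r j L) : profile q r s j (l / rho q r) L = 0 := by
  have hρ := (rho_pos hq hqr).ne'
  rw [profile]
  refine mul_eq_zero_of_right _ ?_
  by_cases hj : j = 0
  · rw [pathSpectrum, if_pos hj, Finset.mem_image] at hl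
    obtain ⟨x, hx, rfl⟩ := hl
    rw [if_pos hj, mul_div_cancel_left₀ _ hρ]
    exact (mem_boundaryRoots (ratio_lt_one hq hqr)).1 hx
  · rw [pathSpectrum, if_neg hj, Finset.mem_image] at hl
    obtain ⟨m, hm, rfl⟩ := hl
    rw [Finset.mem_Icc] at hm
    have hL : (0 : ℝ) < ((L + 1 : ℕ) : ℝ) := by positivity
    have hm0 : (0 : ℝ) < m := by exact_mod_cast hm.1
    have hmL : (m : ℝ) < ((L + 1 : ℕ) : ℝ) := by exact_mod_cast Nat.lt_succ_of_le hm.2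
    rw [if_neg hj, eig, mul_div_cancel_left₀ _ hρ]
    have h := Polynomial.Chebyshev.U_real_cos (m / ((L + 1 : ℕ) : ℝ) * Real.pi) L
    have e : (((L : ℤ) : ℝ) + 1) * (m / ((L + 1 : ℕ) : ℝ) * Real.pi) = m * Real.pi := by
      push_cast at hL ⊢
      field_simp
    rw [e, Real.sin_nat_mul_pi] at h
    refine (mul_eq_zero.1 h).resolve_right (Real.sin_pos_of_pos_of_lt_pi (by positivity) ?_).ne'
    rw [div_mul_eq_mul_div, div_lt_iff₀ hL, mul_comm]
    exact mul_lt_mul_of_pos_left hmL Real.pi_pos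

/-- Each pair whose path has `l` in its spectrum contributes one eigenfunction, and different pairs
give orthogonal ones. -/
lemma card_corePairs_le_finrank (hq : 0 < q) (hqr : q < r) (a₁ : Tree q) (a₂ : Tree r) {n : ℕ}
    (hn : -a₂.hor = a₁.hor + n) (l : ℝ) :
    ((corePairs a₁ a₂ n).filter fun i => l ∈ pathSpectrum q r i.1.2.1 (n - i.1.1)).card ≤
      Module.finrank ℝ (Module.End.eigenspace (srwOp (tetraGraph a₁ a₂)) l) := by
  classical
  have : Fintype (tetrahedron a₁ a₂) := Fintype.ofFinite _
  obtain ⟨s, hs, hs1, hs2⟩ := exists_rho_mul_eq hq hqr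
  have hρ := rho_pos hq hqr
  have hl : rho q r * (l / rho q r) = l := mul_div_cancel₀ _ hρ.ne'
  have hmem : ∀ i ∈ (corePairs a₁ a₂ n).filter
      fun i => l ∈ pathSpectrum q r i.1.2.1 (n - i.1.1),
      i.1.2.1 + i.1.2.2 = i.1.1 ∧ i.1.1 < n ∧ (Tree.IsCore a₁ i.2.1 ∧ i.2.1.hor = a₁.hor + i.1.2.1) ∧
      (Tree.IsCore a₂ i.2.2 ∧ i.2.2.hor = a₂.hor + ((i.1.2.2 + 1 : ℕ) : ℤ)) ∧
      l ∈ pathSpectrum q r i.1.2.1 (n - i.1.1) := by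
    rintro ⟨⟨k, j, i⟩, w, v⟩ h
    simp only [corePairs, Finset.mem_filter, Finset.mem_sigma, Finset.mem_range,
      Finset.HasAntidiagonal.mem_antidiagonal, Finset.mem_product] at h
    obtain ⟨⟨⟨h1, h2⟩, h3, h4⟩, h5⟩ := h
    exact ⟨h2, h1, Tree.mem_cores _ h3, Tree.mem_cores _ h4, h5⟩
  refine card_le_finrank_eigenspace _ l _
    (fun i x => profileFun a₁ i.2.1 a₂ i.2.2 (profile q r s i.1.2.1 (l / rho q r)) x.1) ?_ ?_ ?_
  · intro i hi
    obtain ⟨h1, h2, ⟨h3, h4⟩, ⟨h5, h6⟩, h7⟩ := hmem i hi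
    refine srwOp_profileFun hq h3 h5 (by omega) ?_ ?_ ?_ ?_
    · intro t _ _
      rw [profile_rec hs hs1 hs2, hl]
    -- The generations from `w` to `v` number `n - k`, so the first position past the far end is the
    -- path length.
    · have e : -i.2.1.hor - i.2.2.hor + 1 = ((n - i.1.1 : ℕ) : ℤ) := by omega
      rw [e]
      exact profile_eq_zero hq hqr s h7
    · intro h
      rw [profile, if_neg (by omega)]
      simp
    · intro h
      have hj : i.1.2.1 = 0 := by omega
      have hqr0 : (0 : ℝ) < r + q := by exact_mod_cast (by omega : 0 < r + q)
      have h1c : 1 - ratio q r = 2 * q / (r + q) := by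
        rw [ratio]
        field_simp
        ring
      -- The coefficient `c = (r-q)/(r+q)` is exactly the one for which the profile satisfies the
      -- reflecting condition `p(1) = l p(0)`.
      have hsc : s * (1 - ratio q r) = rho q r := by
        rw [h1c]
        field_simp
        linear_combination -hs2
      rw [profile_zero, profile, if_pos hj]
      have e : (boundaryPoly (ratio q r) 1).eval (l / rho q r) =
          (1 - ratio q r) * (l / rho q r) := by
        simp [boundaryPoly]
        ring
      rw [e, zpow_one, ← mul_assoc, hsc, hl, mul_one]
  · intro i hi
    obtain ⟨h1, h2, ⟨h3, h4⟩, ⟨h5, h6⟩, h7⟩ := hmem i hi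
    exact profileFun_ne_zero h3 h5 (by omega) (by rw [profile_zero]; exact one_ne_zero)
  · intro i hi i' hi' hne
    obtain ⟨h1, h2, ⟨h3, h4⟩, ⟨h5, h6⟩, h7⟩ := hmem i hi
    obtain ⟨h1', h2', ⟨h3', h4'⟩, ⟨h5', h6'⟩, h7'⟩ := hmem i' hi'
    by_cases hw : i.2.1 = i'.2.1
    · by_cases hv : i.2.2 = i'.2.2
      · refine absurd ?_ hne
        rw [hw] at h4
        rw [hv] at h6
        obtain ⟨⟨k, j, i⟩, w, v⟩ := i
        obtain ⟨⟨k', j', i'⟩, w', v'⟩ := i'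
        simp only at *
        obtain rfl : j = j' := by omega
        obtain rfl : i = i' := by omega
        obtain rfl : k = k' := by omega
        rw [hw, hv]
      · exact sum_profileFun_mul_of_right_ne h5 h5' hv _ _
    · exact sum_profileFun_mul_of_left_ne h3 h3' hw _ _

/-- The sum of `f` over the spectra of all paths, grouped by the lengths of the paths. -/
lemma sum_corePairs (hq : 0 < q) (hqr : q < r) (a₁ : Tree q) (a₂ : Tree r) (n : ℕ) (f : ℝ → ℝ) :
    (∑ i ∈ corePairs a₁ a₂ n, ∑ l ∈ pathSpectrum q r i.1.2.1 (n - i.1.1), f l) * (r - q) =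
      ∑ j ∈ Finset.range n, ((r : ℝ) - 1) *
        ((r - q) * (r : ℝ) ^ (n - 1 - j) *
            (∑ x ∈ boundaryRoots (ratio q r) (j + 1), f (rho q r * x)) +
          ((q : ℝ) - 1) * ((r : ℝ) ^ (n - 1 - j) - (q : ℝ) ^ (n - 1 - j)) *
            ∑ m ∈ Finset.Icc 1 (j + 1), f (eig q r m (j + 2))) := by
  set A : ℕ → ℝ := fun L => ∑ m ∈ Finset.Icc 1 L, f (eig q r m (L + 1))
  set B : ℕ → ℝ := fun L => ∑ x ∈ boundaryRoots (ratio q r) L, f (rho q r * x)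
  have hr1 : 1 ≤ r := by omega
  -- Generation `0` of `w` gives the reflecting paths, `(r-1) r^k` of them; the other generations
  -- give a geometric sum `∑ q^i r^j`.
  have hanti : ∀ k L : ℕ, (∑ p ∈ Finset.HasAntidiagonal.antidiagonal k, ((a₁.cores p.1).card : ℝ) *
      (a₂.cores (p.2 + 1)).card * ∑ l ∈ pathSpectrum q r p.1 L, f l) * (r - q) =
      ((r : ℝ) - 1) * ((r - q) * (r : ℝ) ^ k * B L +
        ((q : ℝ) - 1) * ((r : ℝ) ^ k - (q : ℝ) ^ k) * A L) := by
    intro k L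
    have h0 : (a₁.cores 0).card = 1 := by simp [Tree.cores]
    rcases k with _ | k
    · simp only [Finset.Nat.antidiagonal_zero, Finset.sum_singleton, h0, Tree.card_cores_succ,
        sum_pathSpectrum_zero hq hqr]
      push_cast [hr1]
      simp only [B]
      ring
    · rw [Finset.Nat.sum_antidiagonal_succ]
      simp only [h0, Tree.card_cores_succ, sum_pathSpectrum_zero hq hqr,
        sum_pathSpectrum_of_ne_zero hq hqr (Nat.succ_ne_zero _)]
      have hgeom : (∑ p ∈ Finset.HasAntidiagonal.antidiagonal k, (q : ℝ) ^ p.1 * (r : ℝ) ^ p.2) * (r - q) =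
          (r : ℝ) ^ (k + 1) - (q : ℝ) ^ (k + 1) := by
        rw [Finset.Nat.sum_antidiagonal_eq_sum_range_succ fun i j => (q : ℝ) ^ i * (r : ℝ) ^ j]
        have := geom_sum₂_mul (q : ℝ) (r : ℝ) (k + 1)
        simp only [Nat.add_sub_cancel] at this
        linear_combination -this
      have hsum : ∑ p ∈ Finset.HasAntidiagonal.antidiagonal k, (((q - 1) * q ^ p.1 : ℕ) : ℝ) *
          (((r - 1) * r ^ p.2 : ℕ) : ℝ) * ∑ m ∈ Finset.Icc 1 L, f (eig q r m (L + 1)) =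
          ((q : ℝ) - 1) * ((r : ℝ) - 1) * A L *
            ∑ p ∈ Finset.HasAntidiagonal.antidiagonal k, (q : ℝ) ^ p.1 * (r : ℝ) ^ p.2 := by
        rw [Finset.mul_sum]
        refine Finset.sum_congr rfl fun p _ => ?_
        push_cast [hr1, show 1 ≤ q from hq]
        simp only [A]
        ring
      rw [hsum]
      push_cast [hr1]
      simp only [B]
      linear_combination ((q : ℝ) - 1) * ((r : ℝ) - 1) * A L * hgeom
  rw [corePairs, Finset.sum_sigma, Finset.sum_sigma]
  simp only [Finset.sum_const, Finset.card_product, nsmul_eq_mul, Nat.cast_mul]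
  -- Reversing the order of summation makes the path length `j + 1` the index instead of the
  -- generation sum `k = n - 1 - j`.
  rw [Finset.sum_mul, Finset.sum_congr rfl fun k _ => hanti k (n - k), ← Finset.sum_range_reflect]
  refine Finset.sum_congr rfl fun j hj => ?_
  have hj' := Finset.mem_range.1 hj
  have e : n - (n - 1 - j) = j + 1 := by omega
  rw [e]

end Spectrum

/-! ## The limit of the cumulative spectral measures -/

section Limit

variable {q r : ℕ}

/-- The normalized sum of `f` over the spectra of the paths in a tetrahedron of height `n`. -/
def pathMean (q r n : ℕ) (f : ℝ → ℝ) : ℝ :=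
  ((r : ℝ) ^ (n + 1) - (q : ℝ) ^ (n + 1))⁻¹ * ∑ j ∈ Finset.range n, ((r : ℝ) - 1) *
    ((r - q) * (r : ℝ) ^ (n - 1 - j) *
        (∑ x ∈ boundaryRoots (ratio q r) (j + 1), f (rho q r * x)) +
      ((q : ℝ) - 1) * ((r : ℝ) ^ (n - 1 - j) - (q : ℝ) ^ (n - 1 - j)) *
        ∑ m ∈ Finset.Icc 1 (j + 1), f (eig q r m (j + 2)))

/-- Dividing by `r^(n+1)` makes the summands independent of `n`. The terms with `q^(n-1-j)` are
collected in a last sum with the vanishing prefactor `(q/r)^(n+1)`. -/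
lemma pathMean_eq (hq : 0 < q) (hqr : q < r) (n : ℕ) (f : ℝ → ℝ) :
    pathMean q r n f = (1 - ((q : ℝ) / r) ^ (n + 1))⁻¹ *
      (∑ j ∈ Finset.range n, boundaryWeight q r (j + 1) *
          (∑ x ∈ boundaryRoots (ratio q r) (j + 1), f (rho q r * x)) +
        ∑ j ∈ Finset.range n, innerWeight q r (j + 2) *
          (∑ m ∈ Finset.Icc 1 (j + 1), f (eig q r m (j + 2))) -
        ((q : ℝ) / r) ^ (n + 1) * ∑ j ∈ Finset.range n, ((r : ℝ) - 1) * (q - 1) / q ^ (j + 2) *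
          ∑ m ∈ Finset.Icc 1 (j + 1), f (eig q r m (j + 2))) := by
  have h0 : (0 : ℝ) < q := by exact_mod_cast hq
  have h1 : (0 : ℝ) < r := by exact_mod_cast hq.trans hqr
  have e1 : (r : ℝ) ^ (n + 1) - (q : ℝ) ^ (n + 1) =
      (r : ℝ) ^ (n + 1) * (1 - ((q : ℝ) / r) ^ (n + 1)) := by
    rw [div_pow]
    field_simp
  rw [pathMean, e1, mul_inv_rev, mul_assoc]
  congr 1
  rw [Finset.mul_sum, Finset.mul_sum, ← Finset.sum_add_distrib, ← Finset.sum_sub_distrib]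
  refine Finset.sum_congr rfl fun j hj => ?_
  have hj' := Finset.mem_range.1 hj
  obtain ⟨m, rfl⟩ : ∃ m, n = m + 1 + j := ⟨n - 1 - j, by omega⟩
  have e2 : m + 1 + j - 1 - j = m := by omega
  rw [e2, boundaryWeight, innerWeight, div_pow]
  have e3 : ∀ x : ℝ, x ^ (m + 1 + j + 1) = x ^ m * x ^ (j + 2) := fun x => by ring
  rw [e3, e3]
  field_simp
  ring

lemma abs_sum_le_mul_norm {ι : Type*} (s : Finset ι) (x : ι → ℝ) (f : ℝ →ᵇ ℝ) :
    |∑ i ∈ s, f (x i)| ≤ s.card * ‖f‖ := by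
  refine (Finset.abs_sum_le_sum_abs _ _).trans ?_
  rw [← nsmul_eq_mul]
  exact Finset.sum_le_card_nsmul _ _ _ fun i _ => f.norm_coe_le_norm (x i)

lemma hasSum_integral_sum_levelMeasure (hq : 2 ≤ q) (hqr : q < r) (f : ℝ →ᵇ ℝ) :
    Summable (fun N => boundaryWeight q r N *
      ∑ x ∈ boundaryRoots (ratio q r) N, f (rho q r * x)) ∧
    Summable (fun N => innerWeight q r N * ∑ m ∈ Finset.Icc 1 (N - 1), f (eig q r m N)) ∧
    ∫ t, f t ∂(Measure.sum (levelMeasure q r)) =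
      (∑' N, boundaryWeight q r N * ∑ x ∈ boundaryRoots (ratio q r) N, f (rho q r * x)) +
        ∑' N, innerWeight q r N * ∑ m ∈ Finset.Icc 1 (N - 1), f (eig q r m N) := by
  have hq0 : 0 < q := by omega
  have hmass := (hasSum_levelMass hq hqr).summable.mul_right ‖f‖
  have hB : Summable (fun N => boundaryWeight q r N *
      ∑ x ∈ boundaryRoots (ratio q r) N, f (rho q r * x)) := by
    refine Summable.of_norm_bounded hmass fun N => ?_
    have h1 := (innerWeight_pos hq hqr N).le
    have h2 := (boundaryWeight_pos hq hqr N).le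
    have h3 := abs_sum_le_mul_norm (boundaryRoots (ratio q r) N) (fun x => rho q r * x) f
    rw [card_boundaryRoots (ratio_pos hqr) (ratio_lt_one hq0 hqr)] at h3
    rw [norm_mul, Real.norm_of_nonneg h2, add_mul, mul_assoc _ (N : ℝ)]
    exact (mul_le_mul_of_nonneg_left h3 h2).trans (le_add_of_nonneg_left (by positivity))
  have hA : Summable (fun N => innerWeight q r N *
      ∑ m ∈ Finset.Icc 1 (N - 1), f (eig q r m N)) := by
    refine Summable.of_norm_bounded hmass fun N => ?_
    have h1 := (innerWeight_pos hq hqr N).le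
    have h2 := (boundaryWeight_pos hq hqr N).le
    have h3 := abs_sum_le_mul_norm (Finset.Icc 1 (N - 1)) (fun m => eig q r m N) f
    rw [Nat.card_Icc, Nat.add_sub_cancel] at h3
    rw [norm_mul, Real.norm_of_nonneg h1, add_mul, mul_assoc]
    exact (mul_le_mul_of_nonneg_left h3 h1).trans (le_add_of_nonneg_right (by positivity))
  have := isProbabilityMeasure_sum_levelMeasure hq hqr
  have hint := hasSum_integral_measure (f.integrable (Measure.sum (levelMeasure q r)))
  simp only [integral_levelMeasure hq hqr] at hint
  refine ⟨hB, hA, ?_⟩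
  rw [add_comm]
  exact hint.unique (hA.hasSum.add hB.hasSum)

lemma summable_correction (hq : 2 ≤ q) (hqr : q < r) (f : ℝ →ᵇ ℝ) :
    Summable (fun j : ℕ => ((r : ℝ) - 1) * (q - 1) / q ^ (j + 2) *
      ∑ m ∈ Finset.Icc 1 (j + 1), f (eig q r m (j + 2))) := by
  have h0 : (2 : ℝ) ≤ q := by exact_mod_cast hq
  have h1 : (q : ℝ) < r := by exact_mod_cast hqr
  have hq0 : (q : ℝ) ≠ 0 := by linarith
  have hlt : ‖(q : ℝ)⁻¹‖ < 1 := by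
    rw [Real.norm_of_nonneg (by positivity)]
    exact inv_lt_one_of_one_lt₀ (by linarith)
  have hs : Summable fun j : ℕ => ((j + 1 : ℕ) : ℝ) * (q : ℝ)⁻¹ ^ (j + 1) :=
    (summable_nat_add_iff (f := fun n : ℕ => (n : ℝ) * (q : ℝ)⁻¹ ^ n) 1).2
      (hasSum_coe_mul_geometric_of_norm_lt_one hlt).summable
  have hs' := hs.mul_left (((r : ℝ) - 1) * (q - 1) / q * ‖f‖)
  refine Summable.of_norm_bounded hs' fun j => ?_
  have h3 := abs_sum_le_mul_norm (Finset.Icc 1 (j + 1)) (fun m => eig q r m (j + 2)) f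
  rw [Nat.card_Icc, Nat.add_sub_cancel] at h3
  have h4 : (0 : ℝ) ≤ ((r : ℝ) - 1) * (q - 1) / q ^ (j + 2) :=
    div_nonneg (mul_nonneg (by linarith) (by linarith)) (by positivity)
  rw [norm_mul, Real.norm_of_nonneg h4]
  refine (mul_le_mul_of_nonneg_left h3 h4).trans (le_of_eq ?_)
  rw [inv_pow, pow_succ _ (j + 1)]
  field_simp

lemma tendsto_pathMean (hq : 2 ≤ q) (hqr : q < r) (f : ℝ →ᵇ ℝ) :
    Tendsto (fun n => pathMean q r n f) atTop
      (𝓝 (∫ t, f t ∂(Measure.sum (levelMeasure q r)))) := by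
  have hq0 : 0 < q := by omega
  have h0 : (2 : ℝ) ≤ q := by exact_mod_cast hq
  have h1 : (q : ℝ) < r := by exact_mod_cast hqr
  obtain ⟨hB, hA, hint⟩ := hasSum_integral_sum_levelMeasure hq hqr f
  have hθ : Tendsto (fun n : ℕ => ((q : ℝ) / r) ^ (n + 1)) atTop (𝓝 0) :=
    (tendsto_pow_atTop_nhds_zero_of_lt_one (div_nonneg (by linarith) (by linarith))
      ((div_lt_one (by linarith)).2 h1)).comp (tendsto_add_atTop_nat 1)
  have hκ : Tendsto (fun n : ℕ => (1 - ((q : ℝ) / r) ^ (n + 1))⁻¹) atTop (𝓝 1) := by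
    have := (tendsto_const_nhds (x := (1 : ℝ))).sub hθ
    rw [sub_zero] at this
    simpa using this.inv₀ one_ne_zero
  -- The shifts lose nothing: level `0` has no boundary roots, and levels `0` and `1` have no inner
  -- eigenvalues.
  have hB1 := ((hasSum_nat_add_iff' 1).2 hB.hasSum).tendsto_sum_nat
  have hA1 := ((hasSum_nat_add_iff' 2).2 hA.hasSum).tendsto_sum_nat
  simp only [Finset.sum_range_succ, Finset.sum_range_zero, boundaryRoots_zero, Finset.sum_empty,
    mul_zero, add_zero, sub_zero, zero_tsub, tsub_self, Nat.lt_one_iff, pos_of_gt,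
    Finset.Icc_eq_empty_of_lt] at hB1 hA1
  have hC := summable_correction hq hqr f
  have hlim := hκ.mul ((hB1.add hA1).sub (hθ.mul hC.hasSum.tendsto_sum_nat))
  rw [zero_mul, sub_zero, one_mul, ← hint] at hlim
  exact hlim.congr fun n => (pathMean_eq hq0 hqr n f).symm

lemma card_pathSpectrum_sum (hq : 0 < q) (hqr : q < r) (a₁ : Tree q) (a₂ : Tree r) {n : ℕ}
    (hn : -a₂.hor = a₁.hor + n) (f : ℝ → ℝ) :
    (Nat.card (tetrahedron a₁ a₂) : ℝ)⁻¹ *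
      ∑ i ∈ corePairs a₁ a₂ n, ∑ l ∈ pathSpectrum q r i.1.2.1 (n - i.1.1), f l =
      pathMean q r n f := by
  have h1 : (q : ℝ) < r := by exact_mod_cast hqr
  have h2 : (r : ℝ) - q ≠ 0 := by linarith
  rw [pathMean, ← sum_corePairs hq hqr a₁ a₂, ← card_tetrahedron_mul a₁ a₂ hn]
  rw [mul_inv]
  field_simp

lemma nonempty_tetrahedron (hq : 0 < q) (hqr : q < r) (a₁ : Tree q) (a₂ : Tree r) {n : ℕ}
    (hn : -a₂.hor = a₁.hor + n) : Nonempty (tetrahedron a₁ a₂) := by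
  rw [← Finite.card_pos_iff, card_tetrahedron a₁ a₂ hn]
  have hr : 0 < r := by omega
  exact Finset.sum_pos (fun _ _ => by positivity) ⟨0, by simp⟩

lemma abs_integral_sub_pathMean_le (hq : 0 < q) (hqr : q < r) (a₁ : Tree q) (a₂ : Tree r) {n : ℕ}
    (hn : -a₂.hor = a₁.hor + n) (f : ℝ →ᵇ ℝ) :
    |∫ t, f t ∂(cumulativeSpectralMeasure (tetraGraph a₁ a₂)) - pathMean q r n f| ≤
      ‖f‖ * (1 - pathMean q r n fun _ => 1) := by
  have : Fintype (tetrahedron a₁ a₂) := Fintype.ofFinite _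
  have := nonempty_tetrahedron hq hqr a₁ a₂ hn
  have h := abs_integral_cumulativeSpectralMeasure_sub_le (tetraGraph a₁ a₂) (corePairs a₁ a₂ n)
    (fun i => pathSpectrum q r i.1.2.1 (n - i.1.1)) (card_corePairs_le_finrank hq hqr a₁ a₂ hn) f
  rw [card_pathSpectrum_sum hq hqr a₁ a₂ hn] at h
  rw [← card_pathSpectrum_sum hq hqr a₁ a₂ hn fun _ => 1]
  simpa using h

lemma tendsto_integral_cumulativeSpectralMeasure (hq : 2 ≤ q) (hqr : q < r) (a₁ : ℕ → Tree q)
    (a₂ : ℕ → Tree r) (h : ℕ → ℕ) (hn : ∀ n, -(a₂ n).hor = (a₁ n).hor + (h n : ℤ))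
    (hh : Tendsto h atTop atTop) (f : ℝ →ᵇ ℝ) :
    Tendsto (fun n => ∫ t, f t ∂(cumulativeSpectralMeasure (tetraGraph (a₁ n) (a₂ n)))) atTop
      (𝓝 (∫ t, f t ∂(Measure.sum (levelMeasure q r)))) := by
  have hq0 : 0 < q := by omega
  have h1 := (tendsto_pathMean hq hqr f).comp hh
  have := isProbabilityMeasure_sum_levelMeasure hq hqr
  -- The same limit for the constant `1` shows that the fraction of eigenvalues accounted for tends
  -- to the total mass, which is one; this makes the error bound vanish.
  have h2 := (tendsto_pathMean hq hqr (BoundedContinuousFunction.const ℝ 1)).comp hh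
  simp only [BoundedContinuousFunction.const_apply, integral_const, probReal_univ, smul_eq_mul,
    mul_one] at h2
  have h3 : Tendsto (fun n => ‖f‖ * (1 - pathMean q r (h n) fun _ => 1)) atTop (𝓝 0) := by
    have := ((tendsto_const_nhds (x := (1 : ℝ))).sub h2).const_mul ‖f‖
    rw [sub_self, mul_zero] at this
    exact this
  have h4 := squeeze_zero_norm
    (f := fun n => ∫ t, f t ∂(cumulativeSpectralMeasure (tetraGraph (a₁ n) (a₂ n))) -
      pathMean q r (h n) f)
    (fun n => abs_integral_sub_pathMean_le hq0 hqr (a₁ n) (a₂ n) (hn n) f) h3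
  have h5 := h4.add h1
  rw [zero_add] at h5
  exact h5.congr fun n => sub_add_cancel _ _

end Limit

end DiestelLeader

end

/-! ### The theorem -/

theorem proposition6p5 (q r : ℕ) (hq : 2 ≤ q) (hqr : q < r) :
    (∃ α : ℕ → ℕ → ℝ, DiestelLeader.IsAngleFamily q r α) ∧
    ∀ α : ℕ → ℕ → ℝ, DiestelLeader.IsAngleFamily q r α →
      -- weak convergence along tetrahedra whose heights tend to infinity
      (∀ (a₁ : ℕ → DiestelLeader.Tree q) (a₂ : ℕ → DiestelLeader.Tree r) (h : ℕ → ℕ),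
        (∀ n, -(a₂ n).hor = (a₁ n).hor + (h n : ℤ)) → Tendsto h atTop atTop →
        ∀ f : ℝ →ᵇ ℝ,
          Tendsto
            (fun n => ∫ t, f t ∂(DiestelLeader.cumulativeSpectralMeasure
              (DiestelLeader.tetraGraph (a₁ n) (a₂ n))))
            atTop
            (𝓝 (∫ t, f t ∂(DiestelLeader.muTilde q r α + DiestelLeader.nuTilde q r α)))) ∧
      IsProbabilityMeasure (DiestelLeader.muTilde q r α + DiestelLeader.nuTilde q r α) ∧
      -- the support of the first part
      (DiestelLeader.muTilde q r α).support =
        Icc (-DiestelLeader.rho q r) (DiestelLeader.rho q r) ∧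
      -- the second part is carried by its set of atoms, which lies outside that interval
      DiestelLeader.nuTilde q r α (DiestelLeader.bigEigSet q r α)ᶜ = 0 ∧
      (∀ t, DiestelLeader.nuTilde q r α {t} ≠ 0 ↔ t ∈ DiestelLeader.bigEigSet q r α) ∧
      DiestelLeader.bigEigSet q r α ⊆
        Ioo (-1) (-DiestelLeader.rho q r) ∪ Ioo (DiestelLeader.rho q r) 1 ∧
      (DiestelLeader.nuTilde q r α).support ⊆
        Icc (-1) (-DiestelLeader.rho q r) ∪ Icc (DiestelLeader.rho q r) 1 ∧
      -- the positive atoms increase to one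
      StrictMonoOn (DiestelLeader.bigEig q r α)
        {N : ℕ | DiestelLeader.threshold q r < (N : ℝ)} ∧
      Tendsto (DiestelLeader.bigEig q r α) atTop (𝓝 1) ∧
      -- the limit is not the Plancherel measure
      ∀ x : DiestelLeader.DL q r,
        ¬ DiestelLeader.IsSpectralMeasureAt (DiestelLeader.dlGraph q r) x
          (DiestelLeader.muTilde q r α + DiestelLeader.nuTilde q r α) := by
  have hq0 : 0 < q := by omega
  refine ⟨DiestelLeader.exists_isAngleFamily hq0 hqr, fun α hα => ⟨?_, ?_,
    DiestelLeader.muTilde_support hq hqr, DiestelLeader.nuTilde_compl_bigEigSet hq hqr,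
    DiestelLeader.nuTilde_singleton_ne_zero_iff hq hqr, hα.bigEigSet_subset hq0 hqr,
    hα.nuTilde_support_subset hq hqr, hα.strictMonoOn_bigEig hq0 hqr,
    hα.tendsto_bigEig hq0 hqr, fun x => ?_⟩⟩
  · intro a₁ a₂ h hn hh f
    rw [hα.muTilde_add_nuTilde hq0 hqr]
    exact DiestelLeader.tendsto_integral_cumulativeSpectralMeasure hq hqr a₁ a₂ h hn hh f
  · rw [hα.muTilde_add_nuTilde hq0 hqr]
    exact DiestelLeader.isProbabilityMeasure_sum_levelMeasure hq hqr
  -- Any single atom of the second part beyond `ρ` rules out the Plancherel measure.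
  · obtain ⟨N, hN⟩ := exists_nat_gt (DiestelLeader.threshold q r)
    refine DiestelLeader.not_isSpectralMeasureAt_dlGraph hq0 hqr (hα.rho_lt_bigEig hq0 hqr hN)
      (fun h0 => ?_) x
    rw [Measure.add_apply, add_eq_zero] at h0
    exact (DiestelLeader.nuTilde_singleton_ne_zero_iff hq hqr _).2 ⟨N, hN, Or.inl rfl⟩ h0.2
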